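/- Let $R$ be an associative unital ring which is free as a $\mathbb{Z}$-module, and let $I$ be a $\mathbb{Z}$-basis of $R$. View $\mathbb{Q}\otimes_{\mathbb Z} R$ as a Lie algebra under the commutator, and let $$\mathcal G_\infty^{\mathbb Q}(R)=\bigotimes_{l\ge 1}U(\mathbb Q\otimes R)$$ be the infinite tensor product (spanned by pure tensors with all but finitely many factors equal to $1$) of copies of its universal enveloping algebra. Let $T_l(x)$ be the image of $x\in\mathbb Q\otimes R$ in the $l$-th factor, and extend $T_l$ coefficientwise to formal power series. For a power series $x$ over $\mathbb Q\otimes R$ with constant term $1$ put $\Theta_l(x)=\exp(T_l(\log x))$. For every $U\in R$ define $e_r(U)\in \mathcal G_\infty^{\mathbb Q}(R)$ by $$E_U(t)=\sum_{r\ge 0}e_r(U)t^r=\prod_{l\ge 1}\Theta_l\bigl(1-(-t)^lU\bigr).$$ For each $U\in I$ let $\mathbf x_U=(x_{U,i})_{i\in\mathbb N}$ be a set of variables, and let $s_\lambda(\mathbf x_U)$ and $p_l(\mathbf x_U)=\sum_i x_{U,i}^l$ be the Schur functions and power sums in these variables. For multipartitions $\vec\lambda=(\vec\lambda(U))_{U\in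 I}$ of finite total size define $Z_{\vec\lambda}\in\mathcal G_\infty^{\mathbb Q}(R)$ by $$\sum_{\vec\lambda}\Bigl(\prod_{U\in I}s_{\vec\lambda(U)}(\mathbf x_U)\Bigr)\otimes Z_{\vec\lambda}=\prod_{l\ge 1}\Theta_l\Bigl(1+\sum_{U\in I}p_l(\mathbf x_U)\,U\Bigr),$$ and let $\mathcal G_\infty^{\mathbb Z}(R)$ be the $\mathbb Z$-span of the $Z_{\vec\lambda}$. Let $\mu$ be the Möbius function. **Theorem.** (a) In $\mathcal G_\infty^{\mathbb Q}(R)$ one has, for all $U,V\in R$, the equality of power series in $u,v$ $$E_U(u)\,E_{VU}(-uv)^{-1}\,E_V(v)=E_V(v)\,E_{UV}(-uv)^{-1}\,E_U(u),\qquad(1)$$ and, for every $W=\sum_{U\in I}a_UU$ in $R$ with $a_U\in\mathbb Z$, $$\sum_{r\ge1}\frac{\mu(r)}{r}\log\bigl(E_{W^r}(-t^r)\bigr)=\sum_{U\in I}a_U\sum_{r\ge1}\frac{\mu(r)}{r}\log\bigl(E_{U^r}(-t^r)\bigr).\qquad(2)$$ (b) These relations present the $\mathbb Q$-algebra $\mathcal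 G_\infty^{\mathbb Q}(R)$ on the generators $e_r(U)$, $U\in I$, $r\ge1$. Precisely, let $F$ be the free $\mathbb Q$-algebra on symbols $e_r(U)$ ($U\in I$, $r\geq 1$). There is exactly one family of series $\mathcal E_W(t)\in 1+tF[[t]]$, $W\in R$, with $\mathcal E_U(t)=1+\sum_{r\ge1}e_r(U)t^r$ for $U\in I$ which satisfies (2) for all $W\in R$ (with $\mathcal E$ in place of $E$). The homomorphism $F\to\mathcal G_\infty^{\mathbb Q}(R)$ taking each symbol $e_r(U)$ to the element $e_r(U)$ takes $\mathcal E_W(t)$ to $E_W(t)$ for every $W\in R$, and it induces an isomorphism onto $\mathcal G_\infty^{\mathbb Q}(R)$ from the quotient of $F$ by the relations (1) for $U,V\in I$ (with $\mathcal E$ in place of $E$, compared coefficientwise). (c) The family $(Z_{\vec\lambda})$ exists and is unique, and $\mathcal G_\infty^{\mathbb Z}(R)$ is the $\mathbb Z$-subalgebra of $\mathcal G_\infty^{\mathbb Q}(R)$ generated by the $e_r(U)$, $U\in I$, $r\ge1$. -/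

import Mathlib

open scoped TensorProduct

noncomputable section

namespace WreathGrothendieck

/-! ### Formal power series over a noncommutative `ℚ`-algebra

The variables commute with each other and with the coefficients. -/

section Series

variable {σ : Type*} {A : Type*} [Ring A]

/-- The series whose coefficient at the monomial `x^m` is `c m`. -/
def ofCoeff {B : Type*} (c : (σ →₀ ℕ) → B) : MvPowerSeries σ B := c

theorem coeff_ofCoeff (c : (σ →₀ ℕ) → A) (m : σ →₀ ℕ) :
    MvPowerSeries.coeff m (ofCoeff c) = c m := rfl

/-- The series `f(c · x^d)` in the variables `x`, for a one-variable series `f`, an integer `c` and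
a monomial `x^d` with `d ≠ 0`. -/
def substMonomial (f : PowerSeries A) (c : ℤ) (d : σ →₀ ℕ) : MvPowerSeries σ A :=
  open Classical in
  ofCoeff fun m => ∑ n ∈ Finset.range (m.degree + 1),
    if n • d = m then c ^ n • PowerSeries.coeff n f else 0

/-- The infinite product `f 1 * f 2 * f 3 * ⋯` of series such that `f l` is `1` plus terms of
degree at least `l`: the coefficient of a monomial of degree `N` is that of `f 1 * ⋯ * f N`. -/
def infProd (f : ℕ+ → MvPowerSeries σ A) : MvPowerSeries σ A :=
  ofCoeff fun m => MvPowerSeries.coeff m ((List.range m.degree).map fun l => f l.succPNat).prod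

/-- The inverse of a series with constant term `1`. -/
def seriesInv (f : MvPowerSeries σ A) : MvPowerSeries σ A := MvPowerSeries.invOfUnit f 1

variable [Algebra ℚ A]

/-- The exponential `∑_{k ≥ 0} f^k / k!` of a series without constant term. The powers `f^k` with
`k > N` do not contribute to the coefficient of a monomial of degree `N`. -/
def seriesExp (f : MvPowerSeries σ A) : MvPowerSeries σ A :=
  ofCoeff fun m => ∑ k ∈ Finset.range (m.degree + 1),
    (1 / (k.factorial : ℚ)) • MvPowerSeries.coeff m (f ^ k)

/-- The logarithm `∑_{k ≥ 1} (-1)^(k+1) (f - 1)^k / k` of a series with constant term `1`. -/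
def seriesLog (f : MvPowerSeries σ A) : MvPowerSeries σ A :=
  ofCoeff fun m => ∑ k ∈ Finset.Icc 1 m.degree,
    ((-1 : ℚ) ^ (k + 1) / (k : ℚ)) • MvPowerSeries.coeff m ((f - 1) ^ k)

end Series

/-! ### The algebra `G_∞^ℚ(R)` -/

section Enveloping

attribute [local instance] LieRing.ofAssociativeRing LieAlgebra.ofAssociativeAlgebra

/-- The universal enveloping algebra of an associative `ℚ`-algebra `A`, viewed as a Lie algebra
through the commutator bracket. -/
abbrev EnvAssoc (A : Type*) [Ring A] [Algebra ℚ A] := UniversalEnvelopingAlgebra ℚ A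

/-- The canonical map `A → U(A)`. -/
def toEnv (A : Type*) [Ring A] [Algebra ℚ A] : A →ₗ[ℚ] EnvAssoc A :=
  (UniversalEnvelopingAlgebra.ι ℚ : A →ₗ⁅ℚ⁆ EnvAssoc A).toLinearMap

end Enveloping

section Rational

variable (R : Type*) [Ring R]

/-- The `ℚ`-algebra `ℚ ⊗ R`. -/
def RatExt : Type _ := ℚ ⊗[ℤ] R

instance : Ring (RatExt R) := inferInstanceAs (Ring (ℚ ⊗[ℤ] R))

instance : Algebra ℚ (RatExt R) := inferInstanceAs (Algebra ℚ (ℚ ⊗[ℤ] R))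

/-- The canonical map `R → ℚ ⊗ R`, `U ↦ 1 ⊗ U`. -/
def toRatExt : R →+* RatExt R :=
  ((Algebra.TensorProduct.includeRight : R →ₐ[ℤ] ℚ ⊗[ℤ] R) : R →+* ℚ ⊗[ℤ] R)

/-- The universal enveloping algebra `U(ℚ ⊗ R)`. -/
abbrev Env := EnvAssoc (RatExt R)

/-- `G_∞^ℚ(R) = ⨂_{i ≥ 1} U(ℚ ⊗ R)`. The infinite tensor product is the restricted one, spanned by
the pure tensors all but finitely many of whose factors are `1`: the subalgebra generated by the
tensor factors inside the full tensor product `⨂[ℚ] i`. -/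
def rationalSubalgebra : Subalgebra ℚ (⨂[ℚ] _i : ℕ+, Env R) :=
  ⨆ i : ℕ+, (PiTensorProduct.singleAlgHom (R := ℚ) (A := fun _ : ℕ+ => Env R) i).range

/-- The `ℚ`-algebra `G_∞^ℚ(R)`. -/
abbrev GQ := rationalSubalgebra R

/-- `T_l(r)`: the image of `r ∈ ℚ ⊗ R` under the canonical map to the `l`-th tensor factor. -/
def T (l : ℕ+) : (RatExt R) →ₗ[ℚ] GQ R :=
  ((Subalgebra.inclusion (le_iSup (fun i : ℕ+ =>
      (PiTensorProduct.singleAlgHom (R := ℚ) (A := fun _ : ℕ+ => Env R) i).range) l)).comp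
    (PiTensorProduct.singleAlgHom (R := ℚ)
      (A := fun _ : ℕ+ => Env R) l).rangeRestrict).toLinearMap ∘ₗ
    toEnv (RatExt R)

variable {R} {σ : Type*}

/-- `Θ_l(x) = exp(T_l(log x))` for a series `x` with constant term `1`; here `T_l` is applied
coefficientwise. -/
def Theta (l : ℕ+) (x : MvPowerSeries σ (RatExt R)) : MvPowerSeries σ (GQ R) :=
  seriesExp (ofCoeff fun m => T R l (MvPowerSeries.coeff m (seriesLog x)))

/-- `E_U(t) = ∏_{l ≥ 1} Θ_l(1 - (-t)^l U)`, for every `U ∈ R`. -/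
def E (U : R) : PowerSeries (GQ R) :=
  infProd fun l => Theta l (1 - (-PowerSeries.X) ^ (l : ℕ) * PowerSeries.C (toRatExt R U))

/-- `e_r(U)`, the coefficient of `t^r` in `E_U(t)`. -/
def e (r : ℕ) (U : R) : GQ R := PowerSeries.coeff r (E U)

end Rational

/-! ### The integral form `G_∞^ℤ(R)` -/

section Integral

/-- The `I`-indexed multipartitions of finite total size (partitions as Young diagrams). -/
def Multipartition (I : Type*) := {f : I → YoungDiagram // {u | f u ≠ ⊥}.Finite}

/-- The monomial `∏_c x_{u, T(c)}` of a tableau `T` in the variable set `x_u = (x_{u,i})_{i ∈ ℕ}`. -/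
def tableauMonomial {I : Type*} (u : I) {μ : YoungDiagram} (S : SemistandardYoungTableau μ) :
    I × ℕ →₀ ℕ :=
  ∑ c ∈ μ.cells, Finsupp.single (u, S c.1 c.2) 1

/-- The Schur function `s_μ(x_u)`, the sum of the monomials of all semistandard tableaux of shape
`μ`. -/
def schur {I : Type*} (u : I) (μ : YoungDiagram) : MvPowerSeries (I × ℕ) ℤ :=
  ofCoeff fun m => (Nat.card {S : SemistandardYoungTableau μ // tableauMonomial u S = m} : ℤ)

/-- `∏_{u ∈ I} s_{λ(u)}(x_u)`. -/
def schurProd {I : Type*} (lam : Multipartition I) : MvPowerSeries (I × ℕ) ℤ :=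
  ∏ u ∈ lam.2.toFinset, schur u (lam.1 u)

variable {R : Type*} [Ring R] {I : Type*} (b : Module.Basis I ℤ R)

/-- `∑_{u ∈ I} p_l(x_u) u`, where `p_l(x_u) = ∑_i x_{u,i}^l`. -/
def powerSumSeries (l : ℕ+) : MvPowerSeries (I × ℕ) (RatExt R) :=
  open Classical in
  ofCoeff fun m => ∑ p ∈ m.support, if m = Finsupp.single p (l : ℕ) then toRatExt R (b p.1) else 0

/-- The generating function `∏_{l ≥ 1} exp(T_l(log(1 + ∑_{u ∈ I} p_l(x_u) u)))`. -/
def genFun : MvPowerSeries (I × ℕ) (GQ R) := infProd fun l => Theta l (1 + powerSumSeries b l)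

/-- `∑_λ (∏_u s_{λ(u)}(x_u)) ⊗ Z_λ = ∏_{l ≥ 1} exp(T_l(log(1 + ∑_u p_l(x_u) u)))`, as an equality of
formal series in the variables `x_{u,i}`. Only finitely many `λ` contribute to each monomial. -/
def IsZFamily (Z : Multipartition I → GQ R) : Prop :=
  ∀ m : I × ℕ →₀ ℕ,
    ∑ᶠ lam : Multipartition I, MvPowerSeries.coeff m (schurProd lam) • Z lam =
      MvPowerSeries.coeff m (genFun b)

/-- The elements `Z_λ ∈ G_∞^ℚ(R)`, defined by the preceding equality of generating functions. -/
def Z : Multipartition I → GQ R := Classical.epsilon (IsZFamily b)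

/-- `G_∞^ℤ(R)`, the `ℤ`-span of the `Z_λ`. -/
def GZ : Submodule ℤ (GQ R) := Submodule.span ℤ (Set.range (Z b))

end Integral

/-! ### The relations -/

section Relations

variable {A : Type*} [Ring A]

/-- The series `F(u) G(-uv)^{-1} H(v)` in two variables `u`, `v` (the variables `0` and `1`). -/
def tripleSeries (F G H : PowerSeries A) : MvPowerSeries (Fin 2) A :=
  substMonomial F 1 (Finsupp.single 0 1) *
    seriesInv (substMonomial G (-1) (Finsupp.single 0 1 + Finsupp.single 1 1)) *
    substMonomial H 1 (Finsupp.single 1 1)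

/-- The series `H(v) G(-uv)^{-1} F(u)` in two variables `u`, `v` (the variables `0` and `1`). -/
def tripleSeriesRev (F G H : PowerSeries A) : MvPowerSeries (Fin 2) A :=
  substMonomial H 1 (Finsupp.single 1 1) *
    seriesInv (substMonomial G (-1) (Finsupp.single 0 1 + Finsupp.single 1 1)) *
    substMonomial F 1 (Finsupp.single 0 1)

variable [Algebra ℚ A] {R : Type*} [Ring R]

/-- `∑_{r ≥ 1} (μ(r)/r) log(ℰ_{W^r}(-t^r))`, for a family of series `ℰ_W(t)`, `W ∈ R`, with constant
term `1`. The `r`-th summand only involves powers `t^n` with `n ≥ r`. -/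
def moebiusLog (𝓔 : R → PowerSeries A) (W : R) : PowerSeries A :=
  PowerSeries.mk fun n => ∑ r ∈ Finset.Icc 1 n,
    ((ArithmeticFunction.moebius r : ℚ) / (r : ℚ)) •
      PowerSeries.coeff n (seriesLog (substMonomial (𝓔 (W ^ r)) (-1) (Finsupp.single () r)))

variable {I : Type*} (b : Module.Basis I ℤ R)

/-- The second family of relations: if `W = ∑_u a_u u` in `R` with `a_u ∈ ℤ`, then
`∑_r (μ(r)/r) log(ℰ_{W^r}(-t^r)) = ∑_u a_u ∑_r (μ(r)/r) log(ℰ_{u^r}(-t^r))`. -/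
def SumRelation (𝓔 : R → PowerSeries A) : Prop :=
  ∀ W : R, moebiusLog 𝓔 W = (b.repr W).sum fun u a => a • moebiusLog 𝓔 (b u)

/-- The free `ℚ`-algebra on the symbols `e_r(u)`, `u ∈ I`, `r ≥ 1`. -/
abbrev Free (I : Type*) := FreeAlgebra ℚ (I × ℕ+)

/-- `1 + ∑_{r ≥ 1} e_r(u) t^r`, the generating series of the free generators belonging to `u`. -/
def freeSeries (u : I) : PowerSeries (Free I) :=
  PowerSeries.mk fun n => if h : 0 < n then FreeAlgebra.ι ℚ (u, ⟨n, h⟩) else 1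

/-- A family of series `ℰ_W(t) ∈ 1 + t Free⟦t⟧`, for all `W ∈ R`, which for `W ∈ I` are the generating
series of the generators, and which satisfy the second family of relations. -/
def IsSymbolFamily (𝓔 : R → PowerSeries (Free I)) : Prop :=
  (∀ W, PowerSeries.constantCoeff (𝓔 W) = 1) ∧ (∀ u, 𝓔 (b u) = freeSeries u) ∧ SumRelation b 𝓔

/-- The first family of relations, for `U = b u`, `V = b v` in the basis: each coefficient of
`ℰ_U(s) ℰ_{VU}(-st)^{-1} ℰ_V(t)` equals that of `ℰ_V(t) ℰ_{UV}(-st)^{-1} ℰ_U(s)`. -/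
inductive CommutationRel (𝓔 : R → PowerSeries (Free I)) : Free I → Free I → Prop
  | mk (u v : I) (m : Fin 2 →₀ ℕ) : CommutationRel 𝓔
      (MvPowerSeries.coeff m (tripleSeries (𝓔 (b u)) (𝓔 (b v * b u)) (𝓔 (b v))))
      (MvPowerSeries.coeff m (tripleSeriesRev (𝓔 (b u)) (𝓔 (b u * b v)) (𝓔 (b v))))

end Relations

end WreathGrothendieck

end

open scoped TensorProduct
noncomputable section
namespace WreathGrothendieck

/-! For linear maps `t_i : ℚ ⊗ R → B` put `T f = ∑ t_i(f(x^i))` (`lieOp`), and send a series `x`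
with constant term one to `exp(T(log x))` (`lieExp`). Different tensor factors commute, so the
infinite products of the statement collapse: for `t_l = T_l` one has `E_U(-t) = lieExp(1 - tU)`
(`flip_E`), and the generating function of the `Z_λ` is `lieExp(1 + ∑ p_1(x_u) u)` (`genFun_eq`).

If `[t_i a, t_j b] = δ_ij t_i[a, b]`, then `lieExp` is multiplicative (`IsLieFamily.lieExp_mul`).
Indeed, for the Euler derivation `D`, the logarithmic derivative `exp(-a) D(exp a)` is a series of
iterated commutators, which the operator respects once `t_i` is replaced by `i t_i`, and a
first-order linear differential equation determines its solution up to the constant term. Relation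
(1) is then the image of the ring identity `(1-a)(1-ba)⁻¹(1-b) = (1-b)(1-ab)⁻¹(1-a)`
(`triple_identity`).

For relation (2), the coefficient of `t^n` in `log E_W(-t)` is `-∑_{r ∣ n} t_{n/r}(W^r)/r`. Möbius
inversion turns this into `-t_n(W)`, which is additive in `W`. Conversely, a family with constant
terms one satisfying (2) comes from some `t` (`exists_isLieExpFamily`), and recursion on `n` shows
that such a family exists and is unique for prescribed values on the basis (`exists_sumRelation`,
`sumRelation_unique`).

For the presentation, the Lie relations must be recovered from (1) in the quotient of the free
algebra. Suppose they hold for `i + j < l + k`. Then the computation of logarithmic derivatives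
stays valid at all divisors of `u^l v^k`, up to an error at `u^l v^k` itself which is a multiple of
the defect of the relation for `t_l U` and `t_k V`. Comparing the two sides of (1), the defect is
killed by `k + l` (`defect_eq_zero_of_triple`). The universal properties of the enveloping algebra
and of the restricted tensor product then give a homomorphism inverse to the obvious one
(`exists_presentation`).

For (c), products of Schur functions are unitriangular with respect to monomials, and both sides of
the defining identity are symmetric in each set of variables. Hence the `Z_λ` exist, are unique, and
span the same group as the coefficients of the generating function. This group is compared with the
subalgebra generated by the `e_r(u)` through the exponentials `intExp x` of arbitrary integral
series `x`. Factoring `x` successively into terms `1 - u x^m` and their inverses puts the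
coefficients into the subalgebra (`coeff_intExp_mem_genSubalgebra`). Substituting monomials for the
variables of the generating function, and eliminating negative coefficients by cancelling pairs of
variables, puts them into the span (`coeff_intExp_mem_coeffSpan`). -/

open MvPowerSeries Finset

/-! ### Orders of vanishing and congruence on sets of monomials -/

section Order

variable {σ : Type*} {A : Type*} [Ring A]

/-- All coefficients of `f` in degrees less than `n` vanish. -/
def OrdGE (n : ℕ) (f : MvPowerSeries σ A) : Prop := ∀ m : σ →₀ ℕ, m.degree < n → coeff m f = 0

theorem degree_add_of_mem_antidiagonal [DecidableEq σ] {m : σ →₀ ℕ} {p : (σ →₀ ℕ) × (σ →₀ ℕ)}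
    (hp : p ∈ antidiagonal m) : p.1.degree + p.2.degree = m.degree := by
  rw [← map_add, HasAntidiagonal.mem_antidiagonal.1 hp]

theorem ordGE_zero_left (f : MvPowerSeries σ A) : OrdGE 0 f := fun _ h => absurd h (Nat.not_lt_zero _)

theorem ordGE_zero (n : ℕ) : OrdGE n (0 : MvPowerSeries σ A) := fun _ _ => rfl

theorem OrdGE.mono {n k : ℕ} {f : MvPowerSeries σ A} (hf : OrdGE n f) (h : k ≤ n) : OrdGE k f :=
  fun m hm => hf m (hm.trans_le h)

theorem ordGE_one_iff {f : MvPowerSeries σ A} : OrdGE 1 f ↔ constantCoeff f = 0 := by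
  rw [← coeff_zero_eq_constantCoeff_apply]
  refine ⟨fun h => h 0 (by simp), fun h m hm => ?_⟩
  have : m = 0 := by rwa [Nat.lt_one_iff, Finsupp.degree_eq_zero_iff] at hm
  rw [this, h]

theorem OrdGE.add {n : ℕ} {f g : MvPowerSeries σ A} (hf : OrdGE n f) (hg : OrdGE n g) :
    OrdGE n (f + g) := fun m hm => by rw [map_add, hf m hm, hg m hm, add_zero]

theorem OrdGE.neg {n : ℕ} {f : MvPowerSeries σ A} (hf : OrdGE n f) : OrdGE n (-f) :=
  fun m hm => by rw [map_neg, hf m hm, neg_zero]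

theorem OrdGE.sub {n : ℕ} {f g : MvPowerSeries σ A} (hf : OrdGE n f) (hg : OrdGE n g) :
    OrdGE n (f - g) := fun m hm => by rw [map_sub, hf m hm, hg m hm, sub_zero]

theorem OrdGE.sum {ι : Type*} {n : ℕ} {f : ι → MvPowerSeries σ A} {s : Finset ι}
    (h : ∀ i ∈ s, OrdGE n (f i)) : OrdGE n (∑ i ∈ s, f i) := fun m hm => by
  rw [map_sum]; exact Finset.sum_eq_zero fun i hi => h i hi m hm

theorem coeff_qsmul [Algebra ℚ A] (c : ℚ) (f : MvPowerSeries σ A) (m : σ →₀ ℕ) :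
    coeff m (c • f) = c • coeff m f := rfl

theorem OrdGE.smul [Algebra ℚ A] {n : ℕ} {f : MvPowerSeries σ A} (hf : OrdGE n f) (c : ℚ) :
    OrdGE n (c • f) := fun m hm => by rw [coeff_qsmul, hf m hm, smul_zero]

theorem OrdGE.mul {n k : ℕ} {f g : MvPowerSeries σ A} (hf : OrdGE n f) (hg : OrdGE k g) :
    OrdGE (n + k) (f * g) := fun m hm => by
  classical
  rw [coeff_mul]
  refine Finset.sum_eq_zero fun p hp => ?_
  have := degree_add_of_mem_antidiagonal hp
  by_cases h1 : p.1.degree < n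
  · rw [hf _ h1, zero_mul]
  · rw [hg _ (by omega), mul_zero]

theorem OrdGE.pow {f : MvPowerSeries σ A} (hf : OrdGE 1 f) (k : ℕ) : OrdGE k (f ^ k) := by
  induction k with
  | zero => exact ordGE_zero_left _
  | succ k ih => rw [pow_succ]; exact ih.mul hf

theorem OrdGE.mul_left {k : ℕ} {g : MvPowerSeries σ A} (hg : OrdGE k g) (f : MvPowerSeries σ A) :
    OrdGE k (f * g) := by simpa using (ordGE_zero_left f).mul hg

/-- Two series have the same coefficients at the monomials in `P`. -/
def Cong (P : Set (σ →₀ ℕ)) (f g : MvPowerSeries σ A) : Prop := ∀ m ∈ P, coeff m f = coeff m g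

variable {P : Set (σ →₀ ℕ)}

theorem cong_univ {f g : MvPowerSeries σ A} : Cong Set.univ f g ↔ f = g :=
  ⟨fun h => MvPowerSeries.ext fun m => h m trivial, fun h => h ▸ fun _ _ => rfl⟩

theorem Cong.refl (f : MvPowerSeries σ A) : Cong P f f := fun _ _ => rfl

theorem Cong.symm {f g : MvPowerSeries σ A} (h : Cong P f g) : Cong P g f :=
  fun m hm => (h m hm).symm

theorem Cong.trans {f g h : MvPowerSeries σ A} (h1 : Cong P f g) (h2 : Cong P g h) : Cong P f h :=
  fun m hm => (h1 m hm).trans (h2 m hm)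

theorem Cong.add {f g f' g' : MvPowerSeries σ A} (h1 : Cong P f f') (h2 : Cong P g g') :
    Cong P (f + g) (f' + g') := fun m hm => by rw [map_add, map_add, h1 m hm, h2 m hm]

theorem Cong.neg {f f' : MvPowerSeries σ A} (h1 : Cong P f f') :
    Cong P (-f) (-f') := fun m hm => by rw [map_neg, map_neg, h1 m hm]

theorem Cong.sub {f g f' g' : MvPowerSeries σ A} (h1 : Cong P f f') (h2 : Cong P g g') :
    Cong P (f - g) (f' - g') := fun m hm => by rw [map_sub, map_sub, h1 m hm, h2 m hm]

theorem Cong.smul [Algebra ℚ A] {f f' : MvPowerSeries σ A} (h1 : Cong P f f') (c : ℚ) :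
    Cong P (c • f) (c • f') := fun m hm => by rw [coeff_qsmul, coeff_qsmul, h1 m hm]

/-- A coefficient of a product at `m` only involves coefficients at divisors of `m`. This is why
comparisons are restricted to lower sets of monomials. -/
theorem Cong.mul (hP : IsLowerSet P) {f g f' g' : MvPowerSeries σ A} (h1 : Cong P f f')
    (h2 : Cong P g g') : Cong P (f * g) (f' * g') := fun m hm => by
  classical
  rw [coeff_mul, coeff_mul]
  refine Finset.sum_congr rfl fun p hp => ?_
  rw [h1 _ (hP (HasAntidiagonal.antidiagonal.fst_le hp) hm), h2 _ (hP (HasAntidiagonal.antidiagonal.snd_le hp) hm)]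

theorem Cong.pow (hP : IsLowerSet P) {f f' : MvPowerSeries σ A} (h1 : Cong P f f') (k : ℕ) :
    Cong P (f ^ k) (f' ^ k) := by
  induction k with
  | zero => simpa using Cong.refl 1
  | succ k ih => rw [pow_succ, pow_succ]; exact ih.mul hP h1

theorem isLowerSet_degree_le (N : ℕ) : IsLowerSet {m : σ →₀ ℕ | m.degree ≤ N} :=
  fun _ _ h1 h2 => (Finsupp.degree_mono h1).trans h2

end Order

/-! ### Infinite sums of series of increasing order -/

section InfiniteSum

variable {σ : Type*} {A : Type*} [Ring A]

/-- The sum of a sequence of series `f k` such that `f k` only involves monomials of degree at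
least `k`. -/
def isum (f : ℕ → MvPowerSeries σ A) : MvPowerSeries σ A :=
  ofCoeff fun m => ∑ k ∈ range (m.degree + 1), coeff m (f k)

/-- The definition cuts the sum off at the degree of `m`; the condition on orders makes any later
cut-off give the same value. -/
theorem coeff_isum {f : ℕ → MvPowerSeries σ A} (hf : ∀ k, OrdGE k (f k)) {m : σ →₀ ℕ} {N : ℕ}
    (h : m.degree ≤ N) : coeff m (isum f) = ∑ k ∈ range (N + 1), coeff m (f k) := by
  refine Finset.sum_subset (range_subset_range.2 (by omega)) fun k _ hk => hf k m ?_
  simpa using hk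

theorem isum_congr {f g : ℕ → MvPowerSeries σ A} {P : Set (σ →₀ ℕ)} (h : ∀ k, Cong P (f k) (g k)) :
    Cong P (isum f) (isum g) := fun m hm => by
  simp only [isum, coeff_ofCoeff]
  exact Finset.sum_congr rfl fun k _ => h k m hm

theorem isum_add (f g : ℕ → MvPowerSeries σ A) :
    isum (fun k => f k + g k) = isum f + isum g := by
  ext m
  simp only [isum, map_add, coeff_ofCoeff, sum_add_distrib]

theorem OrdGE.isum {n : ℕ} {f : ℕ → MvPowerSeries σ A} (hf : ∀ k, OrdGE n (f k)) :
    OrdGE n (WreathGrothendieck.isum f) := fun m hm => by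
  simp only [WreathGrothendieck.isum, coeff_ofCoeff]
  exact Finset.sum_eq_zero fun k _ => hf k m hm

/-- Cauchy product: both sides are compared with the sum of all `f i * g j` over a square of
indices. -/
theorem isum_mul {f g : ℕ → MvPowerSeries σ A} (hf : ∀ k, OrdGE k (f k)) (hg : ∀ k, OrdGE k (g k)) :
    isum f * isum g = isum fun n => ∑ p ∈ antidiagonal n, f p.1 * g p.2 := by
  classical
  ext m
  have key : coeff m (isum f * isum g) =
      ∑ i ∈ range (m.degree + 1), ∑ j ∈ range (m.degree + 1), coeff m (f i * g j) := by
    rw [coeff_mul]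
    simp_rw [coeff_mul]
    rw [Finset.sum_congr rfl fun i _ => Finset.sum_comm, Finset.sum_comm]
    refine Finset.sum_congr rfl fun p hp => ?_
    have := degree_add_of_mem_antidiagonal hp
    rw [coeff_isum hf (show p.1.degree ≤ m.degree by omega),
      coeff_isum hg (show p.2.degree ≤ m.degree by omega), sum_mul_sum]
  rw [key]
  simp only [isum, coeff_ofCoeff, map_sum]
  rw [← sum_product', Finset.sum_sigma']
  symm
  refine Finset.sum_of_injOn (fun x => x.2) ?_ ?_ ?_ ?_
  · rintro ⟨n, p⟩ h ⟨n', p'⟩ h' he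
    simp only [coe_sigma, Set.mem_sigma_iff, mem_coe, HasAntidiagonal.mem_antidiagonal] at h h' he
    obtain ⟨-, rfl⟩ := h
    obtain ⟨-, rfl⟩ := h'
    subst he
    rfl
  · rintro ⟨n, p⟩ h
    simp only [coe_sigma, Set.mem_sigma_iff, mem_coe, HasAntidiagonal.mem_antidiagonal, mem_range, coe_product,
      Set.mem_prod] at h ⊢
    omega
  -- Pairs in the square beyond the triangle `i + j ≤ m.degree` contribute nothing, by the orders of
  -- `f i` and `g j`.
  · rintro ⟨i, j⟩ - h
    apply (hf i).mul (hg j)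
    by_contra hlt
    replace hlt : ¬ m.degree < i + j := hlt
    exact h ⟨⟨i + j, (i, j)⟩, mem_coe.2 (mem_sigma.2 ⟨mem_range.2 (show i + j < m.degree + 1 by omega),
      HasAntidiagonal.mem_antidiagonal.2 rfl⟩), rfl⟩
  · intros; rfl

theorem isum_single_zero (f : MvPowerSeries σ A) :
    isum (fun k => if k = 0 then f else 0) = f := by
  ext m
  simp only [isum, coeff_ofCoeff]
  rw [Finset.sum_eq_single 0]
  · simp
  · intro b _ hb; simp [hb]
  · simp

theorem isum_mul_left {f : ℕ → MvPowerSeries σ A} (hf : ∀ k, OrdGE k (f k))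
    (g : MvPowerSeries σ A) : g * isum f = isum fun n => g * f n := by
  classical
  ext m
  rw [coeff_mul]
  simp only [isum, coeff_ofCoeff, coeff_mul]
  rw [Finset.sum_comm]
  refine Finset.sum_congr rfl fun p hp => ?_
  have := degree_add_of_mem_antidiagonal hp
  rw [← mul_sum]
  congr 1
  exact coeff_isum hf (show p.2.degree ≤ m.degree by omega)

end InfiniteSum

/-! ### Exponential and logarithm of series -/

section ExpLog

variable {σ : Type*} {A : Type*} [Ring A] [Algebra ℚ A]

theorem seriesExp_eq_isum (f : MvPowerSeries σ A) :
    seriesExp f = isum fun k => (1 / (k.factorial : ℚ)) • f ^ k := rfl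

/-- The sum now includes `k = 0`; that term is zero because division by `0` gives `0`. -/
theorem seriesLog_eq_isum (f : MvPowerSeries σ A) :
    seriesLog f = isum fun k => ((-1 : ℚ) ^ (k + 1) / (k : ℚ)) • (f - 1) ^ k := by
  ext m
  simp only [seriesLog, isum, coeff_ofCoeff]
  rw [Finset.range_eq_Ico, Finset.sum_eq_sum_Ico_succ_bot (by omega)]
  simp
  rfl

theorem Cong.exp {P : Set (σ →₀ ℕ)} (hP : IsLowerSet P) {f g : MvPowerSeries σ A}
    (h : Cong P f g) : Cong P (seriesExp f) (seriesExp g) :=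
  isum_congr fun k => (h.pow hP k).smul _

theorem Cong.log {P : Set (σ →₀ ℕ)} (hP : IsLowerSet P) {f g : MvPowerSeries σ A}
    (h : Cong P f g) : Cong P (seriesLog f) (seriesLog g) := by
  rw [seriesLog_eq_isum, seriesLog_eq_isum]
  exact isum_congr fun k => ((h.sub (Cong.refl 1)).pow hP k).smul _

theorem ordGE_log (f : MvPowerSeries σ A) : OrdGE 1 (seriesLog f) := fun m hm => by
  have : m.degree = 0 := by omega
  simp [seriesLog, coeff_ofCoeff, this]

theorem constantCoeff_exp (f : MvPowerSeries σ A) : constantCoeff (seriesExp f) = 1 := by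
  rw [← coeff_zero_eq_constantCoeff_apply]
  simp [seriesExp, coeff_ofCoeff]

theorem ordGE_exp_sub_one (f : MvPowerSeries σ A) : OrdGE 1 (seriesExp f - 1) := by
  rw [ordGE_one_iff, map_sub, constantCoeff_exp, map_one, sub_self]

theorem choose_div_factorial {n i j : ℕ} (h : i + j = n) :
    (1 / (n.factorial : ℚ)) * (n.choose j : ℚ) = 1 / (i.factorial : ℚ) * (1 / (j.factorial : ℚ)) := by
  subst h
  have h1 := Nat.add_choose_mul_factorial_mul_factorial i j
  have : ((i + j).factorial : ℚ) ≠ 0 := by positivity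
  have : (i.factorial : ℚ) ≠ 0 := by positivity
  have : (j.factorial : ℚ) ≠ 0 := by positivity
  field_simp
  exact_mod_cast by linarith

theorem seriesExp_zero : seriesExp (0 : MvPowerSeries σ A) = 1 := by
  rw [seriesExp_eq_isum, ← isum_single_zero 1]
  congr 1; ext1 k
  by_cases hk : k = 0 <;> simp [hk]

theorem seriesExp_add {f g : MvPowerSeries σ A} (hf : OrdGE 1 f) (hg : OrdGE 1 g)
    (hc : Commute f g) : seriesExp (f + g) = seriesExp f * seriesExp g := by
  rw [seriesExp_eq_isum, seriesExp_eq_isum, seriesExp_eq_isum,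
    isum_mul (fun k => (hf.pow k).smul _) (fun k => (hg.pow k).smul _)]
  congr 1; ext1 n
  rw [hc.add_pow', smul_sum]
  refine Finset.sum_congr rfl fun p hp => ?_
  rw [smul_mul_smul_comm, ← Nat.cast_smul_eq_nsmul ℚ, smul_smul]
  have h1 := HasAntidiagonal.mem_antidiagonal.1 hp
  rw [choose_div_factorial (by omega : p.2 + p.1 = n), mul_comm (1 / (p.1.factorial : ℚ))]

theorem seriesExp_mul_neg {f : MvPowerSeries σ A} (hf : OrdGE 1 f) :
    seriesExp f * seriesExp (-f) = 1 := by
  rw [← seriesExp_add hf hf.neg (Commute.refl f).neg_right, add_neg_cancel, seriesExp_zero]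

theorem seriesExp_neg_mul {f : MvPowerSeries σ A} (hf : OrdGE 1 f) :
    seriesExp (-f) * seriesExp f = 1 := by
  simpa using seriesExp_mul_neg hf.neg

end ExpLog

/-! ### The Euler derivation and derivatives of exponentials -/

section Euler

variable {σ : Type*} {A : Type*} [Ring A]

/-- The Euler derivation, which multiplies the coefficient of a monomial by its degree. -/
def euler : MvPowerSeries σ A →+ MvPowerSeries σ A where
  toFun f := ofCoeff fun m => m.degree • coeff m f
  map_zero' := by ext m; simp [coeff_ofCoeff]
  map_add' f g := by ext m; simp [coeff_ofCoeff]

theorem coeff_euler (f : MvPowerSeries σ A) (m : σ →₀ ℕ) :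
    coeff m (euler f) = m.degree • coeff m f := rfl

theorem euler_mul (f g : MvPowerSeries σ A) : euler (f * g) = euler f * g + f * euler g := by
  classical
  ext m
  rw [coeff_euler, map_add, coeff_mul, coeff_mul, coeff_mul, smul_sum, ← sum_add_distrib]
  refine Finset.sum_congr rfl fun p hp => ?_
  rw [coeff_euler, coeff_euler, ← degree_add_of_mem_antidiagonal hp, add_smul, smul_mul_assoc,
    mul_smul_comm]

theorem euler_one : euler (1 : MvPowerSeries σ A) = 0 := by
  have := euler_mul (1 : MvPowerSeries σ A) 1
  simpa using this

theorem OrdGE.euler {n : ℕ} {f : MvPowerSeries σ A} (hf : OrdGE n f) : OrdGE n (euler f) :=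
  fun m hm => by rw [coeff_euler, hf m hm, smul_zero]

theorem ordGE_euler (f : MvPowerSeries σ A) : OrdGE 1 (euler f) := fun m hm => by
  have : m.degree = 0 := by omega
  rw [coeff_euler, this, zero_smul]

theorem euler_isum (f : ℕ → MvPowerSeries σ A) :
    euler (isum f) = isum fun k => euler (f k) := by
  ext m
  simp only [coeff_euler, isum, coeff_ofCoeff, smul_sum]

/-- The iterated negative commutators `(-ad a)^k z`. -/
def adPow (a z : MvPowerSeries σ A) : ℕ → MvPowerSeries σ A
  | 0 => z
  | k + 1 => adPow a z k * a - a * adPow a z k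

theorem adPow_mul (a z : MvPowerSeries σ A) (k : ℕ) :
    adPow a z k * a = a * adPow a z k + adPow a z (k + 1) := by
  rw [adPow]; abel

theorem ordGE_adPow {a : MvPowerSeries σ A} (ha : OrdGE 1 a) (z : MvPowerSeries σ A) (k : ℕ) :
    OrdGE k (adPow a z k) := by
  induction k with
  | zero => exact ordGE_zero_left _
  | succ k ih =>
    rw [adPow]
    refine (ih.mul ha).sub ?_
    rw [add_comm]
    exact ha.mul ih

theorem ordGE_adPow' {a z : MvPowerSeries σ A} (ha : OrdGE 1 a) (hz : OrdGE 1 z) (k : ℕ) :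
    OrdGE (k + 1) (adPow a z k) := by
  induction k with
  | zero => exact hz
  | succ k ih =>
    rw [adPow]
    refine (ih.mul ha).sub ?_
    rw [add_comm (k + 1) 1]
    exact ha.mul ih

/-- Each factor `a`, when moved to the left, either passes or produces one more commutator
(`adPow_mul`); Pascal's rule counts the possibilities. -/
theorem mul_pow_eq_sum_adPow (a z : MvPowerSeries σ A) (n : ℕ) :
    z * a ^ n = ∑ k ∈ range (n + 1), n.choose k • (a ^ (n - k) * adPow a z k) := by
  induction n with
  | zero => simp [adPow]
  | succ n ih =>
    rw [pow_succ, ← mul_assoc, ih, sum_mul]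
    have h1 : ∀ k ∈ range (n + 1), n.choose k • (a ^ (n - k) * adPow a z k) * a =
        n.choose k • (a ^ (n + 1 - k) * adPow a z k) +
          n.choose k • (a ^ (n + 1 - (k + 1)) * adPow a z (k + 1)) := by
      intro k hk
      have : k ≤ n := by simpa [Nat.lt_succ_iff] using hk
      rw [smul_mul_assoc, mul_assoc, adPow_mul, mul_add, smul_add, ← mul_assoc, ← pow_succ]
      congr 4 <;> omega
    rw [Finset.sum_congr rfl h1, sum_add_distrib, Finset.sum_range_succ' _ (n + 1)]
    simp_rw [Nat.choose_succ_succ, add_smul, sum_add_distrib]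
    rw [Finset.sum_range_succ' (fun k => n.choose k • (a ^ (n + 1 - k) * adPow a z k)),
      Finset.sum_range_succ (fun k => n.choose (k + 1) • (a ^ (n + 1 - (k + 1)) * adPow a z (k + 1)))]
    simp
    abel

/-- The Leibniz rule gives `∑ a^i D(a) a^(n-1-i)`, and moving the right-hand powers to the left sums
binomial coefficients to `n.choose (k + 1)`. The induction uses Pascal's rule instead. -/
theorem euler_pow_eq_sum_adPow (a : MvPowerSeries σ A) (n : ℕ) :
    euler (a ^ n) = ∑ k ∈ range n, n.choose (k + 1) • (a ^ (n - (k + 1)) * adPow a (euler a) k) := by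
  induction n with
  | zero => simp [euler_one]
  | succ n ih =>
    rw [pow_succ, euler_mul, ih, sum_mul]
    have h1 : ∀ k ∈ range n,
        n.choose (k + 1) • (a ^ (n - (k + 1)) * adPow a (euler a) k) * a =
        n.choose (k + 1) • (a ^ (n + 1 - (k + 1)) * adPow a (euler a) k) +
          n.choose (k + 1) • (a ^ (n + 1 - (k + 1 + 1)) * adPow a (euler a) (k + 1)) := by
      intro k hk
      have : k < n := by simpa using hk
      rw [smul_mul_assoc, mul_assoc, adPow_mul, mul_add, smul_add, ← mul_assoc, ← pow_succ]
      congr 4 <;> omega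
    rw [Finset.sum_congr rfl h1, sum_add_distrib]
    simp_rw [Nat.choose_succ_succ, add_smul, sum_add_distrib]
    rw [Finset.sum_range_succ' (fun k => n.choose k • (a ^ (n + 1 - (k + 1)) * adPow a (euler a) k)),
      Finset.sum_range_succ (fun k => n.choose (k + 1) • (a ^ (n + 1 - (k + 1)) * adPow a (euler a) k))]
    simp [adPow]
    abel

theorem adPow_succ_of_commute {a z : MvPowerSeries σ A} (h : Commute z a) (k : ℕ) :
    adPow a z (k + 1) = 0 := by
  induction k with
  | zero => rw [adPow, adPow, h.eq, sub_self]
  | succ k ih => rw [adPow, ih]; simp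

theorem isum_eq_zero_term {f : ℕ → MvPowerSeries σ A} (h : ∀ k, k ≠ 0 → f k = 0) :
    isum f = f 0 := by
  rw [← isum_single_zero (f 0)]
  congr 1; ext1 k
  split_ifs with hk
  · rw [hk]
  · exact h k hk

variable [Algebra ℚ A]

theorem euler_smul (c : ℚ) (f : MvPowerSeries σ A) : euler (c • f) = c • euler f := by
  ext m
  simp only [coeff_euler, coeff_qsmul, smul_comm c]

theorem nsmul_right_cancel {a b : A} {n : ℕ} (hn : n ≠ 0) (h : n • a = n • b) : a = b := by
  have : Module.IsTorsionFree ℕ A := Module.IsTorsionFree.trans ℚ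
  exact smul_right_injective A hn h

/-- A first-order linear differential equation determines a series up to its constant term. -/
theorem eq_of_euler_eq {P : Set (σ →₀ ℕ)} (hP : IsLowerSet P) {f g a : MvPowerSeries σ A}
    (ha : OrdGE 1 a) (h0 : constantCoeff f = constantCoeff g) (hf : Cong P (euler f) (f * a))
    (hg : Cong P (euler g) (g * a)) : Cong P f g := by
  classical
  suffices ∀ n, ∀ m ∈ P, m.degree = n → coeff m f = coeff m g from fun m hm => this _ m hm rfl
  intro n
  induction n using Nat.strong_induction_on with
  | _ n ih =>
    intro m hm hn
    by_cases h : m = 0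
    · subst h; exact h0
    have h1 := hf m hm
    have h2 := hg m hm
    rw [coeff_euler, coeff_mul] at h1 h2
    -- The degree of `m` can be cancelled, and since `a` has no constant term, `f * a` at `m` only
    -- involves coefficients of `f` of smaller degree.
    refine nsmul_right_cancel (n := m.degree) (by rwa [Ne, Finsupp.degree_eq_zero_iff]) ?_
    rw [h1, h2]
    refine Finset.sum_congr rfl fun p hp => ?_
    have := degree_add_of_mem_antidiagonal hp
    by_cases h3 : p.2.degree < 1
    · rw [ha _ h3, mul_zero, mul_zero]
    · rw [ih p.1.degree (by omega) p.1 (hP (HasAntidiagonal.antidiagonal.fst_le hp) hm) rfl]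

/-- `exp(-a) z exp(a)`, as a sum of iterated commutators. -/
def conjExp (a z : MvPowerSeries σ A) : MvPowerSeries σ A :=
  isum fun k => (1 / (k.factorial : ℚ)) • adPow a z k

/-- `exp(-a) D(exp a)`, as a sum of iterated commutators. -/
def logDerivExp (a : MvPowerSeries σ A) : MvPowerSeries σ A :=
  isum fun k => (1 / ((k + 1).factorial : ℚ)) • adPow a (euler a) k

/-- Dividing `mul_pow_eq_sum_adPow` by `n!` turns its binomial sum into a Cauchy product. -/
theorem mul_seriesExp {a : MvPowerSeries σ A} (ha : OrdGE 1 a) (z : MvPowerSeries σ A) :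
    z * seriesExp a = seriesExp a * conjExp a z := by
  rw [seriesExp_eq_isum, conjExp, isum_mul_left (fun k => (ha.pow k).smul _),
    isum_mul (fun k => (ha.pow k).smul _) (fun k => (ordGE_adPow ha z k).smul _)]
  congr 1; ext1 n
  rw [mul_smul_comm, mul_pow_eq_sum_adPow, smul_sum, ← Finset.Nat.sum_antidiagonal_swap,
    Finset.Nat.sum_antidiagonal_eq_sum_range_succ_mk]
  refine Finset.sum_congr rfl fun k hk => ?_
  have hk' : k ≤ n := by simpa [Nat.lt_succ_iff] using hk
  simp only [Prod.fst_swap, Prod.snd_swap]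
  rw [smul_mul_smul_comm, ← Nat.cast_smul_eq_nsmul ℚ, smul_smul]
  congr 1
  exact choose_div_factorial (by omega)

theorem euler_seriesExp {a : MvPowerSeries σ A} (ha : OrdGE 1 a) :
    euler (seriesExp a) = seriesExp a * logDerivExp a := by
  have hz := ha.euler
  -- The index is shifted by one so that the coefficients `n.choose (k + 1)` of
  -- `euler_pow_eq_sum_adPow` fit the Cauchy product with the exponential series.
  have h1 : logDerivExp a = isum fun k => if k = 0 then 0 else
      (1 / (k.factorial : ℚ)) • adPow a (euler a) (k - 1) := by
    ext m
    simp only [logDerivExp, isum, coeff_ofCoeff]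
    rw [Finset.sum_range_succ, Finset.sum_range_succ' _ m.degree,
      ((ordGE_adPow' ha hz _).smul _) m (Nat.lt_succ_self _)]
    simp
  rw [h1, seriesExp_eq_isum, euler_isum, isum_mul (fun k => (ha.pow k).smul _)]
  · congr 1; ext1 n
    rw [euler_smul, euler_pow_eq_sum_adPow, smul_sum, ← Finset.Nat.sum_antidiagonal_swap,
      Finset.Nat.sum_antidiagonal_eq_sum_range_succ_mk, Finset.sum_range_succ']
    simp only [Prod.fst_swap, Prod.snd_swap, if_true, mul_zero, add_zero]
    refine Finset.sum_congr rfl fun k hk => ?_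
    have hk' : k < n := by simpa using hk
    rw [if_neg (Nat.succ_ne_zero k), smul_mul_smul_comm, ← Nat.cast_smul_eq_nsmul ℚ, smul_smul,
      Nat.add_sub_cancel]
    congr 1
    exact choose_div_factorial (by omega)
  · intro k
    split_ifs with h
    · exact ordGE_zero _
    · refine OrdGE.smul ?_ _
      have := ordGE_adPow' ha hz (k - 1)
      rwa [Nat.sub_add_cancel (by omega)] at this

theorem euler_seriesExp_of_commute {a : MvPowerSeries σ A} (ha : OrdGE 1 a)
    (hc : Commute (euler a) a) : euler (seriesExp a) = seriesExp a * euler a := by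
  rw [euler_seriesExp ha]
  congr 1
  rw [logDerivExp, isum_eq_zero_term]
  · simp [adPow]
  · rintro (_ | k) hk
    · exact absurd rfl hk
    · rw [adPow_succ_of_commute hc, smul_zero]

end Euler


/-! ### Exponential and logarithm are inverse, by reduction to one rational variable -/

section EvalRational

variable {σ : Type*} {A : Type*} [Ring A] [Algebra ℚ A]

/-- The value of a rational power series in one variable at a series without constant term. -/
def evalQ (p : PowerSeries ℚ) (g : MvPowerSeries σ A) : MvPowerSeries σ A :=
  isum fun k => PowerSeries.coeff k p • g ^ k

theorem evalQ_mul {g : MvPowerSeries σ A} (hg : OrdGE 1 g) (p q : PowerSeries ℚ) :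
    evalQ (p * q) g = evalQ p g * evalQ q g := by
  rw [evalQ, evalQ, evalQ, isum_mul (fun k => (hg.pow k).smul _) (fun k => (hg.pow k).smul _)]
  congr 1; ext1 n
  rw [PowerSeries.coeff_mul, sum_smul]
  refine Finset.sum_congr rfl fun x hx => ?_
  rw [smul_mul_smul_comm, ← pow_add, HasAntidiagonal.mem_antidiagonal.1 hx]

theorem evalQ_one (g : MvPowerSeries σ A) : evalQ 1 g = 1 := by
  rw [evalQ, isum_eq_zero_term]
  · simp
  · intro k hk; simp [PowerSeries.coeff_one, hk]

theorem evalQ_pow {g : MvPowerSeries σ A} (hg : OrdGE 1 g) (p : PowerSeries ℚ) (k : ℕ) :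
    evalQ (p ^ k) g = evalQ p g ^ k := by
  induction k with
  | zero => simp [evalQ_one]
  | succ k ih => rw [pow_succ, pow_succ, evalQ_mul hg, ih]

theorem evalQ_smul (g : MvPowerSeries σ A) (c : ℚ) (p : PowerSeries ℚ) :
    evalQ (c • p) g = c • evalQ p g := by
  ext m
  simp only [evalQ, isum, coeff_ofCoeff, coeff_qsmul, smul_sum, map_smul, smul_assoc]

theorem evalQ_add (g : MvPowerSeries σ A) (p q : PowerSeries ℚ) :
    evalQ (p + q) g = evalQ p g + evalQ q g := by
  rw [evalQ, evalQ, evalQ, ← isum_add]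
  simp only [map_add, add_smul]

theorem evalQ_isum (g : MvPowerSeries σ A) {q : ℕ → PowerSeries ℚ}
    (hq : ∀ k, OrdGE k (q k : MvPowerSeries Unit ℚ)) :
    evalQ (isum q) g = isum fun k => evalQ (q k) g := by
  ext m
  simp only [evalQ]
  simp only [isum, coeff_ofCoeff, coeff_qsmul]
  rw [Finset.sum_comm]
  refine Finset.sum_congr rfl fun n hn => ?_
  rw [← sum_smul]
  congr 1
  have hn' : n ≤ m.degree := by simpa [Nat.lt_succ_iff] using hn
  exact coeff_isum hq (m := Finsupp.single () n) (by simpa using hn')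

theorem evalQ_X {g : MvPowerSeries σ A} (hg : OrdGE 1 g) : evalQ PowerSeries.X g = g := by
  ext m
  rw [evalQ, coeff_isum (N := m.degree + 1) (fun k => (hg.pow k).smul _) (by omega),
    Finset.sum_eq_single 1]
  · simp
  · intro k _ hk
    simp [PowerSeries.coeff_X, hk]
  · simp

theorem seriesExp_evalQ {g : MvPowerSeries σ A} (hg : OrdGE 1 g) {p : PowerSeries ℚ}
    (hp : OrdGE 1 (p : MvPowerSeries Unit ℚ)) :
    seriesExp (evalQ p g) = evalQ (seriesExp (p : MvPowerSeries Unit ℚ)) g := by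
  rw [seriesExp_eq_isum, seriesExp_eq_isum, evalQ_isum _ (fun k => (hp.pow k).smul _)]
  congr 1; ext1 k
  rw [evalQ_smul]
  exact congrArg _ (evalQ_pow hg p k).symm

theorem seriesLog_evalQ {g : MvPowerSeries σ A} (hg : OrdGE 1 g) {p : PowerSeries ℚ}
    (hp : OrdGE 1 (p - 1 : MvPowerSeries Unit ℚ)) :
    seriesLog (evalQ p g) = evalQ (seriesLog (p : MvPowerSeries Unit ℚ)) g := by
  rw [seriesLog_eq_isum, seriesLog_eq_isum, evalQ_isum _ (fun k => (hp.pow k).smul _)]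
  congr 1; ext1 k
  have h : evalQ p g - 1 = evalQ (p - 1) g := by
    rw [sub_eq_iff_eq_add, ← evalQ_one g, ← evalQ_add, sub_add_cancel]
  rw [evalQ_smul, h]
  exact congrArg _ (evalQ_pow hg (p - 1) k).symm

theorem coeff_seriesLog_one_add_X (n : ℕ) :
    PowerSeries.coeff n (seriesLog (1 + PowerSeries.X : MvPowerSeries Unit ℚ)) =
      (-1 : ℚ) ^ (n + 1) / n := by
  rw [seriesLog_eq_isum]
  change ∑ k ∈ range ((Finsupp.single () n).degree + 1), _ = _
  rw [Finsupp.degree_single, Finset.sum_eq_single n]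
  · have : (1 + PowerSeries.X : MvPowerSeries Unit ℚ) - 1 = PowerSeries.X := add_sub_cancel_left _ _
    rw [this, coeff_qsmul]
    change _ • PowerSeries.coeff n (PowerSeries.X ^ n : PowerSeries ℚ) = _
    simp
  · intro k _ hk
    have : (1 + PowerSeries.X : MvPowerSeries Unit ℚ) - 1 = PowerSeries.X := add_sub_cancel_left _ _
    rw [this, coeff_qsmul]
    change _ • PowerSeries.coeff n (PowerSeries.X ^ k : PowerSeries ℚ) = _
    rw [PowerSeries.coeff_X_pow, if_neg (Ne.symm hk), smul_zero]
  · simp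

theorem coeff_euler_powerSeries (f : PowerSeries ℚ) (n : ℕ) :
    PowerSeries.coeff n (euler (f : MvPowerSeries Unit ℚ)) = n • PowerSeries.coeff n f := by
  change (Finsupp.single () n).degree • PowerSeries.coeff n f = _
  rw [Finsupp.degree_single]

/-- Both sides solve `D f = f · D(log(1 + X))` with constant term one, because `(1 + X) · D(log(1 +
X)) = X`. -/
theorem seriesExp_seriesLog_one_add_X :
    seriesExp (seriesLog (1 + PowerSeries.X : MvPowerSeries Unit ℚ)) = 1 + PowerSeries.X := by
  rw [← cong_univ]
  set l := seriesLog (1 + PowerSeries.X : MvPowerSeries Unit ℚ) with hl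
  have hX : euler (1 + PowerSeries.X : MvPowerSeries Unit ℚ) = (PowerSeries.X : PowerSeries ℚ) := by
    apply PowerSeries.ext
    intro n
    have := coeff_euler_powerSeries (1 + PowerSeries.X) n
    refine this.trans ?_
    rw [map_add, PowerSeries.coeff_one, PowerSeries.coeff_X]
    split_ifs with h1 h2 h2 <;> simp_all
  have hmul : (1 + PowerSeries.X : PowerSeries ℚ) * (euler l : PowerSeries ℚ) = PowerSeries.X := by
    ext n
    rw [add_mul, one_mul, map_add]
    cases n with
    | zero => simp [coeff_euler_powerSeries l 0]
    | succ n =>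
      rw [PowerSeries.coeff_succ_X_mul, coeff_euler_powerSeries l n,
        coeff_euler_powerSeries l (n + 1), hl, coeff_seriesLog_one_add_X,
        coeff_seriesLog_one_add_X, PowerSeries.coeff_X]
      cases n with
      | zero => simp
      | succ n =>
        have h1 : ((n : ℚ) + 1) ≠ 0 := by positivity
        have h2 : ((n : ℚ) + 1 + 1) ≠ 0 := by positivity
        simp only [nsmul_eq_mul, Nat.cast_add, Nat.cast_one]
        field_simp
        simp [pow_succ]
  refine eq_of_euler_eq isLowerSet_univ (a := euler l) (ordGE_euler l) ?_ ?_ ?_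
  · rw [constantCoeff_exp, map_add, map_one]
    have : constantCoeff (PowerSeries.X : MvPowerSeries Unit ℚ) = 0 := PowerSeries.constantCoeff_X
    rw [this, add_zero]
  · rw [cong_univ]
    exact euler_seriesExp_of_commute (ordGE_log _) (Commute.all _ _)
  · rw [cong_univ, hX]
    exact hmul.symm

/-- With `h = log(exp X)`, the previous result gives `exp h = exp X`. Comparing derivatives and
cancelling `exp X` yields `D h = D X`, and neither series has a constant term. -/
theorem seriesLog_seriesExp_X :
    seriesLog (seriesExp (PowerSeries.X : MvPowerSeries Unit ℚ)) = PowerSeries.X := by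
  set E1 := seriesExp (PowerSeries.X : MvPowerSeries Unit ℚ) with hE1
  set h := seriesLog E1 with hh
  have hX : OrdGE 1 (PowerSeries.X : MvPowerSeries Unit ℚ) := by
    rw [ordGE_one_iff]; exact PowerSeries.constantCoeff_X
  have hg : OrdGE 1 (E1 - 1) := ordGE_exp_sub_one _
  have h1 : E1 = evalQ (1 + PowerSeries.X) (E1 - 1) := by
    rw [evalQ_add, evalQ_one, evalQ_X hg]; abel
  have h2 : OrdGE 1 ((1 + PowerSeries.X : MvPowerSeries Unit ℚ) - 1) := by
    rw [add_sub_cancel_left]; exact hX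
  have h3 : seriesExp h = E1 := by
    rw [hh]
    conv_lhs => rw [h1]
    rw [seriesLog_evalQ hg h2, seriesExp_evalQ hg (ordGE_log _)]
    conv_rhs => rw [h1]
    rw [seriesExp_seriesLog_one_add_X]
  have h4 : E1 * euler h = E1 * euler (PowerSeries.X : MvPowerSeries Unit ℚ) := by
    rw [← euler_seriesExp_of_commute hX (Commute.all _ _), ← hE1, ← h3,
      euler_seriesExp_of_commute (ordGE_log _) (Commute.all _ _)]
  have h5 : euler h = euler (PowerSeries.X : MvPowerSeries Unit ℚ) := by
    have := congrArg (fun z => seriesExp (-(PowerSeries.X : MvPowerSeries Unit ℚ)) * z) h4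
    simpa only [← mul_assoc, hE1, seriesExp_neg_mul hX, one_mul] using this
  refine MvPowerSeries.ext fun m => ?_
  by_cases hm : m = 0
  · rw [ordGE_log E1 m (by simp [hm]), hX m (by simp [hm])]
  · refine nsmul_right_cancel (n := m.degree) (by rwa [Ne, Finsupp.degree_eq_zero_iff]) ?_
    rw [← coeff_euler, h5, coeff_euler]

theorem ordGE_X_unit : OrdGE 1 (PowerSeries.X : MvPowerSeries Unit ℚ) := by
  rw [ordGE_one_iff]; exact PowerSeries.constantCoeff_X

/-- Everything takes place among values of rational one-variable series at `f - 1`, so the case of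
`1 + X` suffices. -/
theorem seriesExp_seriesLog {f : MvPowerSeries σ A} (hf : constantCoeff f = 1) :
    seriesExp (seriesLog f) = f := by
  have hg : OrdGE 1 (f - 1) := by rw [ordGE_one_iff, map_sub, hf, map_one, sub_self]
  have h1 : f = evalQ (1 + PowerSeries.X) (f - 1) := by
    rw [evalQ_add, evalQ_one, evalQ_X hg]; abel
  have h2 : OrdGE 1 ((1 + PowerSeries.X : MvPowerSeries Unit ℚ) - 1) := by
    rw [add_sub_cancel_left]; exact ordGE_X_unit
  conv_lhs => rw [h1]
  conv_rhs => rw [h1]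
  rw [seriesLog_evalQ hg h2, seriesExp_evalQ hg (ordGE_log _), seriesExp_seriesLog_one_add_X]

theorem seriesLog_seriesExp {f : MvPowerSeries σ A} (hf : OrdGE 1 f) :
    seriesLog (seriesExp f) = f := by
  conv_lhs => rw [← evalQ_X hf]
  rw [seriesExp_evalQ hf ordGE_X_unit, seriesLog_evalQ hf (ordGE_exp_sub_one _),
    seriesLog_seriesExp_X, evalQ_X hf]

end EvalRational

/-! ### Coefficientwise homomorphisms -/

section Maps

variable {σ : Type*} {A B : Type*} [Ring A] [Ring B]

theorem map_isum (φ : A →+* B) (f : ℕ → MvPowerSeries σ A) :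
    MvPowerSeries.map φ (isum f) = isum fun k => MvPowerSeries.map φ (f k) := by
  ext m
  simp [isum, coeff_ofCoeff, coeff_map]

variable [Algebra ℚ A] [Algebra ℚ B]

theorem map_qsmul (φ : A →ₐ[ℚ] B) (c : ℚ) (f : MvPowerSeries σ A) :
    MvPowerSeries.map (φ : A →+* B) (c • f) = c • MvPowerSeries.map (φ : A →+* B) f := by
  ext m
  simp [coeff_map]

theorem map_seriesExp (φ : A →ₐ[ℚ] B) (f : MvPowerSeries σ A) :
    MvPowerSeries.map (φ : A →+* B) (seriesExp f) =
      seriesExp (MvPowerSeries.map (φ : A →+* B) f) := by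
  simp only [seriesExp_eq_isum, map_isum, map_qsmul, map_pow]

end Maps

/-! ### Inverses of series with constant term one -/

section Inverse

variable {σ : Type*} {A : Type*} [Ring A]

theorem mul_seriesInv {f : MvPowerSeries σ A} (hf : constantCoeff f = 1) :
    f * seriesInv f = 1 := mul_invOfUnit f 1 (by simpa using hf)

theorem seriesInv_mul {f : MvPowerSeries σ A} (hf : constantCoeff f = 1) :
    seriesInv f * f = 1 := invOfUnit_mul f 1 (by simpa using hf)

theorem seriesInv_eq {f g : MvPowerSeries σ A} (hf : constantCoeff f = 1) (h : f * g = 1) :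
    seriesInv f = g := by
  rw [← mul_one (seriesInv f), ← h, ← mul_assoc, seriesInv_mul hf, one_mul]

theorem constantCoeff_seriesInv (f : MvPowerSeries σ A) : constantCoeff (seriesInv f) = 1 := by
  simp [seriesInv]

end Inverse

/-! ### Substitution of monomials -/

/-- A substitution `x^m ↦ c(m) x^{α(m)}` of monomials, with `c` multiplicative and `α` additive,
which does not lower degrees and maps only finitely many monomials to each monomial. -/
structure MonomialSubst (σ τ : Type*) where
  exponent : (σ →₀ ℕ) →+ (τ →₀ ℕ)
  weight : (σ →₀ ℕ) → ℤ
  weight_zero : weight 0 = 1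
  weight_add : ∀ m n, weight (m + n) = weight m * weight n
  degree_le : ∀ m, m.degree ≤ (exponent m).degree
  finite : ∀ n, {m | exponent m = n}.Finite

namespace MonomialSubst

variable {σ τ : Type*} (S : MonomialSubst σ τ) {A : Type*} [Ring A]

/-- The monomials which are mapped to the monomial `n`. -/
def fiber (n : τ →₀ ℕ) : Finset (σ →₀ ℕ) := (S.finite n).toFinset

theorem mem_fiber {n : τ →₀ ℕ} {m : σ →₀ ℕ} : m ∈ S.fiber n ↔ S.exponent m = n := by
  simp [fiber]

theorem degree_le_of_mem_fiber {n : τ →₀ ℕ} {m : σ →₀ ℕ} (h : m ∈ S.fiber n) :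
    m.degree ≤ n.degree := S.mem_fiber.1 h ▸ S.degree_le m

theorem fiber_zero : S.fiber 0 = {0} := by
  ext m
  rw [mem_fiber, mem_singleton]
  refine ⟨fun h => ?_, fun h => by rw [h, map_zero]⟩
  have := S.degree_le m
  rwa [h, map_zero, Nat.le_zero, Finsupp.degree_eq_zero_iff] at this

/-- The effect of a substitution on series. -/
def subst : MvPowerSeries σ A →+* MvPowerSeries τ A where
  toFun f := ofCoeff fun n => ∑ m ∈ S.fiber n, S.weight m • coeff m f
  map_zero' := by ext n; simp [coeff_ofCoeff]
  map_add' f g := by ext n; simp [coeff_ofCoeff, sum_add_distrib]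
  map_one' := by
    classical
    ext n
    rw [coeff_ofCoeff]
    by_cases hn : n = 0
    · subst hn
      rw [fiber_zero, sum_singleton, S.weight_zero, one_smul, coeff_zero_one, coeff_zero_one]
    · rw [coeff_one, if_neg hn]
      refine Finset.sum_eq_zero fun m hm => ?_
      rw [coeff_one, if_neg, smul_zero]
      rintro rfl
      exact hn (by simpa using (S.mem_fiber.1 hm).symm)
  map_mul' f g := by
    classical
    ext n
    rw [coeff_mul]
    simp only [coeff_ofCoeff, coeff_mul, smul_sum, sum_mul_sum]
    simp_rw [← sum_product']
    rw [sum_sigma', sum_sigma']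
    -- A decomposition of a preimage of `n` is the same as a decomposition of `n` together with a
    -- preimage of each part.
    refine Finset.sum_bij' (fun x _ => ⟨(S.exponent x.2.1, S.exponent x.2.2), x.2⟩)
      (fun x _ => ⟨x.2.1 + x.2.2, x.2⟩) ?_ ?_ ?_ ?_ ?_
    · rintro ⟨m, p⟩ h
      simp only [mem_sigma, mem_fiber, HasAntidiagonal.mem_antidiagonal, mem_product,
        and_self, and_true] at h ⊢
      rw [← map_add, h.2, h.1]
    · rintro ⟨q, p⟩ h
      simp only [mem_sigma, mem_fiber, HasAntidiagonal.mem_antidiagonal, mem_product,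
        and_true] at h ⊢
      rw [map_add, h.2.1, h.2.2, h.1]
    · rintro ⟨m, p⟩ h
      simp only [mem_sigma, HasAntidiagonal.mem_antidiagonal] at h
      obtain ⟨-, rfl⟩ := h
      rfl
    · rintro ⟨⟨q1, q2⟩, p⟩ h
      simp only [mem_sigma, mem_fiber, mem_product] at h
      obtain ⟨-, rfl, rfl⟩ := h
      rfl
    · rintro ⟨m, p⟩ h
      simp only [mem_sigma, HasAntidiagonal.mem_antidiagonal] at h
      obtain ⟨-, rfl⟩ := h
      simp only [S.weight_add, smul_mul_smul_comm]

theorem coeff_subst (f : MvPowerSeries σ A) (n : τ →₀ ℕ) :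
    coeff n (S.subst f) = ∑ m ∈ S.fiber n, S.weight m • coeff m f := rfl

theorem subst_isum {f : ℕ → MvPowerSeries σ A} (hf : ∀ k, OrdGE k (f k)) :
    S.subst (isum f) = isum fun k => S.subst (f k) := by
  ext n
  rw [coeff_subst]
  simp only [isum, coeff_ofCoeff, coeff_subst]
  rw [Finset.sum_comm]
  refine Finset.sum_congr rfl fun m hm => ?_
  rw [← smul_sum]
  congr 1
  exact coeff_isum hf (S.degree_le_of_mem_fiber hm)

theorem constantCoeff_subst (f : MvPowerSeries σ A) :
    constantCoeff (S.subst f) = constantCoeff f := by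
  rw [← coeff_zero_eq_constantCoeff_apply, coeff_subst, fiber_zero, sum_singleton, S.weight_zero,
    one_smul, coeff_zero_eq_constantCoeff_apply]

theorem subst_seriesInv {f : MvPowerSeries σ A} (hf : constantCoeff f = 1) :
    S.subst (seriesInv f) = seriesInv (S.subst f) := by
  symm
  refine seriesInv_eq ((S.constantCoeff_subst f).trans hf) ?_
  rw [← map_mul, mul_seriesInv hf, map_one]

/-- The substitution `t ↦ c x^d`. -/
def ofMonomial (c : ℤ) (d : τ →₀ ℕ) (hd : d ≠ 0) : MonomialSubst Unit τ where
  exponent := { toFun := fun m => m () • d, map_zero' := by simp, map_add' := by simp [add_smul] }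
  weight m := c ^ m ()
  weight_zero := by simp
  weight_add m n := by simp [pow_add]
  degree_le m := by
    have h1 : m.degree = m () := by simp [Finsupp.degree_eq_sum]
    have h2 : d.degree ≠ 0 := by rwa [Ne, Finsupp.degree_eq_zero_iff]
    simp only [AddMonoidHom.coe_mk, ZeroHom.coe_mk, map_nsmul, h1, smul_eq_mul]
    exact Nat.le_mul_of_pos_right _ (Nat.pos_of_ne_zero h2)
  finite n := by
    refine Set.Finite.subset (Finsupp.finite_of_degree_le (σ := Unit) n.degree) fun m hm => ?_
    have h1 : m.degree = m () := by simp [Finsupp.degree_eq_sum]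
    have h2 : d.degree ≠ 0 := by rwa [Ne, Finsupp.degree_eq_zero_iff]
    have h3 : n.degree = m () * d.degree := by
      rw [← show m () • d = n from hm]; exact map_nsmul Finsupp.degree _ _
    change m.degree ≤ n.degree
    rw [h1, h3]
    exact Nat.le_mul_of_pos_right _ (Nat.pos_of_ne_zero h2)

theorem ofMonomial_exponent (c : ℤ) (d : τ →₀ ℕ) (hd : d ≠ 0) (m : Unit →₀ ℕ) :
    (ofMonomial c d hd).exponent m = m () • d := rfl

theorem substMonomial_eq (f : PowerSeries A) (c : ℤ) (d : τ →₀ ℕ) (hd : d ≠ 0) :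
    substMonomial f c d = (ofMonomial c d hd).subst (f : MvPowerSeries Unit A) := by
  classical
  ext n
  rw [substMonomial, coeff_ofCoeff, coeff_subst, ← Finset.sum_filter]
  symm
  refine Finset.sum_bij' (fun m _ => m ()) (fun k _ => Finsupp.single () k) ?_ ?_ ?_ ?_ ?_
  · intro m hm
    have h2 := (ofMonomial c d hd).degree_le_of_mem_fiber hm
    rw [mem_fiber, ofMonomial_exponent] at hm
    have h3 : m.degree = m () := by simp [Finsupp.degree_eq_sum]
    rw [Finset.mem_filter, mem_range]
    exact ⟨by omega, by convert hm⟩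
  · intro k hk
    rw [Finset.mem_filter] at hk
    rw [mem_fiber, ofMonomial_exponent, Finsupp.single_eq_same]
    convert hk.2
  · intro m hm
    ext; simp
  · intro k hk
    simp
  · intro m hm
    have h : m = Finsupp.single () (m ()) := by ext; simp
    rw [PowerSeries.coeff, ← h]
    rfl

variable [Algebra ℚ A]

theorem subst_qsmul (c : ℚ) (f : MvPowerSeries σ A) : S.subst (c • f) = c • S.subst f := by
  ext n
  simp only [coeff_subst, coeff_qsmul, smul_sum]
  exact Finset.sum_congr rfl fun m _ => smul_comm _ _ _

theorem subst_seriesExp {f : MvPowerSeries σ A} (hf : OrdGE 1 f) :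
    S.subst (seriesExp f) = seriesExp (S.subst f) := by
  rw [seriesExp_eq_isum, seriesExp_eq_isum, S.subst_isum fun k => (hf.pow k).smul _]
  simp only [subst_qsmul, map_pow]

theorem subst_seriesLog {f : MvPowerSeries σ A} (hf : constantCoeff f = 1) :
    S.subst (seriesLog f) = seriesLog (S.subst f) := by
  have hg : OrdGE 1 (f - 1) := by rw [ordGE_one_iff, map_sub, hf, map_one, sub_self]
  rw [seriesLog_eq_isum, seriesLog_eq_isum, S.subst_isum fun k => (hg.pow k).smul _]
  simp only [subst_qsmul, map_pow, map_sub, map_one]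

end MonomialSubst

/-! ### Infinite products of commuting exponentials -/

section InfProd

variable {σ : Type*} {A : Type*} [Ring A] [Algebra ℚ A]

theorem list_prod_seriesExp {a : ℕ → MvPowerSeries σ A} (ha : ∀ l, OrdGE 1 (a l))
    (hc : ∀ k l, Commute (a k) (a l)) (N : ℕ) :
    ((List.range N).map fun l => seriesExp (a l)).prod = seriesExp (∑ l ∈ range N, a l) := by
  induction N with
  | zero => simp [seriesExp_zero]
  | succ N ih =>
    rw [List.range_succ, List.map_append, List.prod_append, ih, sum_range_succ,
      seriesExp_add (OrdGE.sum fun i _ => ha i) (ha N) (Commute.sum_left _ _ _ fun i _ => hc i N)]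
    simp

theorem infProd_seriesExp {a : ℕ+ → MvPowerSeries σ A} (ha : ∀ l : ℕ+, OrdGE l (a l))
    (hc : ∀ k l, Commute (a k) (a l)) :
    infProd (fun l => seriesExp (a l)) =
      seriesExp (isum fun k => if h : 0 < k then a ⟨k, h⟩ else 0) := by
  ext m
  rw [infProd, coeff_ofCoeff,
    list_prod_seriesExp (a := fun l => a l.succPNat) (fun l => (ha _).mono (by simp))
      (fun k l => hc _ _)]
  -- Only the exponents up to the degree of `m` matter, and there the finite sum and the infinite
  -- sum agree because `a l` has order at least `l`.
  refine Cong.exp (isLowerSet_degree_le m.degree) (fun n hn => ?_) m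
    (show m.degree ≤ m.degree from le_rfl)
  rw [coeff_isum _ (show n.degree ≤ m.degree from hn), Finset.sum_range_succ', map_sum]
  · simp [Nat.succPNat]
  · intro k
    split_ifs with h
    · exact ha ⟨k, h⟩
    · exact ordGE_zero _

end InfProd


theorem coeff_commutator {σ : Type*} [DecidableEq σ] {A : Type*} [Ring A] (f g : MvPowerSeries σ A)
    (m : σ →₀ ℕ) : coeff m (f * g - g * f) = ∑ p ∈ HasAntidiagonal.antidiagonal m,
      (coeff p.1 f * coeff p.2 g - coeff p.2 g * coeff p.1 f) := by
  rw [map_sub, coeff_mul, coeff_mul, sum_sub_distrib]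
  congr 1
  exact Finsupp.sum_antidiagonal_swap m fun a b => coeff a g * coeff b f

/-! ### Logarithmic derivatives of products -/

section LogDeriv

variable {σ L : Type*} [Ring L]

theorem seriesInv_mul_rev {x y : MvPowerSeries σ L} (hx : constantCoeff x = 1)
    (hy : constantCoeff y = 1) : seriesInv (x * y) = seriesInv y * seriesInv x := by
  refine seriesInv_eq (by rw [map_mul, hx, hy, mul_one]) ?_
  rw [mul_assoc, ← mul_assoc y, mul_seriesInv hy, one_mul, mul_seriesInv hx]

/-- In the noncommutative product rule, the logarithmic derivative of the left factor is conjugated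
by the right factor. -/
theorem logDeriv_mul {x y : MvPowerSeries σ L} (hx : constantCoeff x = 1)
    (hy : constantCoeff y = 1) : seriesInv (x * y) * euler (x * y) =
      seriesInv y * (seriesInv x * euler x) * y + seriesInv y * euler y := by
  rw [seriesInv_mul_rev hx hy, euler_mul, mul_add]
  congr 1
  · simp only [mul_assoc]
  · rw [mul_assoc, ← mul_assoc (seriesInv x), seriesInv_mul hx, one_mul]

end LogDeriv

/-! ### Roots of monomials -/

section Divisors

variable {σ : Type*}

/-- The pairs `(i, n)` with `i ≥ 1` and `n ≠ 0` such that `i • n = m`. -/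
def divs (m : σ →₀ ℕ) : Finset (ℕ × (σ →₀ ℕ)) :=
  open Classical in
  (range (m.degree + 1) ×ˢ Iic m).filter fun p => p.1 ≠ 0 ∧ p.2 ≠ 0 ∧ p.1 • p.2 = m

theorem mem_divs {m : σ →₀ ℕ} {p : ℕ × (σ →₀ ℕ)} :
    p ∈ divs m ↔ p.1 ≠ 0 ∧ p.2 ≠ 0 ∧ p.1 • p.2 = m := by
  classical
  rw [divs, Finset.mem_filter]
  refine ⟨fun h => h.2, fun h => ⟨?_, h⟩⟩
  obtain ⟨h1, h2, rfl⟩ := h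
  rw [mem_product, mem_range, mem_Iic]
  have h3 : (p.1 • p.2).degree = p.1 * p.2.degree := map_nsmul Finsupp.degree _ _
  have h4 : p.2.degree ≠ 0 := by rwa [Ne, Finsupp.degree_eq_zero_iff]
  refine ⟨?_, fun s => ?_⟩
  · rw [h3]; exact Nat.lt_succ_of_le (Nat.le_mul_of_pos_right _ (Nat.pos_of_ne_zero h4))
  · simpa using Nat.le_mul_of_pos_left _ (Nat.pos_of_ne_zero h1)

theorem degree_of_mem_divs {m : σ →₀ ℕ} {p : ℕ × (σ →₀ ℕ)} (h : p ∈ divs m) :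
    m.degree = p.1 * p.2.degree := by
  rw [← (mem_divs.1 h).2.2]; exact map_nsmul Finsupp.degree _ _

theorem le_of_mem_divs {m : σ →₀ ℕ} {p : ℕ × (σ →₀ ℕ)} (h : p ∈ divs m) : p.2 ≤ m := by
  obtain ⟨h1, -, rfl⟩ := mem_divs.1 h
  intro s
  simpa using Nat.le_mul_of_pos_left _ (Nat.pos_of_ne_zero h1)

theorem degree_pos_of_mem_divs {m : σ →₀ ℕ} {p : ℕ × (σ →₀ ℕ)} (h : p ∈ divs m) :
    0 < p.2.degree := by
  rw [Nat.pos_iff_ne_zero, Ne, Finsupp.degree_eq_zero_iff]; exact (mem_divs.1 h).2.1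

theorem divs_zero : divs (0 : σ →₀ ℕ) = ∅ := by
  ext p
  have : ¬ p ∈ divs (0 : σ →₀ ℕ) := by
    rw [mem_divs]
    rintro ⟨h1, h2, h3⟩
    rcases smul_eq_zero.1 h3 with h | h
    · exact h1 h
    · exact h2 h
  simpa using this

end Divisors

/-! ### The operator `T` and the multiplicativity of `exp ∘ T ∘ log` -/

section LieOperator

variable {σ τ : Type*} {L B : Type*} [Ring L] [Algebra ℚ L] [Ring B] [Algebra ℚ B]

/-- The operator `f(x) ↦ ∑_{i ≥ 1} t_i(f(x^i))`, with `t_i` applied coefficientwise, where `f` has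
no constant term. -/
def lieOp (t : ℕ → L →ₗ[ℚ] B) : MvPowerSeries σ L →+ MvPowerSeries σ B where
  toFun f := ofCoeff fun m => ∑ p ∈ divs m, t p.1 (coeff p.2 f)
  map_zero' := by ext m; simp [coeff_ofCoeff]
  map_add' f g := by ext m; simp [coeff_ofCoeff, sum_add_distrib]

variable (t : ℕ → L →ₗ[ℚ] B)

theorem coeff_lieOp (f : MvPowerSeries σ L) (m : σ →₀ ℕ) :
    coeff m (lieOp t f) = ∑ p ∈ divs m, t p.1 (coeff p.2 f) := rfl

theorem lieOp_qsmul (c : ℚ) (f : MvPowerSeries σ L) : lieOp t (c • f) = c • lieOp t f := by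
  ext m
  simp only [coeff_lieOp, coeff_qsmul, map_smul, smul_sum]

theorem ordGE_one_lieOp (f : MvPowerSeries σ L) : OrdGE 1 (lieOp t f) := fun m hm => by
  have : m = 0 := by rwa [Nat.lt_one_iff, Finsupp.degree_eq_zero_iff] at hm
  rw [coeff_lieOp, this, divs_zero, sum_empty]

theorem lieOp_isum {f : ℕ → MvPowerSeries σ L} (hf : ∀ k, OrdGE k (f k)) :
    lieOp t (isum f) = isum fun k => lieOp t (f k) := by
  ext m
  rw [coeff_lieOp]
  simp only [isum, coeff_ofCoeff, coeff_lieOp]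
  rw [Finset.sum_comm]
  refine Finset.sum_congr rfl fun p hp => ?_
  rw [← map_sum (t p.1)]
  exact congrArg (t p.1) (coeff_isum hf (Finsupp.degree_mono (le_of_mem_divs hp)))

theorem Cong.lieOp {P : Set (σ →₀ ℕ)} (hP : IsLowerSet P) {f g : MvPowerSeries σ L}
    (h : Cong P f g) : Cong P (lieOp t f) (lieOp t g) := fun m hm => by
  rw [coeff_lieOp, coeff_lieOp]
  exact Finset.sum_congr rfl fun p hp => by rw [h p.2 (hP (le_of_mem_divs hp) hm)]

/-- The family `i ↦ i t_i`. -/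
def scaled : ℕ → L →ₗ[ℚ] B := fun i => (i : ℚ) • t i

/-- The monomial `x^(i n)` has `i` times the degree of `x^n`, so differentiating `t_i(f(x^i))`
brings out a factor `i`. For this reason `scaled t` appears in all statements about derivatives. -/
theorem euler_lieOp (f : MvPowerSeries σ L) :
    euler (lieOp t f) = lieOp (scaled t) (euler f) := by
  ext m
  rw [coeff_euler, coeff_lieOp, coeff_lieOp, smul_sum]
  refine Finset.sum_congr rfl fun p hp => ?_
  rw [degree_of_mem_divs hp, coeff_euler, map_nsmul, scaled, LinearMap.smul_apply,
    Nat.cast_smul_eq_nsmul, smul_smul, mul_comm]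

/-- The operator replaces `x` by `x^i`, so a substitution commutes with it if `x^m` and `x^(i m)`
carry the same weight. A sign change `x ↦ -x` does not satisfy this condition; signs are treated
separately through `flip`. -/
theorem subst_lieOp (S : MonomialSubst σ τ)
    (hS : ∀ i, i ≠ 0 → ∀ m, S.weight (i • m) = S.weight m) (f : MvPowerSeries σ L) :
    S.subst (lieOp t f) = lieOp t (S.subst f) := by
  ext n
  rw [MonomialSubst.coeff_subst, coeff_lieOp]
  simp only [coeff_lieOp, MonomialSubst.coeff_subst, map_sum, smul_sum, map_zsmul]
  rw [sum_sigma', sum_sigma']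
  refine Finset.sum_bij' (fun x _ => ⟨(x.2.1, S.exponent x.2.2), x.2.2⟩)
    (fun x _ => ⟨x.1.1 • x.2, (x.1.1, x.2)⟩) ?_ ?_ ?_ ?_ ?_
  · rintro ⟨m, p⟩ h
    simp only [mem_sigma, MonomialSubst.mem_fiber, mem_divs, and_true] at h ⊢
    obtain ⟨h1, h2, h3, rfl⟩ := h
    rw [map_nsmul] at h1
    refine ⟨h2, fun h0 => h3 ?_, h1⟩
    have := S.mem_fiber.2 h0
    rwa [S.fiber_zero, mem_singleton] at this
  · rintro ⟨⟨i, n'⟩, m⟩ h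
    simp only [mem_sigma, MonomialSubst.mem_fiber, mem_divs, and_true] at h ⊢
    obtain ⟨⟨h1, h2, h3⟩, rfl⟩ := h
    exact ⟨by rw [map_nsmul, h3], h1, fun h0 => h2 (by rw [h0, map_zero])⟩
  · rintro ⟨m, p⟩ h
    simp only [mem_sigma, mem_divs] at h
    obtain ⟨-, -, -, rfl⟩ := h
    rfl
  · rintro ⟨⟨i, n'⟩, m⟩ h
    simp only [mem_sigma, MonomialSubst.mem_fiber] at h
    obtain ⟨-, rfl⟩ := h
    rfl
  · rintro ⟨m, p⟩ h
    simp only [mem_sigma, mem_divs] at h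
    obtain ⟨-, h1, -, rfl⟩ := h
    rw [hS _ h1]

/-- The failure of `t_i` and `t'_j` to satisfy the Lie relation `[t_i a, t'_j b] = δ_ij t'_i[a, b]`. -/
def defect (t t' : ℕ → L →ₗ[ℚ] B) (i j : ℕ) (a b : L) : B :=
  t i a * t' j b - t' j b * t i a - if i = j then t' i (a * b - b * a) else 0

/-- Expanding the commutator gives a sum over pairs `t_i(f(x^i))`, `t'_j(g(x^j))`, and the terms of
`T'[f, g]` correspond to the diagonal pairs `i = j`. -/
theorem coeff_bracket_lieOp [DecidableEq σ] (t t' : ℕ → L →ₗ[ℚ] B) {f g : MvPowerSeries σ L}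
    (hf : OrdGE 1 f) (hg : OrdGE 1 g) (m : σ →₀ ℕ) :
    coeff m (lieOp t f * lieOp t' g - lieOp t' g * lieOp t f - lieOp t' (f * g - g * f)) =
      ∑ x ∈ HasAntidiagonal.antidiagonal m, ∑ p ∈ divs x.1, ∑ q ∈ divs x.2,
        defect t t' p.1 q.1 (coeff p.2 f) (coeff q.2 g) := by
  have h1 : coeff m (lieOp t' (f * g - g * f)) =
      ∑ x ∈ HasAntidiagonal.antidiagonal m, ∑ p ∈ divs x.1, ∑ q ∈ divs x.2,
        if p.1 = q.1 then t' p.1 (coeff p.2 f * coeff q.2 g - coeff q.2 g * coeff p.2 f)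
        else 0 := by
    rw [coeff_lieOp]
    simp only [coeff_commutator, map_sum]
    simp_rw [← sum_product']
    -- `divs` only contains nonzero exponents, so decompositions with a zero part are discarded
    -- first. They contribute nothing because `f` and `g` have no constant term.
    rw [sum_sigma', sum_sigma', ← sum_filter_of_ne (p := fun x => x.2.1 ≠ 0 ∧ x.2.2 ≠ 0),
      ← sum_filter_of_ne (s := (HasAntidiagonal.antidiagonal m).sigma _)
        (p := fun x => x.2.1.1 = x.2.2.1)]
    · refine Finset.sum_bij'
        (fun x _ => ⟨(x.1.1 • x.2.1, x.1.1 • x.2.2), ((x.1.1, x.2.1), (x.1.1, x.2.2))⟩)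
        (fun x _ => ⟨(x.2.1.1, x.2.1.2 + x.2.2.2), (x.2.1.2, x.2.2.2)⟩) ?_ ?_ ?_ ?_ ?_
      · rintro ⟨⟨i, m'⟩, ⟨a, b⟩⟩ h
        simp only [Finset.mem_filter, mem_sigma, mem_divs, HasAntidiagonal.mem_antidiagonal,
          mem_product, and_true] at h ⊢
        obtain ⟨⟨⟨h1, h2, h3⟩, h4⟩, h5, h6⟩ := h
        rw [← smul_add, h4]
        exact ⟨h3, ⟨h1, h5⟩, h1, h6⟩
      · rintro ⟨⟨m1, m2⟩, ⟨⟨i, a⟩, ⟨j, b⟩⟩⟩ h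
        simp only [Finset.mem_filter, mem_sigma, mem_divs, HasAntidiagonal.mem_antidiagonal,
          mem_product, and_true] at h ⊢
        obtain ⟨⟨h1, ⟨h2, h3, h4⟩, h5, h6, h7⟩, rfl⟩ := h
        refine ⟨⟨h2, fun h0 => h3 (add_eq_zero.1 h0).1, ?_⟩, h3, h6⟩
        rw [smul_add, h4, h7, h1]
      · rintro ⟨⟨i, m'⟩, ⟨a, b⟩⟩ h
        simp only [Finset.mem_filter, mem_sigma, HasAntidiagonal.mem_antidiagonal] at h
        obtain ⟨⟨-, rfl⟩, -⟩ := h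
        rfl
      · rintro ⟨⟨m1, m2⟩, ⟨⟨i, a⟩, ⟨j, b⟩⟩⟩ h
        simp only [Finset.mem_filter, mem_sigma, mem_divs, mem_product] at h
        obtain ⟨⟨h1, ⟨h2, h3, rfl⟩, h5, h6, rfl⟩, rfl⟩ := h
        rfl
      · rintro ⟨⟨i, m'⟩, ⟨a, b⟩⟩ h
        simp only [if_true]
    · rintro ⟨⟨m1, m2⟩, ⟨⟨i, a⟩, ⟨j, b⟩⟩⟩ h h0
      by_contra h1
      exact h0 (if_neg h1)
    · rintro ⟨⟨i, m'⟩, ⟨a, b⟩⟩ h h0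
      constructor
      · rintro h1
        simp only at h1
        apply h0
        subst h1
        simp [hf 0 (by simp), -coeff_zero_eq_constantCoeff]
      · rintro h1
        simp only at h1
        apply h0
        subst h1
        simp [hg 0 (by simp), -coeff_zero_eq_constantCoeff]
  rw [map_sub, h1, coeff_commutator, ← sum_sub_distrib]
  refine Finset.sum_congr rfl fun x _ => ?_
  rw [coeff_lieOp, coeff_lieOp, sum_mul_sum, sum_mul_sum, Finset.sum_comm (s := divs x.2)]
  simp only [← sum_sub_distrib, defect]

/-- The bracket relation `[T f, T' g] = T'[f, g]` for the operators `T = lieOp t` and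
`T' = lieOp (scaled t)` holds, on the monomials in `P`, up to an error `κ f g` which is annihilated
by all series without constant term, and vanishes if `g` has no terms of degree one. -/
structure IsLieUpTo (P : Set (σ →₀ ℕ)) (t : ℕ → L →ₗ[ℚ] B)
    (κ : MvPowerSeries σ L → MvPowerSeries σ L → MvPowerSeries σ B) : Prop where
  lower : IsLowerSet P
  bracket : ∀ f g, OrdGE 1 f → OrdGE 1 g →
    Cong P (lieOp t f * lieOp (scaled t) g - lieOp (scaled t) g * lieOp t f)
      (lieOp (scaled t) (f * g - g * f) + κ f g)
  ord : ∀ f g, OrdGE 1 (κ f g)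
  ann_left : ∀ f g h, OrdGE 1 h → Cong P (h * κ f g) 0
  ann_right : ∀ f g h, OrdGE 1 h → Cong P (κ f g * h) 0
  high : ∀ f g, OrdGE 1 f → OrdGE 2 g → Cong P (κ f g) 0

variable {t} {P : Set (σ →₀ ℕ)} {κ : MvPowerSeries σ L → MvPowerSeries σ L → MvPowerSeries σ B}

theorem IsLieUpTo.bracket' (H : IsLieUpTo P t κ) {f g : MvPowerSeries σ L} (hf : OrdGE 1 f)
    (hg : OrdGE 1 g) :
    Cong P (lieOp (scaled t) g * lieOp t f - lieOp t f * lieOp (scaled t) g)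
      (lieOp (scaled t) (g * f - f * g) - κ f g) := by
  have := (H.bracket f g hf hg).neg
  rw [neg_sub, neg_add', ← map_neg, neg_sub] at this
  exact this

/-- The error enters at the first commutator only. Multiplication by a series without constant term
annihilates it afterwards, and the later iterates have order at least two, so they produce no new
error. -/
theorem IsLieUpTo.adPow_lieOp (H : IsLieUpTo P t κ) {a z : MvPowerSeries σ L} (ha : OrdGE 1 a)
    (hz : OrdGE 1 z) (k : ℕ) :
    Cong P (adPow (lieOp t a) (lieOp (scaled t) z) k)
      (lieOp (scaled t) (adPow a z k) - if k = 1 then κ a z else 0) := by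
  induction k with
  | zero => simpa [adPow] using Cong.refl _
  | succ k ih =>
    rw [adPow, adPow]
    have hw := ordGE_adPow' ha hz k
    set w := adPow a z k
    set ε : MvPowerSeries σ B := if k = 1 then κ a z else 0 with hε
    have h1 : Cong P (ε * lieOp t a) 0 := by
      rw [hε]; split_ifs
      · exact H.ann_right _ _ _ (ordGE_one_lieOp t a)
      · rw [zero_mul]; exact Cong.refl _
    have h2 : Cong P (lieOp t a * ε) 0 := by
      rw [hε]; split_ifs
      · exact H.ann_left _ _ _ (ordGE_one_lieOp t a)
      · rw [mul_zero]; exact Cong.refl _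
    have h3 := (ih.mul H.lower (Cong.refl (lieOp t a))).sub ((Cong.refl (lieOp t a)).mul H.lower ih)
    refine h3.trans ?_
    have h4 := ((H.bracket' ha (hw.mono (by omega))).sub h1).add h2
    have h5 : (lieOp (scaled t) w - ε) * lieOp t a - lieOp t a * (lieOp (scaled t) w - ε) =
      lieOp (scaled t) w * lieOp t a - lieOp t a * lieOp (scaled t) w - ε * lieOp t a +
        lieOp t a * ε := by noncomm_ring
    rw [h5]
    refine h4.trans ?_
    rw [sub_zero, add_zero]
    refine (Cong.refl _).sub ?_
    by_cases hk : k = 0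
    · subst hk
      exact Cong.refl _
    · rw [if_neg (by omega)]
      exact H.high _ _ ha (hw.mono (by omega))

/-- Only the term `k = 1` of the series carries an error, with coefficient `1/1!`. -/
theorem IsLieUpTo.conjExp_lieOp (H : IsLieUpTo P t κ) {a z : MvPowerSeries σ L} (ha : OrdGE 1 a)
    (hz : OrdGE 1 z) :
    Cong P (conjExp (lieOp t a) (lieOp (scaled t) z))
      (lieOp (scaled t) (conjExp a z) - κ a z) := by
  have h1 : κ a z = isum fun k => (1 / (k.factorial : ℚ)) • if k = 1 then κ a z else 0 := by
    ext m
    rw [coeff_isum (N := m.degree + 1) _ (by omega), Finset.sum_eq_single 1]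
    · simp
    · intro k _ hk; simp [hk]
    · simp
    · intro k
      split_ifs with h
      · rw [h]; exact (H.ord a z).smul _
      · rw [smul_zero]; exact ordGE_zero _
  rw [conjExp, conjExp, lieOp_isum _ fun k => (ordGE_adPow ha z k).smul _, sub_eq_add_neg]
  have h2 : -κ a z = isum fun k => -((1 / (k.factorial : ℚ)) • if k = 1 then κ a z else 0) := by
    conv_lhs => rw [h1]
    ext m; simp [isum, coeff_ofCoeff]
  rw [h2, ← isum_add]
  refine isum_congr fun k => ?_
  rw [lieOp_qsmul, ← sub_eq_add_neg, ← smul_sub]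
  exact (H.adPow_lieOp ha hz k).smul _

theorem IsLieUpTo.logDerivExp_lieOp (H : IsLieUpTo P t κ) {a : MvPowerSeries σ L}
    (ha : OrdGE 1 a) (h0 : Cong P (κ a (euler a)) 0) :
    Cong P (logDerivExp (lieOp t a)) (lieOp (scaled t) (logDerivExp a)) := by
  rw [logDerivExp, logDerivExp, lieOp_isum _ fun k => ((ordGE_adPow' ha ha.euler k).mono
    (Nat.le_succ k)).smul _]
  refine isum_congr fun k => ?_
  rw [lieOp_qsmul, euler_lieOp]
  refine Cong.smul ((H.adPow_lieOp ha ha.euler k).trans ?_) _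
  conv_rhs => rw [← sub_zero (lieOp (scaled t) (adPow a (euler a) k))]
  refine (Cong.refl _).sub ?_
  split_ifs
  · exact h0
  · exact Cong.refl _

/-- The map `x ↦ exp(T(log x))`. -/
def lieExp (t : ℕ → L →ₗ[ℚ] B) (x : MvPowerSeries σ L) : MvPowerSeries σ B :=
  seriesExp (lieOp t (seriesLog x))

theorem constantCoeff_lieExp (x : MvPowerSeries σ L) : constantCoeff (lieExp t x) = 1 :=
  constantCoeff_exp _

theorem Cong.lieExp (hP : IsLowerSet P) {x y : MvPowerSeries σ L} (h : Cong P x y) :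
    Cong P (lieExp t x) (lieExp t y) :=
  ((h.log hP).lieOp t hP).exp hP

theorem subst_lieExp (S : MonomialSubst σ τ)
    (hS : ∀ i, i ≠ 0 → ∀ m, S.weight (i • m) = S.weight m) {x : MvPowerSeries σ L}
    (hx : constantCoeff x = 1) : S.subst (lieExp t x) = lieExp t (S.subst x) := by
  rw [lieExp, lieExp, S.subst_seriesExp (ordGE_one_lieOp t _), subst_lieOp t S hS,
    S.subst_seriesLog hx]

theorem lieExp_one : lieExp t (1 : MvPowerSeries σ L) = 1 := by
  rw [lieExp, ← seriesExp_zero (σ := σ) (A := L), seriesLog_seriesExp (ordGE_zero 1), map_zero,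
    seriesExp_zero]

theorem conjExp_seriesLog {x : MvPowerSeries σ L} (hx : constantCoeff x = 1)
    (z : MvPowerSeries σ L) : conjExp (seriesLog x) z = seriesInv x * z * x := by
  have h := mul_seriesExp (ordGE_log x) z
  rw [seriesExp_seriesLog hx] at h
  rw [mul_assoc, h, ← mul_assoc, seriesInv_mul hx, one_mul]

theorem logDerivExp_seriesLog {x : MvPowerSeries σ L} (hx : constantCoeff x = 1) :
    logDerivExp (seriesLog x) = seriesInv x * euler x := by
  have h := euler_seriesExp (ordGE_log x)
  rw [seriesExp_seriesLog hx] at h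
  rw [h, ← mul_assoc, seriesInv_mul hx, one_mul]

theorem IsLieUpTo.mul_lieExp (H : IsLieUpTo P t κ) {x z : MvPowerSeries σ L}
    (hx : constantCoeff x = 1) (hz : OrdGE 1 z) :
    Cong P (lieOp (scaled t) z * lieExp t x)
      (lieExp t x * (lieOp (scaled t) (seriesInv x * z * x) - κ (seriesLog x) z)) := by
  rw [lieExp, mul_seriesExp (ordGE_one_lieOp t _), ← conjExp_seriesLog hx]
  exact (Cong.refl _).mul H.lower (H.conjExp_lieOp (ordGE_log x) hz)

theorem IsLieUpTo.euler_lieExp (H : IsLieUpTo P t κ) {x : MvPowerSeries σ L}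
    (hx : constantCoeff x = 1) (h0 : Cong P (κ (seriesLog x) (euler (seriesLog x))) 0) :
    Cong P (euler (lieExp t x)) (lieExp t x * lieOp (scaled t) (seriesInv x * euler x)) := by
  rw [lieExp, euler_seriesExp (ordGE_one_lieOp t _), ← logDerivExp_seriesLog hx]
  exact (Cong.refl _).mul H.lower (H.logDerivExp_lieOp (ordGE_log x) h0)

/-- The exact Lie relations `[t_i a, t_j b] = δ_ij t_i[a, b]`. -/
def IsLieFamily (t : ℕ → L →ₗ[ℚ] B) : Prop :=
  ∀ i j, i ≠ 0 → j ≠ 0 → ∀ a b, defect t t i j a b = 0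

theorem defect_scaled (i j : ℕ) (a b : L) :
    defect t (scaled t) i j a b = (j : ℚ) • defect t t i j a b := by
  simp only [defect, scaled, LinearMap.smul_apply, mul_smul_comm, smul_mul_assoc, smul_sub]
  congr 1
  split_ifs with h
  · rw [h]
  · rw [smul_zero]

theorem IsLieFamily.isLieUpTo (H : IsLieFamily t) :
    IsLieUpTo (Set.univ : Set (σ →₀ ℕ)) t 0 where
  lower := isLowerSet_univ
  bracket f g hf hg m _ := by
    classical
    rw [← sub_eq_zero, ← map_sub, Pi.zero_apply, Pi.zero_apply, add_zero,
      coeff_bracket_lieOp _ _ hf hg]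
    refine Finset.sum_eq_zero fun x _ => Finset.sum_eq_zero fun p hp =>
      Finset.sum_eq_zero fun q hq => ?_
    rw [defect_scaled, H _ _ (mem_divs.1 hp).1 (mem_divs.1 hq).1, smul_zero]
  ord _ _ := ordGE_zero 1
  ann_left f g h _ := by rw [Pi.zero_apply, Pi.zero_apply, mul_zero]; exact Cong.refl _
  ann_right f g h _ := by rw [Pi.zero_apply, Pi.zero_apply, zero_mul]; exact Cong.refl _
  high _ _ _ _ := Cong.refl _

/-- Both sides have constant term one and satisfy `D f = f · T'((xy)⁻¹ D(xy))`, where `T'` is built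
from the maps `i t_i`. For the product, `T'(x⁻¹ D x)` is moved past `lieExp t y`, which conjugates
its argument by `y` and so matches `logDeriv_mul`. -/
theorem IsLieFamily.lieExp_mul (H : IsLieFamily t) {x y : MvPowerSeries σ L}
    (hx : constantCoeff x = 1) (hy : constantCoeff y = 1) :
    lieExp t (x * y) = lieExp t x * lieExp t y := by
  have HL := H.isLieUpTo (σ := σ)
  have hxy : constantCoeff (x * y) = 1 := by rw [map_mul, hx, hy, mul_one]
  have hcx := HL.euler_lieExp hx (Cong.refl _)
  have hcy := HL.euler_lieExp hy (Cong.refl _)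
  have hcxy := HL.euler_lieExp hxy (Cong.refl _)
  have hm := HL.mul_lieExp (z := seriesInv x * euler x) hy ((ordGE_euler x).mul_left _)
  rw [cong_univ] at hcx hcy hm
  rw [← cong_univ]
  refine eq_of_euler_eq isLowerSet_univ (ordGE_one_lieOp (scaled t) _) ?_ hcxy ?_
  · rw [map_mul, constantCoeff_lieExp, constantCoeff_lieExp, constantCoeff_lieExp, mul_one]
  · rw [cong_univ, euler_mul, hcx, hcy, logDeriv_mul hx hy, map_add, mul_assoc, hm]
    simp only [Pi.zero_apply, sub_zero]
    noncomm_ring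

end LieOperator


/-! ### Terms of degree one, and the ring identity behind the first relation -/

section DegreeOne

variable {σ : Type*} {A : Type*} [Ring A]

theorem ordGE_monomial {d : σ →₀ ℕ} {n : ℕ} (h : n ≤ d.degree) (a : A) :
    OrdGE n (monomial d a) := fun m hm => by
  rw [coeff_monomial_ne]
  rintro rfl
  omega

theorem coeff_mul_of_degree_one {m : σ →₀ ℕ} (hm : m.degree = 1) (f g : MvPowerSeries σ A) :
    coeff m (f * g) = coeff m f * constantCoeff g + constantCoeff f * coeff m g := by
  have hf : OrdGE 1 (f - C (constantCoeff f)) := by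
    rw [ordGE_one_iff, map_sub, constantCoeff_C, sub_self]
  have hg : OrdGE 1 (g - C (constantCoeff g)) := by
    rw [ordGE_one_iff, map_sub, constantCoeff_C, sub_self]
  have h := hf.mul hg m (by omega)
  have hm0 : m ≠ 0 := by rintro rfl; simp at hm
  rw [sub_mul, mul_sub, mul_sub, ← map_mul, map_sub, map_sub, map_sub, coeff_mul_C, coeff_C_mul,
    coeff_C_of_ne_zero hm0] at h
  rw [sub_zero, sub_eq_zero, sub_eq_iff_eq_add'] at h
  exact h

theorem constantCoeff_one_sub_monomial {d : σ →₀ ℕ} (hd : d ≠ 0) (a : A) :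
    constantCoeff (1 - monomial d a) = 1 := by
  rw [← coeff_zero_eq_constantCoeff_apply, map_sub, coeff_zero_one, coeff_monomial_ne hd.symm,
    sub_zero]

theorem coeff_seriesLog_of_degree_one [Algebra ℚ A] {m : σ →₀ ℕ} (hm : m.degree = 1)
    (f : MvPowerSeries σ A) : coeff m (seriesLog f) = coeff m (f - 1) := by
  simp [seriesLog, coeff_ofCoeff, hm]

theorem seriesLog_seriesInv [Algebra ℚ A] {f : MvPowerSeries σ A} (hf : constantCoeff f = 1) :
    seriesLog (seriesInv f) = -seriesLog f := by
  have h : seriesInv f = seriesExp (-seriesLog f) := by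
    refine seriesInv_eq hf ?_
    have h0 := seriesExp_mul_neg (ordGE_log f)
    rwa [seriesExp_seriesLog hf] at h0
  rw [h, seriesLog_seriesExp (ordGE_log f).neg]

theorem seriesInv_lieExp {L B : Type*} [Ring L] [Algebra ℚ L] [Ring B] [Algebra ℚ B]
    (t : ℕ → L →ₗ[ℚ] B) {x : MvPowerSeries σ L} (hx : constantCoeff x = 1) :
    seriesInv (lieExp t x) = lieExp t (seriesInv x) := by
  refine seriesInv_eq (constantCoeff_lieExp x) ?_
  rw [lieExp, lieExp, seriesLog_seriesInv hx, map_neg]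
  exact seriesExp_mul_neg (ordGE_one_lieOp t _)

/-- This follows from the resolvent identities `b(1-ab)⁻¹ = (1-ba)⁻¹b` and `(1-ab)⁻¹ = 1 +
a(1-ba)⁻¹b`. -/
theorem triple_identity {S : Type*} [Ring S] {a b n n' : S} (hn : n * (1 - b * a) = 1)
    (hn₂ : (1 - b * a) * n = 1) (hn' : (1 - a * b) * n' = 1) :
    (1 - a) * n * (1 - b) = (1 - b) * n' * (1 - a) := by
  have h1 : b * n' = n * b := by
    calc b * n' = n * (1 - b * a) * b * n' := by rw [hn, one_mul]
      _ = n * b * ((1 - a * b) * n') := by noncomm_ring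
      _ = n * b := by rw [hn', mul_one]
  have h2 : n' = 1 + a * n * b := by
    calc n' = (1 - a * b) * n' + a * (b * n') := by noncomm_ring
      _ = 1 + a * n * b := by rw [hn', h1]; noncomm_ring
  have h3 : n * b * a = n - 1 := by
    rw [← hn]; noncomm_ring
  have h4 : b * a * n = n - 1 := by
    rw [← hn₂]; noncomm_ring
  calc (1 - a) * n * (1 - b) = (n - 1) + 1 + a * n * b - a * n - n * b := by noncomm_ring
    _ = n' - n * b - (a + a * (n - 1)) + (n - 1) := by rw [h2]; noncomm_ring
    _ = n' - b * n' - n' * a + b * n' * a := by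
      rw [h1, h3, h2, add_mul, one_mul, mul_assoc (a * n), ← h3]; noncomm_ring
    _ = _ := by noncomm_ring

end DegreeOne

/-! ### The first relation implies the Lie relations -/

section LieSeries

variable {L B : Type*} [Ring L] [Algebra ℚ L] [Ring B] [Algebra ℚ B] {t : ℕ → L →ₗ[ℚ] B}

/-- The computation is that of `IsLieFamily.lieExp_mul` for three factors, with the error tracked.
Under the stated vanishing conditions an error arises only when the logarithmic derivative of `x *
n` is moved past the exponential of `y`. -/
theorem IsLieUpTo.euler_triple {σ : Type*} {P : Set (σ →₀ ℕ)}
    {κ : MvPowerSeries σ L → MvPowerSeries σ L → MvPowerSeries σ B} (H : IsLieUpTo P t κ)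
    {x n y : MvPowerSeries σ L} (hx : constantCoeff x = 1) (hn : constantCoeff n = 1)
    (hy : constantCoeff y = 1) (hκx : Cong P (κ (seriesLog x) (euler (seriesLog x))) 0)
    (hκy : Cong P (κ (seriesLog y) (euler (seriesLog y))) 0)
    (hκn : ∀ z, Cong P (κ (seriesLog n) z) 0) :
    Cong P (euler (lieExp t x * lieExp t n * lieExp t y))
      (lieExp t x * lieExp t n * lieExp t y *
        lieOp (scaled t) (seriesInv (x * n * y) * euler (x * n * y)) -
          κ (seriesLog y) (seriesInv (x * n) * euler (x * n))) := by
  have hP := H.lower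
  have hxn : constantCoeff (x * n) = 1 := by rw [map_mul, hx, hn, mul_one]
  have dX := H.euler_lieExp hx hκx
  have dN := H.euler_lieExp hn (hκn _)
  have dY := H.euler_lieExp hy hκy
  have cN := H.mul_lieExp (z := seriesInv x * euler x) hn ((ordGE_euler x).mul_left _)
  have cY := H.mul_lieExp (z := seriesInv (x * n) * euler (x * n)) hy
    ((ordGE_euler (x * n)).mul_left _)
  have dXN : Cong P (euler (lieExp t x * lieExp t n))
      (lieExp t x * lieExp t n * lieOp (scaled t) (seriesInv (x * n) * euler (x * n))) := by
    rw [euler_mul, logDeriv_mul hx hn, map_add, mul_add]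
    refine Cong.add ?_ ?_
    · refine (dX.mul hP (Cong.refl _)).trans ?_
      rw [mul_assoc, mul_assoc]
      refine (Cong.refl _).mul hP (cN.trans ?_)
      refine (Cong.refl _).mul hP ?_
      conv_rhs => rw [← sub_zero (lieOp (scaled t) _)]
      exact (Cong.refl _).sub (hκn _)
    · rw [mul_assoc]
      exact (Cong.refl _).mul hP dN
  set Z := lieExp t x * lieExp t n with hZ
  rw [euler_mul, logDeriv_mul hxn hy, map_add, mul_add, add_sub_right_comm]
  refine Cong.add ?_ ?_
  · refine (dXN.mul hP (Cong.refl _)).trans ?_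
    rw [mul_assoc]
    refine ((Cong.refl Z).mul hP cY).trans ?_
    rw [mul_sub, mul_sub, ← mul_assoc Z, ← mul_assoc Z]
    refine (Cong.refl _).sub ?_
    set k := κ (seriesLog y) (seriesInv (x * n) * euler (x * n)) with hk
    -- The factor in front of the error is one plus a series that annihilates the error, so it can
    -- be dropped.
    have h1 : OrdGE 1 (Z * lieExp t y - 1) := by
      rw [ordGE_one_iff, hZ, map_sub, map_mul, map_mul, constantCoeff_lieExp, constantCoeff_lieExp,
        constantCoeff_lieExp]
      simp
    have h2 := (H.ann_left (seriesLog y) (seriesInv (x * n) * euler (x * n)) _ h1).add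
      (Cong.refl k)
    rw [zero_add, ← hk, sub_mul, one_mul, sub_add_cancel] at h2
    exact h2
  · rw [mul_assoc Z]
    exact (Cong.refl _).mul hP dY

theorem defect_swap (i j : ℕ) (a b : L) : defect t t i j a b = -defect t t j i b a := by
  rw [defect, defect]
  by_cases h : i = j
  · subst h
    rw [if_pos rfl, if_pos rfl, map_sub, map_sub]; abel
  · rw [if_neg h, if_neg (Ne.symm h)]; abel

theorem defect_zero_left (t' : ℕ → L →ₗ[ℚ] B) (i j : ℕ) (b : L) : defect t t' i j 0 b = 0 := by
  simp [defect]

theorem defect_zero_right (t' : ℕ → L →ₗ[ℚ] B) (i j : ℕ) (a : L) : defect t t' i j a 0 = 0 := by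
  simp [defect]

/-- The monomial `u^l v^k` in two variables. -/
def bimonomial (l k : ℕ) : Fin 2 →₀ ℕ := Finsupp.single 0 l + Finsupp.single 1 k

theorem bimonomial_zero_apply (l k : ℕ) : bimonomial l k 0 = l := by simp [bimonomial]

theorem bimonomial_one_apply (l k : ℕ) : bimonomial l k 1 = k := by simp [bimonomial]

theorem degree_fin_two (m : Fin 2 →₀ ℕ) : m.degree = m 0 + m 1 := by
  simp [Finsupp.degree_eq_sum]

theorem eq_bimonomial (m : Fin 2 →₀ ℕ) : m = bimonomial (m 0) (m 1) := by
  ext i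
  fin_cases i
  · exact (bimonomial_zero_apply _ _).symm
  · exact (bimonomial_one_apply _ _).symm

theorem smul_bimonomial (i a b : ℕ) : i • bimonomial a b = bimonomial (i * a) (i * b) := by
  simp [bimonomial]

theorem bimonomial_inj {a b a' b' : ℕ} : bimonomial a b = bimonomial a' b' ↔ a = a' ∧ b = b' := by
  refine ⟨fun h => ⟨?_, ?_⟩, fun h => by rw [h.1, h.2]⟩
  · rw [← bimonomial_zero_apply a b, h, bimonomial_zero_apply]
  · rw [← bimonomial_one_apply a b, h, bimonomial_one_apply]

/-- The error term when the Lie relations are known for `i + j < l + k`. -/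
def topError (t : ℕ → L →ₗ[ℚ] B) (l k : ℕ) (f g : MvPowerSeries (Fin 2) L) :
    MvPowerSeries (Fin 2) B :=
  monomial (bimonomial l k)
    ((k : ℚ) • defect t t l k (coeff (bimonomial 1 0) f) (coeff (bimonomial 0 1) g) +
      (l : ℚ) • defect t t k l (coeff (bimonomial 0 1) f) (coeff (bimonomial 1 0) g))

/-- A nonzero term has `i + j ≥ l + k`, while `i · deg a + j · deg b ≤ l + k` since `m` divides `u^l
v^k`. Hence `a` and `b` are single variables and `m = u^l v^k`. Two terms remain, according to which
factor carries `u`. -/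
theorem sum_defect_top {l k : ℕ} (hl : l ≠ 0) (hk : k ≠ 0)
    (H : ∀ i j, i ≠ 0 → j ≠ 0 → i + j < l + k → ∀ a b, defect t t i j a b = 0)
    (f g : MvPowerSeries (Fin 2) L) {m : Fin 2 →₀ ℕ} (hm : m ≤ bimonomial l k) :
    ∑ x ∈ HasAntidiagonal.antidiagonal m, ∑ p ∈ divs x.1, ∑ q ∈ divs x.2,
        defect t (scaled t) p.1 q.1 (coeff p.2 f) (coeff q.2 g) =
      coeff m (topError t l k f g) := by
  simp_rw [← sum_product', defect_scaled]
  rw [sum_sigma']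
  have hdeg : (bimonomial l k).degree = l + k := by
    rw [degree_fin_two, bimonomial_zero_apply, bimonomial_one_apply]
  have key : ∀ z ∈ (HasAntidiagonal.antidiagonal m).sigma fun x => divs x.1 ×ˢ divs x.2,
      (z.2.2.1 : ℚ) • defect t t z.2.1.1 z.2.2.1 (coeff z.2.1.2 f) (coeff z.2.2.2 g) ≠ 0 →
      m = bimonomial l k ∧ (z = ⟨(bimonomial l 0, bimonomial 0 k), ((l, bimonomial 1 0), (k, bimonomial 0 1))⟩ ∨
        z = ⟨(bimonomial 0 k, bimonomial l 0), ((k, bimonomial 0 1), (l, bimonomial 1 0))⟩) := by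
    rintro ⟨⟨m1, m2⟩, ⟨⟨i, a⟩, ⟨j, b⟩⟩⟩ hz h0
    simp only [mem_sigma, HasAntidiagonal.mem_antidiagonal, mem_product] at hz
    obtain ⟨hm12, hp, hq⟩ := hz
    have hi := (mem_divs.1 hp).1
    have hj := (mem_divs.1 hq).1
    have d1 := degree_of_mem_divs hp
    have d2 := degree_of_mem_divs hq
    have e1 := degree_pos_of_mem_divs hp
    have e2 := degree_pos_of_mem_divs hq
    simp only at hi hj d1 d2 e1 e2 h0
    have hij : ¬ i + j < l + k := fun hlt => h0 (by rw [H i j hi hj hlt, smul_zero])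
    have hmd : m.degree ≤ l + k := hdeg ▸ Finsupp.degree_mono hm
    have hsum : m1.degree + m2.degree = m.degree := by rw [← hm12, map_add]
    have f1 : i * a.degree ≥ i := Nat.le_mul_of_pos_right _ e1
    have f2 : j * b.degree ≥ j := Nat.le_mul_of_pos_right _ e2
    have ha : a.degree = 1 := by
      have h : i * a.degree = i * 1 := by omega
      exact Nat.eq_of_mul_eq_mul_left (Nat.pos_of_ne_zero hi) h
    have hb : b.degree = 1 := by
      have h : j * b.degree = j * 1 := by omega
      exact Nat.eq_of_mul_eq_mul_left (Nat.pos_of_ne_zero hj) h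
    have hmeq : m = bimonomial l k := by
      have h0 := hm 0
      have h1 := hm 1
      rw [bimonomial_zero_apply] at h0
      rw [bimonomial_one_apply] at h1
      have h2 := degree_fin_two m
      rw [eq_bimonomial m, bimonomial_inj]
      omega
    refine ⟨hmeq, ?_⟩
    have h1 := (mem_divs.1 hp).2.2
    have h2 := (mem_divs.1 hq).2.2
    simp only at h1 h2
    rw [hmeq, ← h1, ← h2, eq_bimonomial a, eq_bimonomial b, smul_bimonomial, smul_bimonomial] at hm12
    have h3 : bimonomial (i * a 0) (i * a 1) + bimonomial (j * b 0) (j * b 1) =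
        bimonomial (i * a 0 + j * b 0) (i * a 1 + j * b 1) := by
      simp only [bimonomial, Finsupp.single_add]; abel
    rw [h3, bimonomial_inj] at hm12
    rw [degree_fin_two] at ha hb
    -- If both factors carried the same variable, the other variable would be missing from `u^l
    -- v^k`, contrary to `l, k ≠ 0`.
    rcases (show a 0 = 1 ∧ a 1 = 0 ∨ a 0 = 0 ∧ a 1 = 1 by omega) with ⟨a0, a1⟩ | ⟨a0, a1⟩ <;>
    rcases (show b 0 = 1 ∧ b 1 = 0 ∨ b 0 = 0 ∧ b 1 = 1 by omega) with ⟨b0, b1⟩ | ⟨b0, b1⟩ <;>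
    simp only [a0, a1, b0, b1, mul_one, mul_zero, add_zero, zero_add] at hm12
    · exact absurd hm12.2.symm hk
    · left
      obtain ⟨rfl, rfl⟩ := hm12
      rw [← h1, ← h2, eq_bimonomial a, eq_bimonomial b, a0, a1, b0, b1, smul_bimonomial,
        smul_bimonomial]
      simp
    · right
      obtain ⟨rfl, rfl⟩ := hm12
      rw [← h1, ← h2, eq_bimonomial a, eq_bimonomial b, a0, a1, b0, b1, smul_bimonomial,
        smul_bimonomial]
      simp
    · exact absurd hm12.1.symm hl
  by_cases hmt : m = bimonomial l k
  · have hb : ∀ a b : ℕ, a ≠ 0 ∨ b ≠ 0 → bimonomial a b ≠ 0 := by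
      intro a b hab h
      have : bimonomial a b = bimonomial 0 0 := by rw [h]; simp [bimonomial]
      rw [bimonomial_inj] at this
      omega
    rw [Finset.sum_eq_add ⟨(bimonomial l 0, bimonomial 0 k), ((l, bimonomial 1 0), (k, bimonomial 0 1))⟩
      ⟨(bimonomial 0 k, bimonomial l 0), ((k, bimonomial 0 1), (l, bimonomial 1 0))⟩]
    · rw [hmt, topError, coeff_monomial_same]
    · intro h
      have := congrArg (fun z => z.1.1) h
      simp only [bimonomial_inj] at this
      exact hl this.1
    · rintro z hz ⟨h1, h2⟩
      by_contra h0
      rcases (key z hz h0).2 with h | h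
      · exact h1 h
      · exact h2 h
    · intro h
      refine absurd ?_ h
      simp only [mem_sigma, HasAntidiagonal.mem_antidiagonal, mem_product, mem_divs, smul_bimonomial]
      refine ⟨by rw [hmt]; simp [bimonomial], ⟨hl, hb _ _ (by simp), by simp⟩,
        hk, hb _ _ (by simp), by simp⟩
    · intro h
      refine absurd ?_ h
      simp only [mem_sigma, HasAntidiagonal.mem_antidiagonal, mem_product, mem_divs, smul_bimonomial]
      refine ⟨by rw [hmt]; simp [bimonomial, add_comm], ⟨hk, hb _ _ (by simp), by simp⟩,
        hl, hb _ _ (by simp), by simp⟩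
  · rw [topError, coeff_monomial_ne hmt]
    refine Finset.sum_eq_zero fun z hz => ?_
    by_contra h0
    exact hmt (key z hz h0).1

/-- The error sits at the largest monomial of the lower set, so multiplying it by a series without
constant term moves it outside. -/
theorem isLieUpTo_topError {l k : ℕ} (hl : l ≠ 0) (hk : k ≠ 0)
    (H : ∀ i j, i ≠ 0 → j ≠ 0 → i + j < l + k → ∀ a b, defect t t i j a b = 0) :
    IsLieUpTo (Set.Iic (bimonomial l k)) t (topError t l k) where
  lower := isLowerSet_Iic _
  bracket f g hf hg m hm := by
    have h := coeff_bracket_lieOp t (scaled t) hf hg m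
    rw [sum_defect_top hl hk H f g hm, map_sub, sub_eq_iff_eq_add'] at h
    rw [h, map_add]
  ord f g := ordGE_monomial (by
    rw [degree_fin_two, bimonomial_zero_apply, bimonomial_one_apply]; omega) _
  ann_left f g h hh m hm := by
    classical
    rw [topError, coeff_mul_monomial, map_zero]
    split_ifs with h1
    · rw [tsub_eq_zero_of_le hm, hh 0 (by simp), zero_mul]
    · rfl
  ann_right f g h hh m hm := by
    classical
    rw [topError, coeff_monomial_mul, map_zero]
    split_ifs with h1
    · rw [tsub_eq_zero_of_le hm, hh 0 (by simp), mul_zero]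
    · rfl
  high f g _ hg m _ := by
    rw [topError, hg (bimonomial 0 1) (by simp [bimonomial]),
      hg (bimonomial 1 0) (by simp [bimonomial]), defect_zero_right,
      defect_zero_right, smul_zero, smul_zero, add_zero, map_zero]

/-- The first family of relations implies the Lie relations. -/
theorem defect_eq_zero_of_triple {l k : ℕ} (hl : l ≠ 0) (hk : k ≠ 0)
    (H : ∀ i j, i ≠ 0 → j ≠ 0 → i + j < l + k → ∀ a b, defect t t i j a b = 0) (U V : L)
    (h : lieExp t (1 - monomial (bimonomial 1 0) U) *
          seriesInv (lieExp t (1 - monomial (bimonomial 1 1) (V * U))) *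
          lieExp t (1 - monomial (bimonomial 0 1) V) =
        lieExp t (1 - monomial (bimonomial 0 1) V) *
          seriesInv (lieExp t (1 - monomial (bimonomial 1 1) (U * V))) *
          lieExp t (1 - monomial (bimonomial 1 0) U)) :
    defect t t l k U V = 0 := by
  have HL := isLieUpTo_topError (t := t) hl hk H
  have hb : ∀ a b : ℕ, a ≠ 0 ∨ b ≠ 0 → bimonomial a b ≠ 0 := by
    intro a b hab h
    have : bimonomial a b = bimonomial 0 0 := by rw [h]; simp [bimonomial]
    rw [bimonomial_inj] at this
    omega
  have hd10 : (bimonomial 1 0).degree = 1 := by simp [bimonomial]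
  have hd01 : (bimonomial 0 1).degree = 1 := by simp [bimonomial]
  have hd11 : (bimonomial 1 1).degree = 2 := by simp [degree_fin_two, bimonomial]
  have h10 : bimonomial 1 0 ≠ bimonomial 0 1 := by simp [bimonomial_inj]
  set a : MvPowerSeries (Fin 2) L := monomial (bimonomial 1 0) U with ha
  set b : MvPowerSeries (Fin 2) L := monomial (bimonomial 0 1) V with hbd
  have hba : monomial (bimonomial 1 1) (V * U) = b * a := by
    rw [ha, hbd, monomial_mul_monomial]; congr 1; simp [bimonomial, add_comm]
  have hab : monomial (bimonomial 1 1) (U * V) = a * b := by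
    rw [ha, hbd, monomial_mul_monomial]; congr 1; simp [bimonomial]
  have cx : constantCoeff (1 - a) = 1 := constantCoeff_one_sub_monomial (hb _ _ (by simp)) U
  have cy : constantCoeff (1 - b) = 1 := constantCoeff_one_sub_monomial (hb _ _ (by simp)) V
  have cm : constantCoeff (1 - b * a) = 1 := by
    rw [← hba]; exact constantCoeff_one_sub_monomial (hb _ _ (by simp)) _
  have cm' : constantCoeff (1 - a * b) = 1 := by
    rw [← hab]; exact constantCoeff_one_sub_monomial (hb _ _ (by simp)) _
  rw [hba, hab, seriesInv_lieExp t cm, seriesInv_lieExp t cm'] at h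
  set n := seriesInv (1 - b * a) with hn
  set n' := seriesInv (1 - a * b) with hn'
  have cn : constantCoeff n = 1 := constantCoeff_seriesInv _
  have cn' : constantCoeff n' = 1 := constantCoeff_seriesInv _
  -- The arguments of the exponentials have the same product on both sides, so the main terms of the
  -- two logarithmic derivatives will agree.
  have hid : (1 - a) * n * (1 - b) = (1 - b) * n' * (1 - a) :=
    triple_identity (seriesInv_mul cm) (mul_seriesInv cm) (mul_seriesInv cm')
  have zl : ∀ (W : L) (d : Fin 2 →₀ ℕ), coeff d (1 - monomial d W - 1 : MvPowerSeries (Fin 2) L) = -W := by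
    intro W d
    rw [sub_sub_cancel_left, map_neg, coeff_monomial_same]
  have zl' : ∀ (W : L) (d e : Fin 2 →₀ ℕ), e ≠ d →
      coeff e (1 - monomial d W - 1 : MvPowerSeries (Fin 2) L) = 0 := by
    intro W d e hde
    rw [sub_sub_cancel_left, map_neg, coeff_monomial_ne hde, neg_zero]
  have lx0 : coeff (bimonomial 1 0) (seriesLog (1 - a)) = -U := by
    rw [coeff_seriesLog_of_degree_one hd10, zl]
  have lx1 : coeff (bimonomial 0 1) (seriesLog (1 - a)) = 0 := by
    rw [coeff_seriesLog_of_degree_one hd01, zl' _ _ _ h10.symm]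
  have ly1 : coeff (bimonomial 0 1) (seriesLog (1 - b)) = -V := by
    rw [coeff_seriesLog_of_degree_one hd01, zl]
  have ly0 : coeff (bimonomial 1 0) (seriesLog (1 - b)) = 0 := by
    rw [coeff_seriesLog_of_degree_one hd10, zl' _ _ _ h10]
  -- The linear part of `log(1 - a)` involves `u` only, whereas each defect in the error term pairs
  -- a `u`-coefficient with a `v`-coefficient.
  have hκx : topError t l k (seriesLog (1 - a)) (euler (seriesLog (1 - a))) = 0 := by
    rw [topError, coeff_euler, coeff_euler, lx1, smul_zero, defect_zero_right, defect_zero_left,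
      smul_zero, smul_zero, add_zero, map_zero]
  have hκy : topError t l k (seriesLog (1 - b)) (euler (seriesLog (1 - b))) = 0 := by
    rw [topError, coeff_euler, coeff_euler, ly0, smul_zero, defect_zero_right, defect_zero_left,
      smul_zero, smul_zero, add_zero, map_zero]
  have linN : ∀ (W : L) (c : Fin 2 →₀ ℕ), c.degree = 1 →
      coeff c (seriesInv (1 - monomial (bimonomial 1 1) W)) = 0 := by
    intro W c hc
    have c1 : constantCoeff (1 - monomial (bimonomial 1 1) W) = 1 :=
      constantCoeff_one_sub_monomial (hb _ _ (by simp)) W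
    have h1 := congrArg (coeff c) (mul_seriesInv c1)
    rw [coeff_mul_of_degree_one hc, c1, one_mul, constantCoeff_seriesInv, mul_one, map_sub,
      coeff_monomial_ne (by rintro rfl; omega), sub_zero] at h1
    have hc0 : c ≠ 0 := by rintro rfl; simp at hc
    classical
    rw [coeff_one, if_neg hc0, zero_add] at h1
    exact h1
  -- The middle factor is a series in `uv`, so it has no terms of degree one and produces no error.
  have hκn : ∀ (W : L) z, topError t l k
      (seriesLog (seriesInv (1 - monomial (bimonomial 1 1) W))) z = 0 := by
    intro W z
    classical
    rw [topError, coeff_seriesLog_of_degree_one hd10, coeff_seriesLog_of_degree_one hd01, map_sub,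
      map_sub, linN W _ hd10, linN W _ hd01, coeff_one, coeff_one, if_neg (hb _ _ (by simp)),
      if_neg (hb _ _ (by simp)), sub_zero, defect_zero_left, defect_zero_left,
      smul_zero, smul_zero, add_zero, map_zero]
  have e1 := HL.euler_triple cx cn cy (hκx ▸ Cong.refl _) (hκy ▸ Cong.refl _)
    (fun z => by rw [hn, ← hba, hκn]; exact Cong.refl _)
  have e2 := HL.euler_triple cy cn' cx (hκy ▸ Cong.refl _) (hκx ▸ Cong.refl _)
    (fun z => by rw [hn', ← hab, hκn]; exact Cong.refl _)
  -- By the assumed relation and the ring identity, the two differential equations differ in their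
  -- error terms only; these must therefore coincide at `u^l v^k`.
  rw [← h, ← hid] at e2
  have e3 := (e1.symm.trans e2) (bimonomial l k) (Set.mem_Iic.2 le_rfl)
  rw [map_sub, map_sub, sub_right_inj, topError, topError, coeff_monomial_same, coeff_monomial_same,
    lx0, lx1, ly0, ly1, defect_zero_left, defect_zero_left, smul_zero, smul_zero, zero_add,
    add_zero, coeff_mul_of_degree_one hd10, coeff_mul_of_degree_one hd01, constantCoeff_seriesInv,
    constantCoeff_seriesInv, ordGE_one_iff.1 (ordGE_euler _), ordGE_one_iff.1 (ordGE_euler _),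
    mul_zero, mul_zero, zero_add, zero_add, one_mul, one_mul, coeff_euler, coeff_euler, hd10, hd01,
    one_smul, one_smul, coeff_mul_of_degree_one hd10, coeff_mul_of_degree_one hd01, cn, cn', cx, cy,
    one_mul, one_mul, mul_one, mul_one] at e3
  have n10 : coeff (bimonomial 1 0) n = 0 := by rw [hn, ← hba]; exact linN _ _ hd10
  have n01 : coeff (bimonomial 0 1) n' = 0 := by rw [hn', ← hab]; exact linN _ _ hd01
  classical
  rw [n10, n01, add_zero, add_zero, map_sub, map_sub, coeff_one, coeff_one, if_neg (hb _ _ (by simp)),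
    if_neg (hb _ _ (by simp)), ha, hbd, coeff_monomial_same, coeff_monomial_same, zero_sub, zero_sub,
    defect_swap k l, smul_neg] at e3
  -- The defect occurs with the factor `k` in one error and, by antisymmetry, with the factor `-l`
  -- in the other.
  have e4 : ((k : ℚ) + l) • defect t t l k (-U) (-V) = 0 := by
    rw [add_smul, ← e3]; abel
  have e5 : defect t t l k (-U) (-V) = 0 := by
    refine (smul_eq_zero.1 e4).resolve_left ?_
    positivity
  rw [← e5]
  simp [defect]

end LieSeries

/-! ### Families `ℰ_W(-t) = exp(T(log(1 - tW)))` and the first relation -/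

section Families

variable {B : Type*} [Ring B]

/-- The series `f(-t)`. -/
def flip (f : PowerSeries B) : MvPowerSeries Unit B := substMonomial f (-1) (Finsupp.single () 1)

theorem single_one_ne_zero : (Finsupp.single () 1 : Unit →₀ ℕ) ≠ 0 := by simp

theorem coeff_flip (f : PowerSeries B) (n : Unit →₀ ℕ) :
    coeff n (flip f) = (-1 : ℤ) ^ n () • coeff n (f : MvPowerSeries Unit B) := by
  rw [flip, MonomialSubst.substMonomial_eq _ _ _ single_one_ne_zero, MonomialSubst.coeff_subst,
    Finset.sum_eq_single n]
  · rfl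
  · intro m hm hmn
    rw [MonomialSubst.mem_fiber, MonomialSubst.ofMonomial_exponent] at hm
    refine absurd ?_ hmn
    rw [← hm]; ext; simp
  · intro hn
    refine absurd ?_ hn
    rw [MonomialSubst.mem_fiber, MonomialSubst.ofMonomial_exponent]
    ext; simp

theorem flip_injective : Function.Injective (flip : PowerSeries B → MvPowerSeries Unit B) := by
  intro f g h
  refine MvPowerSeries.ext fun n => ?_
  have := congrArg (coeff n) h
  rw [coeff_flip, coeff_flip] at this
  have h2 := congrArg (fun z => (-1 : ℤ) ^ n () • z) this
  have h3 : (-1 : ℤ) ^ n () * (-1) ^ n () = 1 := by rw [← mul_pow]; simp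
  simpa only [smul_smul, h3, one_smul] using h2

theorem constantCoeff_flip (f : PowerSeries B) :
    constantCoeff (flip f) = PowerSeries.constantCoeff f := by
  rw [flip, MonomialSubst.substMonomial_eq _ _ _ single_one_ne_zero]
  exact MonomialSubst.constantCoeff_subst _ _

/-- The sign is absorbed into `flip`; the remaining substitution has weight one and thus commutes
with `lieOp`. -/
theorem substMonomial_neg_one {τ : Type*} (f : PowerSeries B) {d : τ →₀ ℕ} (hd : d ≠ 0) :
    substMonomial f (-1) d = (MonomialSubst.ofMonomial 1 d hd).subst (flip f) := by
  rw [MonomialSubst.substMonomial_eq _ _ _ hd]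
  ext n
  rw [MonomialSubst.coeff_subst, MonomialSubst.coeff_subst]
  refine Finset.sum_congr rfl fun m _ => ?_
  rw [coeff_flip]
  simp [MonomialSubst.ofMonomial]

theorem subst_ofMonomial_monomial {τ : Type*} {d : τ →₀ ℕ} (hd : d ≠ 0) (a : B) :
    (MonomialSubst.ofMonomial 1 d hd).subst (monomial (Finsupp.single () 1) a) = monomial d a := by
  classical
  ext n
  rw [MonomialSubst.coeff_subst]
  simp only [coeff_monomial, MonomialSubst.ofMonomial, one_pow, one_smul]
  rw [Finset.sum_ite_eq']
  congr 1
  rw [MonomialSubst.mem_fiber]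
  simp [eq_comm]

/-- The sign change of all variables. -/
def signSubst (σ : Type*) : MonomialSubst σ σ where
  exponent := AddMonoidHom.id _
  weight m := (-1) ^ m.degree
  weight_zero := by simp
  weight_add m n := by rw [map_add, pow_add]
  degree_le m := le_rfl
  finite n := by simp

theorem coeff_signSubst {σ : Type*} (f : MvPowerSeries σ B) (n : σ →₀ ℕ) :
    coeff n ((signSubst σ).subst f) = (-1 : ℤ) ^ n.degree • coeff n f := by
  rw [MonomialSubst.coeff_subst, Finset.sum_eq_single n]
  · rfl
  · intro m hm hmn
    exact absurd ((signSubst σ).mem_fiber.1 hm) hmn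
  · intro hn
    exact absurd ((signSubst σ).mem_fiber.2 rfl) hn

theorem signSubst_injective {σ : Type*} :
    Function.Injective ((signSubst σ).subst : MvPowerSeries σ B → MvPowerSeries σ B) := by
  intro f g h
  ext n
  have := congrArg (coeff n) h
  rw [coeff_signSubst, coeff_signSubst] at this
  have h2 := congrArg (fun z => (-1 : ℤ) ^ n.degree • z) this
  have h3 : (-1 : ℤ) ^ n.degree * (-1) ^ n.degree = 1 := by rw [← mul_pow]; simp
  simpa only [smul_smul, h3, one_smul] using h2

theorem signSubst_substMonomial {τ : Type*} (f : PowerSeries B) (c : ℤ) {d : τ →₀ ℕ} (hd : d ≠ 0) :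
    (signSubst τ).subst (substMonomial f c d) = substMonomial f (c * (-1) ^ d.degree) d := by
  rw [MonomialSubst.substMonomial_eq _ _ _ hd, MonomialSubst.substMonomial_eq _ _ _ hd]
  ext n
  rw [coeff_signSubst, MonomialSubst.coeff_subst, MonomialSubst.coeff_subst, smul_sum]
  refine Finset.sum_congr rfl fun m hm => ?_
  have h : n.degree = m () * d.degree := by
    rw [← (MonomialSubst.mem_fiber _).1 hm]; exact map_nsmul Finsupp.degree _ _
  rw [smul_smul, h]
  congr 1
  change _ * c ^ m () = (c * (-1) ^ d.degree) ^ m ()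
  rw [mul_pow, ← pow_mul, mul_comm, mul_comm d.degree]

theorem constantCoeff_substMonomial {τ : Type*} (f : PowerSeries B) (c : ℤ) {d : τ →₀ ℕ}
    (hd : d ≠ 0) : constantCoeff (substMonomial f c d) = PowerSeries.constantCoeff f := by
  rw [MonomialSubst.substMonomial_eq _ _ _ hd]
  exact MonomialSubst.constantCoeff_subst _ _

/-- The change `u ↦ -u`, `v ↦ -v` leaves `uv` alone, so afterwards all three series are evaluated at
minus a monomial, which is the form provided by `IsLieExpFamily`. -/
theorem signSubst_tripleSeries {F G H : PowerSeries B} (hG : PowerSeries.constantCoeff G = 1) :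
    (signSubst (Fin 2)).subst (tripleSeries F G H) =
      substMonomial F (-1) (bimonomial 1 0) * seriesInv (substMonomial G (-1) (bimonomial 1 1)) *
        substMonomial H (-1) (bimonomial 0 1) := by
  have h0 : (Finsupp.single 0 1 : Fin 2 →₀ ℕ) ≠ 0 := by simp
  have h1 : (Finsupp.single 1 1 : Fin 2 →₀ ℕ) ≠ 0 := by simp
  have h2 : (Finsupp.single 0 1 + Finsupp.single 1 1 : Fin 2 →₀ ℕ) ≠ 0 := by
    intro h; exact h0 (add_eq_zero.1 h).1
  rw [tripleSeries, map_mul, map_mul, MonomialSubst.subst_seriesInv _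
    ((constantCoeff_substMonomial G (-1) h2).trans hG), signSubst_substMonomial _ _ h0,
    signSubst_substMonomial _ _ h1, signSubst_substMonomial _ _ h2]
  simp [bimonomial]

theorem signSubst_tripleSeriesRev {F G H : PowerSeries B} (hG : PowerSeries.constantCoeff G = 1) :
    (signSubst (Fin 2)).subst (tripleSeriesRev F G H) =
      substMonomial H (-1) (bimonomial 0 1) * seriesInv (substMonomial G (-1) (bimonomial 1 1)) *
        substMonomial F (-1) (bimonomial 1 0) := by
  have h0 : (Finsupp.single 0 1 : Fin 2 →₀ ℕ) ≠ 0 := by simp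
  have h1 : (Finsupp.single 1 1 : Fin 2 →₀ ℕ) ≠ 0 := by simp
  have h2 : (Finsupp.single 0 1 + Finsupp.single 1 1 : Fin 2 →₀ ℕ) ≠ 0 := by
    intro h; exact h0 (add_eq_zero.1 h).1
  rw [tripleSeriesRev, map_mul, map_mul, MonomialSubst.subst_seriesInv _
    ((constantCoeff_substMonomial G (-1) h2).trans hG), signSubst_substMonomial _ _ h0,
    signSubst_substMonomial _ _ h1, signSubst_substMonomial _ _ h2]
  simp [bimonomial]

variable [Algebra ℚ B] {R : Type*} [Ring R]

/-- A family of series with `𝓔_W(-t) = exp(T(log(1 - t W)))` for all `W ∈ R`. -/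
def IsLieExpFamily (t : ℕ → RatExt R →ₗ[ℚ] B) (𝓔 : R → PowerSeries B) : Prop :=
  ∀ W, flip (𝓔 W) = lieExp t (1 - monomial (Finsupp.single () 1) (toRatExt R W))

variable {t : ℕ → RatExt R →ₗ[ℚ] B} {𝓔 : R → PowerSeries B}

theorem IsLieExpFamily.constantCoeff_eq (H : IsLieExpFamily t 𝓔) (W : R) :
    PowerSeries.constantCoeff (𝓔 W) = 1 := by
  rw [← constantCoeff_flip, H W, constantCoeff_lieExp]

theorem IsLieExpFamily.substMonomial_eq (H : IsLieExpFamily t 𝓔) (W : R) {τ : Type*} {d : τ →₀ ℕ}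
    (hd : d ≠ 0) : substMonomial (𝓔 W) (-1) d = lieExp t (1 - monomial d (toRatExt R W)) := by
  rw [substMonomial_neg_one _ hd, H W, subst_lieExp _ (fun i _ m => by simp [MonomialSubst.ofMonomial])
    (constantCoeff_one_sub_monomial single_one_ne_zero _), map_sub, map_one,
    subst_ofMonomial_monomial]

theorem bimonomial_ne_zero {a b : ℕ} (hab : a ≠ 0 ∨ b ≠ 0) : bimonomial a b ≠ 0 := by
  intro h
  have : bimonomial a b = bimonomial 0 0 := by rw [h]; simp [bimonomial]
  rw [bimonomial_inj] at this
  omega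

theorem IsLieExpFamily.triple_iff (H : IsLieExpFamily t 𝓔) (U V : R) :
    tripleSeries (𝓔 U) (𝓔 (V * U)) (𝓔 V) = tripleSeriesRev (𝓔 U) (𝓔 (U * V)) (𝓔 V) ↔
    lieExp t (1 - monomial (bimonomial 1 0) (toRatExt R U)) *
          seriesInv (lieExp t (1 - monomial (bimonomial 1 1) (toRatExt R V * toRatExt R U))) *
          lieExp t (1 - monomial (bimonomial 0 1) (toRatExt R V)) =
        lieExp t (1 - monomial (bimonomial 0 1) (toRatExt R V)) *
          seriesInv (lieExp t (1 - monomial (bimonomial 1 1) (toRatExt R U * toRatExt R V))) *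
          lieExp t (1 - monomial (bimonomial 1 0) (toRatExt R U)) := by
  rw [← signSubst_injective.eq_iff, signSubst_tripleSeries (H.constantCoeff_eq _),
    signSubst_tripleSeriesRev (H.constantCoeff_eq _), H.substMonomial_eq U (bimonomial_ne_zero (by simp)),
    H.substMonomial_eq V (bimonomial_ne_zero (by simp)),
    H.substMonomial_eq (V * U) (bimonomial_ne_zero (by simp)),
    H.substMonomial_eq (U * V) (bimonomial_ne_zero (by simp)), map_mul (toRatExt R), map_mul (toRatExt R)]

/-- By multiplicativity both sides are exponentials of single products, which agree by
`triple_identity`. -/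
theorem IsLieExpFamily.triple (H : IsLieExpFamily t 𝓔) (Ht : IsLieFamily t) (U V : R) :
    tripleSeries (𝓔 U) (𝓔 (V * U)) (𝓔 V) = tripleSeriesRev (𝓔 U) (𝓔 (U * V)) (𝓔 V) := by
  rw [H.triple_iff]
  set a : MvPowerSeries (Fin 2) (RatExt R) := monomial (bimonomial 1 0) (toRatExt R U) with ha
  set b : MvPowerSeries (Fin 2) (RatExt R) := monomial (bimonomial 0 1) (toRatExt R V) with hb
  have hba : monomial (bimonomial 1 1) (toRatExt R V * toRatExt R U) = b * a := by
    rw [ha, hb, monomial_mul_monomial]; congr 1; simp [bimonomial, add_comm]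
  have hab : monomial (bimonomial 1 1) (toRatExt R U * toRatExt R V) = a * b := by
    rw [ha, hb, monomial_mul_monomial]; congr 1; simp [bimonomial]
  have cx : constantCoeff (1 - a) = 1 :=
    constantCoeff_one_sub_monomial (bimonomial_ne_zero (by simp)) _
  have cy : constantCoeff (1 - b) = 1 :=
    constantCoeff_one_sub_monomial (bimonomial_ne_zero (by simp)) _
  have cm : constantCoeff (1 - b * a) = 1 := by
    rw [← hba]; exact constantCoeff_one_sub_monomial (bimonomial_ne_zero (by simp)) _
  have cm' : constantCoeff (1 - a * b) = 1 := by
    rw [← hab]; exact constantCoeff_one_sub_monomial (bimonomial_ne_zero (by simp)) _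
  have cn := constantCoeff_seriesInv (1 - b * a)
  have cn' := constantCoeff_seriesInv (1 - a * b)
  rw [hba, hab, seriesInv_lieExp t cm, seriesInv_lieExp t cm', ← Ht.lieExp_mul cx cn,
    ← Ht.lieExp_mul cy cn', ← Ht.lieExp_mul (by rw [map_mul, cx, cn, mul_one]) cy,
    ← Ht.lieExp_mul (by rw [map_mul, cy, cn', mul_one]) cx,
    triple_identity (seriesInv_mul cm) (mul_seriesInv cm) (mul_seriesInv cm')]

end Families


/-! ### Power substitutions `x ↦ x^k` -/

section PowerSubstitution

variable {σ : Type*} {A : Type*} [Ring A]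

/-- The substitution `x ↦ x^k` in all variables. -/
def powSubst (σ : Type*) (k : ℕ) (hk : k ≠ 0) : MonomialSubst σ σ where
  exponent := nsmulAddMonoidHom k
  weight _ := 1
  weight_zero := rfl
  weight_add _ _ := rfl
  degree_le m := by
    rw [nsmulAddMonoidHom_apply, map_nsmul]
    exact Nat.le_mul_of_pos_left _ (Nat.pos_of_ne_zero hk)
  finite n := by
    refine Set.Subsingleton.finite fun m hm m' hm' => ?_
    exact smul_right_injective _ hk ((hm : k • m = n).trans (hm' : k • m' = n).symm)

theorem mem_fiber_powSubst {k : ℕ} (hk : k ≠ 0) {n m : σ →₀ ℕ} :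
    m ∈ (powSubst σ k hk).fiber n ↔ k • m = n := (powSubst σ k hk).mem_fiber

theorem coeff_powSubst_smul {k : ℕ} (hk : k ≠ 0) (f : MvPowerSeries σ A) (m : σ →₀ ℕ) :
    coeff (k • m) ((powSubst σ k hk).subst f) = coeff m f := by
  rw [MonomialSubst.coeff_subst, Finset.sum_eq_single m]
  · exact one_smul _ _
  · intro m' hm' hne
    exact absurd (smul_right_injective _ hk ((mem_fiber_powSubst hk).1 hm')) hne
  · intro h
    exact absurd ((mem_fiber_powSubst hk).2 rfl) h

theorem coeff_powSubst_of_forall_ne {k : ℕ} (hk : k ≠ 0) (f : MvPowerSeries σ A) {n : σ →₀ ℕ}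
    (h : ∀ m, k • m ≠ n) : coeff n ((powSubst σ k hk).subst f) = 0 := by
  rw [MonomialSubst.coeff_subst]
  exact Finset.sum_eq_zero fun m hm => absurd ((mem_fiber_powSubst hk).1 hm) (h m)

theorem ordGE_powSubst {k : ℕ} (hk : k ≠ 0) {f : MvPowerSeries σ A} (hf : OrdGE 1 f) :
    OrdGE k ((powSubst σ k hk).subst f) := fun n hn => by
  rw [MonomialSubst.coeff_subst]
  refine Finset.sum_eq_zero fun m hm => ?_
  have h1 := (mem_fiber_powSubst hk).1 hm
  have h2 : n.degree = k * m.degree := by rw [← h1]; exact map_nsmul Finsupp.degree _ _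
  have h3 : m.degree < 1 := by
    by_contra h
    have := Nat.le_mul_of_pos_right k (show 0 < m.degree by omega)
    omega
  rw [hf m h3, smul_zero]

theorem commute_of_coeff {f g : MvPowerSeries σ A}
    (h : ∀ m n, Commute (coeff m f) (coeff n g)) : Commute f g := by
  classical
  rw [Commute, SemiconjBy, ← sub_eq_zero]
  refine MvPowerSeries.ext fun m => ?_
  rw [coeff_commutator]
  exact Finset.sum_eq_zero fun p _ => sub_eq_zero.2 (h _ _)

variable {B : Type*} [Ring B] [Algebra ℚ A] [Algebra ℚ B]

/-- A linear map applied to the coefficients of a series. -/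
def mapLin (u : A →ₗ[ℚ] B) (f : MvPowerSeries σ A) : MvPowerSeries σ B :=
  ofCoeff fun m => u (coeff m f)

theorem coeff_mapLin (u : A →ₗ[ℚ] B) (f : MvPowerSeries σ A) (m : σ →₀ ℕ) :
    coeff m (mapLin u f) = u (coeff m f) := rfl

theorem OrdGE.mapLin {k : ℕ} {f : MvPowerSeries σ A} (hf : OrdGE k f) (u : A →ₗ[ℚ] B) :
    OrdGE k (mapLin u f) := fun m hm => by rw [coeff_mapLin, hf m hm, map_zero]

/-- Grouping the terms of the operator by the index `k` of `t_k` gives the form in which logarithms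
of infinite products appear. -/
theorem lieOp_eq_isum (t : ℕ → A →ₗ[ℚ] B) {f : MvPowerSeries σ A} (hf : OrdGE 1 f) :
    lieOp t f = isum fun k => if h : 0 < k then mapLin (t k) ((powSubst σ k h.ne').subst f) else 0 := by
  ext n
  simp only [isum, coeff_ofCoeff]
  have h1 : ∀ k ∈ range (n.degree + 1), coeff n (if h : 0 < k then
      mapLin (t k) ((powSubst σ k h.ne').subst f) else 0 : MvPowerSeries σ B) =
      ∑ p ∈ (divs n).filter (fun p => p.1 = k), t p.1 (coeff p.2 f) := by
    intro k _
    by_cases h : 0 < k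
    · rw [dif_pos h, coeff_mapLin]
      by_cases h2 : ∃ m, k • m = n ∧ m ≠ 0
      · obtain ⟨m, rfl, hm⟩ := h2
        rw [coeff_powSubst_smul, Finset.sum_eq_single (k, m)]
        · rintro ⟨i, m'⟩ hp hne
          rw [Finset.mem_filter, mem_divs] at hp
          obtain ⟨⟨h3, h4, h5⟩, rfl⟩ := hp
          have h6 : m' = m := smul_right_injective _ h3 h5
          exact absurd (by rw [h6]) hne
        · intro hp
          refine absurd ?_ hp
          rw [Finset.mem_filter, mem_divs]
          exact ⟨⟨h.ne', hm, rfl⟩, rfl⟩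
      · push Not at h2
        rw [Finset.sum_eq_zero]
        · by_cases h3 : n = 0
          · rw [h3, coeff_zero_eq_constantCoeff_apply, MonomialSubst.constantCoeff_subst,
              ordGE_one_iff.1 hf, map_zero]
          · rw [coeff_powSubst_of_forall_ne h.ne', map_zero]
            intro m hm
            have := h2 m hm
            rw [this, smul_zero] at hm
            exact h3 hm.symm
        · rintro ⟨i, m'⟩ hp
          rw [Finset.mem_filter, mem_divs] at hp
          obtain ⟨⟨h3, h4, h5⟩, rfl⟩ := hp
          exact absurd (h2 m' h5) h4
    · rw [dif_neg h, Finset.sum_eq_zero, map_zero]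
      rintro ⟨i, m'⟩ hp
      rw [Finset.mem_filter, mem_divs] at hp
      obtain ⟨⟨h3, h4, h5⟩, rfl⟩ := hp
      simp only at h h3
      omega
  rw [Finset.sum_congr rfl h1, coeff_lieOp]
  symm
  refine Finset.sum_fiberwise_of_maps_to (fun p hp => ?_) _
  rw [mem_range, degree_of_mem_divs hp]
  exact Nat.lt_succ_of_le (Nat.le_mul_of_pos_right _ (degree_pos_of_mem_divs hp))

end PowerSubstitution

/-! ### The series `E_U` and the generating function as exponentials -/

section Generators

variable (R : Type*) [Ring R]

/-- The maps `T_l`, indexed by natural numbers. -/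
def tau : ℕ → RatExt R →ₗ[ℚ] GQ R := fun l => T R l.toPNat'

section

attribute [local instance] LieRing.ofAssociativeRing LieAlgebra.ofAssociativeAlgebra

theorem toEnv_bracket {A : Type*} [Ring A] [Algebra ℚ A] (a b : A) :
    toEnv A (a * b - b * a) = toEnv A a * toEnv A b - toEnv A b * toEnv A a := by
  have h := LieHom.map_lie (UniversalEnvelopingAlgebra.ι ℚ : A →ₗ⁅ℚ⁆ EnvAssoc A) a b
  rw [LieRing.of_associative_ring_bracket, LieRing.of_associative_ring_bracket] at h
  exact h

end

theorem coe_T (l : ℕ+) (a : RatExt R) : (T R l a : ⨂[ℚ] _i : ℕ+, Env R) =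
    PiTensorProduct.singleAlgHom (R := ℚ) (A := fun _ : ℕ+ => Env R) l (toEnv (RatExt R) a) := rfl

theorem T_bracket (l : ℕ+) (a b : RatExt R) :
    T R l (a * b - b * a) = T R l a * T R l b - T R l b * T R l a := by
  apply Subtype.ext
  rw [AddSubgroupClass.coe_sub, MulMemClass.coe_mul, MulMemClass.coe_mul, coe_T, coe_T, coe_T,
    toEnv_bracket, map_sub, map_mul, map_mul]

theorem T_commute {k l : ℕ+} (h : k ≠ l) (a b : RatExt R) : Commute (T R k a) (T R l b) := by
  apply Subtype.ext
  rw [MulMemClass.coe_mul, MulMemClass.coe_mul, coe_T, coe_T]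
  exact Commute.tprod (Pi.mulSingle_commute h _ _)

theorem isLieFamily_tau : IsLieFamily (tau R) := by
  intro i j hi hj a b
  rw [defect]
  by_cases h : i = j
  · subst h
    rw [if_pos rfl, tau, T_bracket, sub_self]
  · rw [if_neg h, sub_zero, sub_eq_zero]
    refine T_commute R (fun h2 => h ?_) a b
    have := congrArg PNat.val h2
    simpa [Nat.toPNat'_coe, Nat.pos_of_ne_zero hi, Nat.pos_of_ne_zero hj] using this

variable {R} {σ : Type*}

theorem tau_mk {k : ℕ} (h : 0 < k) : tau R k = T R ⟨k, h⟩ := by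
  rw [tau]
  congr 1
  exact PNat.eq (by simp [Nat.toPNat'_coe, h])

theorem infProd_Theta {x : ℕ+ → MvPowerSeries σ (RatExt R)}
    (hx : ∀ l : ℕ+, OrdGE l (seriesLog (x l))) :
    infProd (fun l => Theta l (x l)) = seriesExp (isum fun k =>
      if h : 0 < k then mapLin (tau R k) (seriesLog (x ⟨k, h⟩)) else 0) := by
  have h1 := infProd_seriesExp (a := fun l => mapLin (T R l) (seriesLog (x l)))
    (fun l => (hx l).mapLin _) (fun k l => ?_)
  · refine h1.trans ?_
    congr 2
    ext1 k
    split_ifs with h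
    · rw [tau_mk h]
    · rfl
  · by_cases h : k = l
    · subst h; exact Commute.refl _
    · exact commute_of_coeff fun m n => T_commute R h _ _

theorem seriesLog_powSubst {x : MvPowerSeries σ (RatExt R)} (hx : constantCoeff x = 1) {k : ℕ}
    (hk : k ≠ 0) :
    seriesLog ((powSubst σ k hk).subst x) = (powSubst σ k hk).subst (seriesLog x) :=
  (MonomialSubst.subst_seriesLog _ hx).symm

/-- When the `l`-th factor comes from `x(t^l)` for one fixed series `x`, the logarithm commutes with
`t ↦ t^l`, and the exponents add up to `T(log x)`. -/
theorem infProd_Theta_eq_lieExp {x : MvPowerSeries σ (RatExt R)} (hx : constantCoeff x = 1)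
    (y : ℕ+ → MvPowerSeries σ (RatExt R))
    (hy : ∀ l : ℕ+, y l = (powSubst σ l l.ne_zero).subst x) :
    infProd (fun l => Theta l (y l)) = lieExp (tau R) x := by
  rw [infProd_Theta, lieExp, lieOp_eq_isum _ (ordGE_log x)]
  · congr 2
    ext1 k
    split_ifs with h
    · exact congrArg (mapLin _) ((congrArg seriesLog (hy ⟨k, h⟩)).trans
        (seriesLog_powSubst hx h.ne'))
    · rfl
  · intro l
    rw [hy, seriesLog_powSubst hx]
    exact ordGE_powSubst _ (ordGE_log x)

theorem monomial_unit_eq (k : ℕ) (U : RatExt R) :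
    (-PowerSeries.X : PowerSeries (RatExt R)) ^ k * PowerSeries.C U =
      ((-1 : ℤ) ^ k • monomial (Finsupp.single () k) U : MvPowerSeries Unit (RatExt R)) := by
  rw [neg_pow]
  have h : (PowerSeries.X : PowerSeries (RatExt R)) ^ k * PowerSeries.C U =
      (monomial (Finsupp.single () k) U : MvPowerSeries Unit (RatExt R)) := by
    rw [PowerSeries.X_pow_eq]
    ext n
    rw [PowerSeries.coeff_mul_C]
    change coeff (Finsupp.single () n) (monomial (Finsupp.single () k) (1 : RatExt R)) * U =
      coeff (Finsupp.single () n) (monomial (Finsupp.single () k) U)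
    classical
    rw [coeff_monomial, coeff_monomial]
    split_ifs <;> simp
  rw [mul_assoc, h, zsmul_eq_mul]
  congr 1
  push_cast
  rfl

/-- After `t ↦ -t` the argument of `Θ_l` becomes `1 - t^l U`, the power substitution of `1 - tU`. -/
theorem flip_E (U : R) :
    flip (E U) = lieExp (tau R) (1 - monomial (Finsupp.single () 1) (toRatExt R U)) := by
  set x : MvPowerSeries Unit (RatExt R) := 1 - monomial (Finsupp.single () 1) (toRatExt R U) with hx
  have cx : constantCoeff x = 1 := constantCoeff_one_sub_monomial single_one_ne_zero _
  have hsk : ∀ k : ℕ, k ≠ 0 → (Finsupp.single () k : Unit →₀ ℕ) ≠ 0 := fun k hk => by simpa using hk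
  have hy : ∀ l : ℕ+, (1 - (-PowerSeries.X) ^ (l : ℕ) * PowerSeries.C (toRatExt R U) :
      MvPowerSeries Unit (RatExt R)) =
      (MonomialSubst.ofMonomial ((-1) ^ (l : ℕ)) (Finsupp.single () (l : ℕ))
        (hsk _ l.ne_zero)).subst x := by
    intro l
    rw [hx, map_sub, map_one]
    refine congrArg (fun z => (1 - z : MvPowerSeries Unit (RatExt R))) ?_
    refine (monomial_unit_eq (l : ℕ) (toRatExt R U)).trans ?_
    classical
    refine MvPowerSeries.ext fun n => ?_
    rw [MonomialSubst.coeff_subst, map_zsmul]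
    simp only [coeff_monomial, smul_ite, smul_zero]
    rw [Finset.sum_ite_eq']
    simp only [MonomialSubst.mem_fiber, MonomialSubst.ofMonomial_exponent]
    simp [MonomialSubst.ofMonomial, eq_comm]
  have hlog : ∀ l : ℕ+, seriesLog (1 - (-PowerSeries.X) ^ (l : ℕ) * PowerSeries.C (toRatExt R U) :
      MvPowerSeries Unit (RatExt R)) =
      (MonomialSubst.ofMonomial ((-1) ^ (l : ℕ)) (Finsupp.single () (l : ℕ))
        (hsk _ l.ne_zero)).subst (seriesLog x) := by
    intro l
    rw [hy, MonomialSubst.subst_seriesLog _ cx]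
  have hfib : ∀ (k : ℕ) (hk : k ≠ 0) (c : ℤ) (n : Unit →₀ ℕ),
      (MonomialSubst.ofMonomial c (Finsupp.single () k) (hsk k hk)).fiber n =
        (powSubst Unit k hk).fiber n := by
    intro k hk c n
    ext m
    rw [MonomialSubst.mem_fiber, mem_fiber_powSubst, MonomialSubst.ofMonomial_exponent]
    have : m () • Finsupp.single () k = k • m := by ext; simp [mul_comm]
    rw [this]
  -- The sign `((-1)^k)^m = (-1)^(km)` depends on the exponent `n = km` alone. It is therefore the
  -- same for all factors and cancels the sign from `flip`.
  have hcoeff : ∀ (k : ℕ) (hk : k ≠ 0) (n : Unit →₀ ℕ),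
      coeff n ((MonomialSubst.ofMonomial ((-1) ^ k) (Finsupp.single () k)
        (hsk k hk)).subst (seriesLog x)) =
      (-1 : ℤ) ^ n () • coeff n ((powSubst Unit k hk).subst (seriesLog x)) := by
    intro k hk n
    rw [MonomialSubst.coeff_subst, MonomialSubst.coeff_subst, hfib k hk, smul_sum]
    refine Finset.sum_congr rfl fun m hm => ?_
    have h1 := (mem_fiber_powSubst hk).1 hm
    subst h1
    simp [MonomialSubst.ofMonomial, powSubst, pow_mul]
  have hord : ∀ l : ℕ+, OrdGE l (seriesLog (1 - (-PowerSeries.X) ^ (l : ℕ) *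
      PowerSeries.C (toRatExt R U) : MvPowerSeries Unit (RatExt R))) := by
    intro l n hn
    rw [hlog, hcoeff _ l.ne_zero, ordGE_powSubst l.ne_zero (ordGE_log x) n hn, smul_zero]
  rw [flip, MonomialSubst.substMonomial_eq _ _ _ single_one_ne_zero]
  have hE : (E U : MvPowerSeries Unit (GQ R)) = _ := infProd_Theta hord
  rw [hE, MonomialSubst.subst_seriesExp, lieExp, lieOp_eq_isum _ (ordGE_log x),
    ← MonomialSubst.substMonomial_eq]
  · congr 1
    refine MvPowerSeries.ext fun n => ?_
    refine (coeff_flip _ n).trans ?_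
    simp only [isum, coeff_ofCoeff, smul_sum]
    refine Finset.sum_congr rfl fun k _ => ?_
    split_ifs with h
    · rw [coeff_mapLin, coeff_mapLin]
      rw [hlog ⟨k, h⟩]
      have := hcoeff k h.ne' n
      simp only [PNat.mk_coe]
      rw [this, ← map_zsmul, smul_smul, ← mul_pow]
      simp
    · simp
  · refine OrdGE.isum fun k => ?_
    split_ifs with h
    · exact ((hord ⟨k, h⟩).mono h).mapLin _
    · exact ordGE_zero _

theorem isLieExpFamily_E : IsLieExpFamily (tau R) (E : R → PowerSeries (GQ R)) := flip_E

variable {I : Type*} (b : Module.Basis I ℤ R)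

theorem coeff_powerSumSeries_single (l : ℕ+) (p : I × ℕ) :
    coeff (Finsupp.single p (l : ℕ)) (powerSumSeries b l) = toRatExt R (b p.1) := by
  classical
  rw [powerSumSeries, coeff_ofCoeff, Finsupp.support_single _ l.ne_zero, sum_singleton,
    if_pos rfl]

theorem coeff_powerSumSeries_of_forall_ne (l : ℕ+) {m : I × ℕ →₀ ℕ}
    (h : ∀ p, m ≠ Finsupp.single p (l : ℕ)) : coeff m (powerSumSeries b l) = 0 := by
  classical
  rw [powerSumSeries, coeff_ofCoeff]
  exact Finset.sum_eq_zero fun p _ => if_neg (h p)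

theorem powerSumSeries_eq (l : ℕ+) :
    powerSumSeries b l = (powSubst (I × ℕ) l l.ne_zero).subst (powerSumSeries b 1) := by
  ext m
  by_cases h : ∃ p, m = Finsupp.single p (l : ℕ)
  · obtain ⟨p, rfl⟩ := h
    have : (Finsupp.single p (l : ℕ) : I × ℕ →₀ ℕ) = (l : ℕ) • Finsupp.single p 1 := by simp
    rw [coeff_powerSumSeries_single, this, coeff_powSubst_smul]
    exact (coeff_powerSumSeries_single b 1 p).symm
  · push Not at h
    rw [coeff_powerSumSeries_of_forall_ne b l h]
    by_cases h2 : ∃ m', (l : ℕ) • m' = m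
    · obtain ⟨m', rfl⟩ := h2
      rw [coeff_powSubst_smul, coeff_powerSumSeries_of_forall_ne b 1]
      rintro p rfl
      exact h p (by simp)
    · push Not at h2
      rw [coeff_powSubst_of_forall_ne _ _ h2]

theorem constantCoeff_powerSumSeries (l : ℕ+) : constantCoeff (powerSumSeries b l) = 0 := by
  rw [← coeff_zero_eq_constantCoeff_apply, coeff_powerSumSeries_of_forall_ne]
  intro p h
  have := congrArg (fun z => z p) h
  exact l.ne_zero (by simpa using this.symm)

theorem genFun_eq : genFun b = lieExp (tau R) (1 + powerSumSeries b 1) := by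
  refine infProd_Theta_eq_lieExp ?_ _ fun l => ?_
  · rw [map_add, constantCoeff_powerSumSeries, map_one, add_zero]
  · rw [map_add, map_one, ← powerSumSeries_eq]

end Generators


/-! ### Arithmetic functions acting on sequences of functions of `W` -/

section DirichletAction

variable {R : Type*} [Ring R] {B : Type*} [Ring B] [Algebra ℚ B]

/-- The action `(a • f)_n(W) = ∑_{r ∣ n} (a_r / r) f_{n/r}(W^r)` of the arithmetic functions on the
sequences of functions on a ring. -/
def dirichletAct (a : ArithmeticFunction ℚ) (f : ℕ → R → B) (n : ℕ) (W : R) : B :=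
  ∑ p ∈ n.divisorsAntidiagonal, (a p.1 / (p.1 : ℚ)) • f p.2 (W ^ p.1)

theorem dirichletAct_congr {a : ArithmeticFunction ℚ} {f g : ℕ → R → B} {n : ℕ} {W : R}
    (h : ∀ p ∈ n.divisorsAntidiagonal, f p.2 (W ^ p.1) = g p.2 (W ^ p.1)) :
    dirichletAct a f n W = dirichletAct a g n W :=
  Finset.sum_congr rfl fun p hp => by rw [h p hp]

theorem dirichletAct_one (f : ℕ → R → B) {n : ℕ} (hn : n ≠ 0) (W : R) :
    dirichletAct 1 f n W = f n W := by
  rw [dirichletAct, Finset.sum_eq_single (1, n)]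
  · simp
  · rintro ⟨p, q⟩ hp hne
    have h := (Nat.mem_divisorsAntidiagonal.1 hp).1
    have : p ≠ 1 := by
      rintro rfl
      rw [one_mul] at h
      exact hne (by rw [← h])
    rw [ArithmeticFunction.one_apply_ne this, zero_div, zero_smul]
  · intro h
    exact absurd (Nat.mem_divisorsAntidiagonal.2 ⟨one_mul n, hn⟩) h

/-- Dirichlet convolution acts because `(W^i)^k = W^(ik)` and the denominators multiply. -/
theorem dirichletAct_mul (a c : ArithmeticFunction ℚ) (f : ℕ → R → B) (n : ℕ) (W : R) :
    dirichletAct (a * c) f n W = dirichletAct a (dirichletAct c f) n W := by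
  simp only [dirichletAct, ArithmeticFunction.mul_apply, sum_div, sum_smul, smul_sum, sum_sigma']
  apply Finset.sum_nbij' (fun ⟨⟨_i, j⟩, ⟨k, l⟩⟩ ↦ ⟨(k, l * j), (l, j)⟩)
    (fun ⟨⟨i, _j⟩, ⟨k, l⟩⟩ ↦ ⟨(i * k, l), (i, k)⟩)
  · rintro ⟨⟨i, j⟩, ⟨k, l⟩⟩ h
    simp only [mem_sigma, Nat.mem_divisorsAntidiagonal, Ne] at h ⊢
    obtain ⟨⟨rfl, h1⟩, rfl, h2⟩ := h
    exact ⟨⟨by ring, h1⟩, trivial, fun h => h1 (by rw [mul_assoc, h, mul_zero])⟩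
  · rintro ⟨⟨i, j⟩, ⟨k, l⟩⟩ h
    simp only [mem_sigma, Nat.mem_divisorsAntidiagonal, Ne] at h ⊢
    obtain ⟨⟨rfl, h1⟩, rfl, h2⟩ := h
    exact ⟨⟨by ring, h1⟩, trivial, fun h => h1 (by rw [← mul_assoc, h, zero_mul])⟩
  · rintro ⟨⟨i, j⟩, ⟨k, l⟩⟩ h
    simp only [mem_sigma, Nat.mem_divisorsAntidiagonal, Ne] at h ⊢
    obtain ⟨⟨rfl, h1⟩, rfl, h2⟩ := h
    rfl
  · rintro ⟨⟨i, j⟩, ⟨k, l⟩⟩ h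
    simp only [mem_sigma, Nat.mem_divisorsAntidiagonal, Ne] at h ⊢
    obtain ⟨⟨rfl, h1⟩, rfl, h2⟩ := h
    rfl
  · rintro ⟨⟨i, j⟩, ⟨k, l⟩⟩ h
    simp only [mem_sigma, Nat.mem_divisorsAntidiagonal, Ne] at h ⊢
    obtain ⟨⟨rfl, h1⟩, rfl, h2⟩ := h
    rw [smul_smul, ← pow_mul]
    congr 1
    push_cast
    rw [div_mul_div_comm]

/-- The Möbius function with rational values. -/
abbrev moebiusQ : ArithmeticFunction ℚ :=
  ((ArithmeticFunction.moebius : ArithmeticFunction ℤ) : ArithmeticFunction ℚ)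

/-- The zeta function with rational values. -/
abbrev zetaQ : ArithmeticFunction ℚ :=
  ((ArithmeticFunction.zeta : ArithmeticFunction ℕ) : ArithmeticFunction ℚ)

theorem dirichletAct_moebius_zeta (f : ℕ → R → B) {n : ℕ} (hn : n ≠ 0) (W : R) :
    dirichletAct moebiusQ (dirichletAct zetaQ f) n W = f n W := by
  rw [← dirichletAct_mul, ArithmeticFunction.coe_moebius_mul_coe_zeta, dirichletAct_one _ hn]

theorem dirichletAct_zeta_moebius (f : ℕ → R → B) {n : ℕ} (hn : n ≠ 0) (W : R) :
    dirichletAct zetaQ (dirichletAct moebiusQ f) n W = f n W := by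
  rw [← dirichletAct_mul, ArithmeticFunction.coe_zeta_mul_coe_moebius, dirichletAct_one _ hn]

theorem dirichletAct_zeta (f : ℕ → R → B) (n : ℕ) (W : R) : dirichletAct zetaQ f n W =
    ∑ p ∈ n.divisorsAntidiagonal, (1 / (p.1 : ℚ)) • f p.2 (W ^ p.1) := by
  refine Finset.sum_congr rfl fun p hp => ?_
  have : p.1 ≠ 0 := by
    intro h
    have := Nat.mem_divisorsAntidiagonal.1 hp
    rw [h, zero_mul] at this
    exact this.2 this.1.symm
  rw [ArithmeticFunction.natCoe_apply, ArithmeticFunction.zeta_apply_ne this, Nat.cast_one]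

/-- The divisor `r = 1` contributes `M n (b u)`, and all other terms involve `M m` with `m < n`, so
the values on the basis can be solved for recursively. -/
theorem exists_dirichletAct_zeta_eq {I : Type*} (b : Module.Basis I ℤ R) (g : ℕ → I → B) :
    ∃ M : ℕ → R →ₗ[ℤ] B, ∀ n, n ≠ 0 → ∀ u,
      dirichletAct zetaQ (fun n W => M n W) n (b u) = g n u := by
  -- The powers `b u ^ r` need not be basis elements. Each `M n` is therefore extended linearly to
  -- `R` before the recursion proceeds.
  let F : (n : ℕ) → ((m : ℕ) → m < n → R →ₗ[ℤ] B) → R →ₗ[ℤ] B := fun n ih =>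
    b.constr ℤ fun u => g n u - ∑ p ∈ n.divisorsAntidiagonal,
      if h : p.2 < n then (1 / (p.1 : ℚ)) • ih p.2 h (b u ^ p.1) else 0
  let M : ℕ → R →ₗ[ℤ] B := fun n => WellFounded.fix (C := fun _ => R →ₗ[ℤ] B) Nat.lt_wfRel.wf F n
  have hM : ∀ n, M n = F n fun m _ => M m := fun n => WellFounded.fix_eq _ _ _
  refine ⟨M, fun n hn u => ?_⟩
  rw [dirichletAct_zeta]
  have h1 : (1, n) ∈ n.divisorsAntidiagonal := Nat.mem_divisorsAntidiagonal.2 ⟨one_mul n, hn⟩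
  rw [← Finset.add_sum_erase _ _ h1]
  simp only [Nat.cast_one, div_one, one_smul, pow_one]
  rw [hM n]
  simp only [F, Module.Basis.constr_basis]
  rw [← Finset.add_sum_erase _ _ h1, dif_neg (lt_irrefl n), zero_add, sub_add_eq_add_sub,
    sub_eq_iff_eq_add]
  congr 1
  refine Finset.sum_congr rfl fun p hp => ?_
  obtain ⟨hp1, hp2⟩ := Finset.mem_erase.1 hp
  obtain ⟨h2, -⟩ := Nat.mem_divisorsAntidiagonal.1 hp2
  have h3 : p.2 < n := by
    rcases p with ⟨i, j⟩
    simp only at h2 ⊢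
    have hi : i ≠ 1 := by
      rintro rfl
      rw [one_mul] at h2
      exact hp1 (by rw [h2])
    have hi0 : i ≠ 0 := by rintro rfl; rw [zero_mul] at h2; exact hn h2.symm
    have hj0 : j ≠ 0 := by rintro rfl; rw [mul_zero] at h2; exact hn h2.symm
    rw [← h2]
    exact lt_mul_left (Nat.pos_of_ne_zero hj0) (by omega)
  rw [dif_pos h3]

end DirichletAction

/-! ### The logarithm of `1 - tW` -/

section LogCoefficients

variable {A : Type*} [Ring A] [Algebra ℚ A]

theorem monomial_unit_pow (a : A) (k : ℕ) :
    (monomial (Finsupp.single () 1) a : MvPowerSeries Unit A) ^ k =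
      monomial (Finsupp.single () k) (a ^ k) := by
  induction k with
  | zero => simp only [pow_zero, Finsupp.single_zero]; rfl
  | succ k ih => rw [pow_succ, ih, monomial_mul_monomial, ← Finsupp.single_add, pow_succ]

theorem coeff_seriesLog_one_sub_monomial (a : A) (n : ℕ) :
    coeff (Finsupp.single () n)
      (seriesLog (1 - monomial (Finsupp.single () 1) a : MvPowerSeries Unit A)) =
      -((1 / (n : ℚ)) • a ^ n) := by
  classical
  rw [seriesLog, coeff_ofCoeff]
  have h : ∀ k, coeff (Finsupp.single () n)
      ((1 - monomial (Finsupp.single () 1) a - 1 : MvPowerSeries Unit A) ^ k) =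
      if n = k then (-1 : ℚ) ^ k • a ^ k else 0 := by
    intro k
    have e1 : (1 - monomial (Finsupp.single () 1) a - 1 : MvPowerSeries Unit A) =
      monomial (Finsupp.single () 1) (-a) := by rw [map_neg]; abel
    rw [e1, monomial_unit_pow, coeff_monomial]
    have : (Finsupp.single () n = (Finsupp.single () k : Unit →₀ ℕ)) ↔ n = k :=
      (Finsupp.single_injective ()).eq_iff
    simp only [this]
    split_ifs
    · rw [neg_pow, Algebra.smul_def]; simp
    · rfl
  simp only [h, smul_ite, smul_zero]
  rw [Finset.sum_ite_eq]
  by_cases hn : n = 0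
  · subst hn; simp
  · rw [if_pos (Finset.mem_Icc.2 ⟨Nat.one_le_iff_ne_zero.2 hn, by simp⟩), smul_smul, ← neg_smul]
    congr 1
    rw [pow_succ]
    have : ((-1 : ℚ) ^ n) * (-1) ^ n = 1 := by rw [← mul_pow]; simp
    field_simp
    linear_combination -this

end LogCoefficients

/-! ### The second relation and Möbius inversion -/

section LogFamilies

variable {R : Type*} [Ring R] {B : Type*} [Ring B] [Algebra ℚ B]

theorem divs_single (n : ℕ) (f : ℕ × (Unit →₀ ℕ) → B) : ∑ p ∈ divs (Finsupp.single () n), f p =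
    ∑ p ∈ n.divisorsAntidiagonal, f (p.2, Finsupp.single () p.1) := by
  symm
  refine Finset.sum_nbij' (fun p => (p.2, Finsupp.single () p.1)) (fun p => (p.2 (), p.1))
    ?_ ?_ ?_ ?_ ?_
  · rintro ⟨i, j⟩ h
    obtain ⟨h1, h2⟩ := Nat.mem_divisorsAntidiagonal.1 h
    simp only at h1
    subst h1
    rw [mem_divs]
    refine ⟨right_ne_zero_of_mul h2, ?_, ?_⟩
    · simpa using left_ne_zero_of_mul h2
    · simp [mul_comm]
  · rintro ⟨i, m⟩ h
    obtain ⟨h1, h2, h3⟩ := mem_divs.1 h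
    have h4 := congrArg (fun z => z ()) h3
    simp only [Finsupp.coe_smul, Pi.smul_apply, smul_eq_mul, Finsupp.single_eq_same] at h4
    refine Nat.mem_divisorsAntidiagonal.2 ⟨by rw [mul_comm]; exact h4, ?_⟩
    rw [← h4]
    refine mul_ne_zero h1 fun h5 => h2 ?_
    ext; simpa using h5
  · intro p _; simp
  · rintro ⟨i, m⟩ _
    refine Prod.ext rfl ?_
    ext; simp
  · intro p _; rfl

/-- The coefficients of the series `log ℰ_W(-t)`. -/
def logCoeff (𝓔 : R → PowerSeries B) (n : ℕ) (W : R) : B :=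
  coeff (Finsupp.single () n) (seriesLog (flip (𝓔 W)))

theorem eq_of_logCoeff_eq {𝓔 𝓔' : R → PowerSeries B} {W : R}
    (h : PowerSeries.constantCoeff (𝓔 W) = 1) (h' : PowerSeries.constantCoeff (𝓔' W) = 1)
    (H : ∀ n, n ≠ 0 → logCoeff 𝓔 n W = logCoeff 𝓔' n W) : 𝓔 W = 𝓔' W := by
  apply flip_injective
  rw [← seriesExp_seriesLog ((constantCoeff_flip _).trans h),
    ← seriesExp_seriesLog ((constantCoeff_flip _).trans h')]
  congr 1
  refine MvPowerSeries.ext fun m => ?_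
  have hm : m = Finsupp.single () (m ()) := by ext; simp
  rw [hm]
  by_cases h0 : m () = 0
  · rw [h0, Finsupp.single_zero, ordGE_log _ 0 (by simp), ordGE_log _ 0 (by simp)]
  · exact H _ h0

variable {t : ℕ → RatExt R →ₗ[ℚ] B} {𝓔 : R → PowerSeries B}

/-- The family of series attached to `t`. -/
def lieExpFamily (t : ℕ → RatExt R →ₗ[ℚ] B) (W : R) : PowerSeries B :=
  flip (lieExp t (1 - monomial (Finsupp.single () 1) (toRatExt R W)) : MvPowerSeries Unit B)

theorem isLieExpFamily_lieExpFamily (t : ℕ → RatExt R →ₗ[ℚ] B) :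
    IsLieExpFamily t (lieExpFamily t) := fun W => by
  refine MvPowerSeries.ext fun n => ?_
  refine (coeff_flip _ n).trans ((congrArg _ (coeff_flip _ n)).trans ?_)
  rw [smul_smul, ← mul_pow]
  simp

/-- Since `log(1 - tW) = -∑ t^r W^r / r`, applying the operator sums `t_{n/r}(W^r)/r` over the
divisors `r` of `n`, which is the action of the zeta function. -/
theorem IsLieExpFamily.logCoeff_eq (H : IsLieExpFamily t 𝓔) (n : ℕ) (W : R) :
    logCoeff 𝓔 n W = dirichletAct zetaQ (fun n W => -t n (toRatExt R W)) n W := by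
  rw [logCoeff, H W, lieExp, seriesLog_seriesExp (ordGE_one_lieOp _ _), coeff_lieOp, divs_single,
    dirichletAct_zeta]
  refine Finset.sum_congr rfl fun p _ => ?_
  rw [coeff_seriesLog_one_sub_monomial, map_neg, map_smul, smul_neg, map_pow (toRatExt R)]

theorem coeff_moebiusLog (h : ∀ W, PowerSeries.constantCoeff (𝓔 W) = 1) (n : ℕ) (W : R) :
    PowerSeries.coeff n (moebiusLog 𝓔 W) = dirichletAct moebiusQ (logCoeff 𝓔) n W := by
  rw [moebiusLog, PowerSeries.coeff_mk, dirichletAct,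
    Nat.sum_divisorsAntidiagonal (fun i j => (moebiusQ i / (i : ℚ)) • logCoeff 𝓔 j (W ^ i))]
  symm
  have key : ∀ r, r ≠ 0 → ∀ d, coeff (Finsupp.single () d)
      (seriesLog (substMonomial (𝓔 (W ^ r)) (-1) (Finsupp.single () r))) =
      if r ∣ d then logCoeff 𝓔 (d / r) (W ^ r) else 0 := by
    intro r hr d
    have hsr : (Finsupp.single () r : Unit →₀ ℕ) ≠ 0 := by simpa using hr
    rw [substMonomial_neg_one _ hsr, ← MonomialSubst.subst_seriesLog _
      ((constantCoeff_flip _).trans (h _)), MonomialSubst.coeff_subst]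
    have hw : ∀ m, (MonomialSubst.ofMonomial 1 (Finsupp.single () r) hsr).weight m = 1 :=
      fun m => one_pow _
    split_ifs with hd
    · obtain ⟨e, rfl⟩ := hd
      rw [Nat.mul_div_cancel_left _ (Nat.pos_of_ne_zero hr),
        Finset.sum_eq_single (Finsupp.single () e), hw, one_smul, logCoeff]
      · intro m hm hne
        rw [MonomialSubst.mem_fiber, MonomialSubst.ofMonomial_exponent] at hm
        have := congrArg (fun z => z ()) hm
        simp only [Finsupp.coe_smul, Pi.smul_apply, smul_eq_mul, Finsupp.single_eq_same] at this
        refine absurd ?_ hne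
        ext
        rw [mul_comm] at this
        simpa using Nat.eq_of_mul_eq_mul_left (Nat.pos_of_ne_zero hr) this
      · intro hm
        refine absurd ?_ hm
        rw [MonomialSubst.mem_fiber, MonomialSubst.ofMonomial_exponent]
        simp [mul_comm]
    · refine Finset.sum_eq_zero fun m hm => ?_
      rw [MonomialSubst.mem_fiber, MonomialSubst.ofMonomial_exponent] at hm
      have := congrArg (fun z => z ()) hm
      simp only [Finsupp.coe_smul, Pi.smul_apply, smul_eq_mul, Finsupp.single_eq_same] at this
      exact absurd ⟨m (), by rw [← this, mul_comm]⟩ hd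
  have hsub : n.divisors ⊆ Icc 1 n := fun r hr => by
    have h1 := Nat.dvd_of_mem_divisors hr
    have h2 := Nat.pos_of_mem_divisors hr
    have h3 := Nat.divisor_le hr
    exact Finset.mem_Icc.2 ⟨h2, h3⟩
  rw [← Finset.sum_subset hsub]
  · refine Finset.sum_congr rfl fun r hr => ?_
    have h1 := Nat.dvd_of_mem_divisors hr
    have h2 := Nat.pos_of_mem_divisors hr
    have := key r h2.ne' n
    rw [if_pos h1] at this
    rw [← this]
    rfl
  · intro r hr hr'
    rw [Finset.mem_Icc] at hr
    have := key r (by omega) n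
    rw [if_neg (fun hd => hr' (Nat.mem_divisors.2 ⟨hd, by omega⟩))] at this
    exact (congrArg _ this).trans (smul_zero _)

/-- Möbius inversion recovers the linear maps themselves, so the second relation expresses their
additivity in `W`. -/
theorem IsLieExpFamily.coeff_moebiusLog_eq (H : IsLieExpFamily t 𝓔) {n : ℕ} (hn : n ≠ 0) (W : R) :
    PowerSeries.coeff n (moebiusLog 𝓔 W) = -t n (toRatExt R W) := by
  rw [coeff_moebiusLog H.constantCoeff_eq, dirichletAct_congr fun p _ => H.logCoeff_eq _ _,
    dirichletAct_moebius_zeta _ hn]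

theorem coeff_zero_moebiusLog (𝓔 : R → PowerSeries B) (W : R) :
    PowerSeries.coeff 0 (moebiusLog 𝓔 W) = 0 := by
  rw [moebiusLog, PowerSeries.coeff_mk]; rfl

variable {I : Type*} (b : Module.Basis I ℤ R)

theorem sumRelation_iff : SumRelation b 𝓔 ↔ ∀ n W, PowerSeries.coeff n (moebiusLog 𝓔 W) =
    b.constr ℤ (fun u => PowerSeries.coeff n (moebiusLog 𝓔 (b u))) W := by
  have : ∀ n W, b.constr ℤ (fun u => PowerSeries.coeff n (moebiusLog 𝓔 (b u))) W =
      PowerSeries.coeff n ((b.repr W).sum fun u a => a • moebiusLog 𝓔 (b u)) := by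
    intro n W
    rw [Module.Basis.constr_apply, Finsupp.sum, Finsupp.sum, map_sum]
    exact Finset.sum_congr rfl fun u _ => (map_zsmul _ _ _).symm
  simp only [this]
  exact ⟨fun h n W => by rw [h W], fun h W => PowerSeries.ext fun n => h n W⟩

theorem IsLieExpFamily.sumRelation (H : IsLieExpFamily t 𝓔) : SumRelation b 𝓔 := by
  rw [sumRelation_iff]
  intro n W
  by_cases hn : n = 0
  · subst hn
    simp only [coeff_zero_moebiusLog]
    rw [Module.Basis.constr_apply]
    simp
  · simp only [H.coeff_moebiusLog_eq hn]
    let f : R →ₗ[ℤ] B := -((t n).toAddMonoidHom.comp (toRatExt R).toAddMonoidHom).toIntLinearMap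
    have : b.constr ℤ (fun u => -t n (toRatExt R (b u))) = f := by
      refine b.ext fun u => ?_
      rw [Module.Basis.constr_basis]; rfl
    rw [this]; rfl

/-- The `ℚ`-linear extension of an additive map to `ℚ ⊗ R`. -/
def extendQ (f : R →ₗ[ℤ] B) : RatExt R →ₗ[ℚ] B :=
  (LinearMap.liftBaseChange ℚ f : ℚ ⊗[ℤ] R →ₗ[ℚ] B)

theorem extendQ_toRatExt (f : R →ₗ[ℤ] B) (W : R) : extendQ f (toRatExt R W) = f W := by
  change LinearMap.liftBaseChange ℚ f ((1 : ℚ) ⊗ₜ[ℤ] W) = f W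
  rw [LinearMap.liftBaseChange_tmul, one_smul]

theorem isLieExpFamily_of_logCoeff (h : ∀ W, PowerSeries.constantCoeff (𝓔 W) = 1)
    (H : ∀ n, n ≠ 0 → ∀ W,
      logCoeff 𝓔 n W = dirichletAct zetaQ (fun n W => -t n (toRatExt R W)) n W) :
    IsLieExpFamily t 𝓔 := by
  intro W
  have h' := isLieExpFamily_lieExpFamily t
  have : 𝓔 W = lieExpFamily t W := eq_of_logCoeff_eq (h W) (h'.constantCoeff_eq W) fun n hn => by
    rw [H n hn, h'.logCoeff_eq]
  rw [this, h' W]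

/-- Relation (2) makes the coefficients of `moebiusLog` additive in `W`; their negatives, extended
over `ℚ`, are the required maps, and inversion by zeta returns the logarithms. -/
theorem exists_isLieExpFamily (h : ∀ W, PowerSeries.constantCoeff (𝓔 W) = 1)
    (H : SumRelation b 𝓔) : ∃ t : ℕ → RatExt R →ₗ[ℚ] B, IsLieExpFamily t 𝓔 := by
  rw [sumRelation_iff] at H
  refine ⟨fun n => extendQ (-b.constr ℤ (fun u => PowerSeries.coeff n (moebiusLog 𝓔 (b u)))),
    isLieExpFamily_of_logCoeff h fun n hn W => ?_⟩
  rw [← dirichletAct_zeta_moebius (logCoeff 𝓔) hn]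
  refine dirichletAct_congr fun p _ => ?_
  rw [extendQ_toRatExt, LinearMap.neg_apply, neg_neg, ← H, coeff_moebiusLog h]

/-- The maps `t_n` are chosen recursively so that the logarithms at the basis elements are the
prescribed ones; the attached family then satisfies (2) automatically. -/
theorem exists_sumRelation (g : I → PowerSeries B)
    (hg : ∀ u, PowerSeries.constantCoeff (g u) = 1) : ∃ 𝓔 : R → PowerSeries B,
      (∀ W, PowerSeries.constantCoeff (𝓔 W) = 1) ∧ (∀ u, 𝓔 (b u) = g u) ∧ SumRelation b 𝓔 := by
  obtain ⟨M, hM⟩ := exists_dirichletAct_zeta_eq b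
    fun n u => coeff (Finsupp.single () n) (seriesLog (flip (g u)))
  let t : ℕ → RatExt R →ₗ[ℚ] B := fun n => extendQ (-M n)
  have h' := isLieExpFamily_lieExpFamily t
  refine ⟨lieExpFamily t, h'.constantCoeff_eq, fun u => ?_, h'.sumRelation b⟩
  refine eq_of_logCoeff_eq (𝓔' := fun _ => g u) (h'.constantCoeff_eq _) (hg u) fun n hn => ?_
  rw [h'.logCoeff_eq]
  refine Eq.trans ?_ (hM n hn u)
  refine dirichletAct_congr fun p _ => ?_
  simp only [t]
  rw [extendQ_toRatExt, LinearMap.neg_apply, neg_neg]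

/-- Induction on `n`: zeta inversion expresses the `n`-th logarithmic coefficient at any `W` through
coefficients of `moebiusLog` of index at most `n`. By (2) these are determined by the basis
elements. -/
theorem sumRelation_unique {𝓔 𝓔' : R → PowerSeries B}
    (h : ∀ W, PowerSeries.constantCoeff (𝓔 W) = 1) (h' : ∀ W, PowerSeries.constantCoeff (𝓔' W) = 1)
    (hb : ∀ u, 𝓔 (b u) = 𝓔' (b u)) (H : SumRelation b 𝓔) (H' : SumRelation b 𝓔') : 𝓔 = 𝓔' := by
  rw [sumRelation_iff] at H H'
  have key : ∀ n, n ≠ 0 → ∀ W, logCoeff 𝓔 n W = logCoeff 𝓔' n W := by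
    intro n
    induction n using Nat.strong_induction_on with
    | _ n ih =>
      intro hn
      have hle : ∀ {k : ℕ} {p : ℕ × ℕ}, p ∈ k.divisorsAntidiagonal → p.2 ≤ k ∧ p.2 ≠ 0 := by
        intro k p hp
        obtain ⟨h1, h2⟩ := Nat.mem_divisorsAntidiagonal.1 hp
        rw [← h1] at h2 ⊢
        exact ⟨Nat.le_mul_of_pos_left _ (Nat.pos_of_ne_zero (left_ne_zero_of_mul h2)),
          right_ne_zero_of_mul h2⟩
      have h1 : ∀ k, k ≤ n → ∀ W, PowerSeries.coeff k (moebiusLog 𝓔 W) =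
          PowerSeries.coeff k (moebiusLog 𝓔' W) := by
        intro k hk W
        rw [H, H']
        congr 2
        ext1 u
        rw [coeff_moebiusLog h, coeff_moebiusLog h']
        refine dirichletAct_congr fun p hp => ?_
        obtain ⟨h2, h3⟩ := hle hp
        by_cases h4 : p.2 < n
        · exact ih _ h4 h3 _
        -- Index `n` itself is reached for `r = 1` only, and there the argument is the basis
        -- element, where both families agree by hypothesis.
        · have h5 : k = n := by omega
          have h6 : p.2 = n := by omega
          have h7 := (Nat.mem_divisorsAntidiagonal.1 hp).1
          rw [h6, h5] at h7
          have h8 : p.1 = 1 := Nat.eq_of_mul_eq_mul_right (Nat.pos_of_ne_zero hn) (by simpa using h7)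
          rw [h8, pow_one, logCoeff, logCoeff, hb]
      intro W
      rw [← dirichletAct_zeta_moebius (logCoeff 𝓔) hn, ← dirichletAct_zeta_moebius (logCoeff 𝓔') hn]
      refine dirichletAct_congr fun p hp => ?_
      rw [← coeff_moebiusLog h, ← coeff_moebiusLog h']
      exact h1 _ (hle hp).1 _
  ext1 W
  exact eq_of_logCoeff_eq (h W) (h' W) fun n hn => key n hn W

end LogFamilies


/-! ### Behaviour under algebra homomorphisms, and reduction to a basis -/

section Naturality

variable {σ : Type*} {A B : Type*} [Ring A] [Ring B]

theorem map_substMonomial (φ : A →+* B) (f : PowerSeries A) (c : ℤ) (d : σ →₀ ℕ) :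
    MvPowerSeries.map φ (substMonomial f c d) = substMonomial (PowerSeries.map φ f) c d := by
  ext m
  rw [coeff_map, substMonomial, substMonomial, coeff_ofCoeff, coeff_ofCoeff, map_sum]
  refine Finset.sum_congr rfl fun n _ => ?_
  rw [apply_ite φ, map_zsmul, map_zero, PowerSeries.coeff_map]

theorem map_seriesInv (φ : A →+* B) {f : MvPowerSeries σ A} (hf : constantCoeff f = 1) :
    MvPowerSeries.map φ (seriesInv f) = seriesInv (MvPowerSeries.map φ f) := by
  symm
  refine seriesInv_eq (by rw [constantCoeff_map, hf, map_one]) ?_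
  rw [← map_mul, mul_seriesInv hf, map_one]

theorem single_add_single_ne_zero :
    (Finsupp.single 0 1 + Finsupp.single 1 1 : Fin 2 →₀ ℕ) ≠ 0 := fun h => by
  simpa using congrArg (fun z => z 0) h

theorem map_tripleSeries (φ : A →+* B) {F G H : PowerSeries A}
    (hG : PowerSeries.constantCoeff G = 1) : MvPowerSeries.map φ (tripleSeries F G H) =
      tripleSeries (PowerSeries.map φ F) (PowerSeries.map φ G) (PowerSeries.map φ H) := by
  rw [tripleSeries, tripleSeries, map_mul, map_mul, map_substMonomial, map_substMonomial,
    map_seriesInv φ ((constantCoeff_substMonomial _ _ single_add_single_ne_zero).trans hG),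
    map_substMonomial]

theorem map_tripleSeriesRev (φ : A →+* B) {F G H : PowerSeries A}
    (hG : PowerSeries.constantCoeff G = 1) : MvPowerSeries.map φ (tripleSeriesRev F G H) =
      tripleSeriesRev (PowerSeries.map φ F) (PowerSeries.map φ G) (PowerSeries.map φ H) := by
  rw [tripleSeriesRev, tripleSeriesRev, map_mul, map_mul, map_substMonomial, map_substMonomial,
    map_seriesInv φ ((constantCoeff_substMonomial _ _ single_add_single_ne_zero).trans hG),
    map_substMonomial]

variable [Algebra ℚ A] [Algebra ℚ B] {L : Type*} [Ring L] [Algebra ℚ L]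

theorem map_lieExp (φ : A →ₐ[ℚ] B) (t : ℕ → L →ₗ[ℚ] A) (x : MvPowerSeries σ L) :
    MvPowerSeries.map (φ : A →+* B) (lieExp t x) = lieExp (fun n => φ.toLinearMap ∘ₗ t n) x := by
  rw [lieExp, lieExp, map_seriesExp]
  congr 1
  ext m
  rw [coeff_map, coeff_lieOp, coeff_lieOp, map_sum]
  rfl

theorem lieExp_congr {t t' : ℕ → L →ₗ[ℚ] A} (h : ∀ n, n ≠ 0 → t n = t' n)
    (x : MvPowerSeries σ L) : lieExp t x = lieExp t' x := by
  rw [lieExp, lieExp]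
  congr 1
  ext m
  rw [coeff_lieOp, coeff_lieOp]
  exact Finset.sum_congr rfl fun p hp => by rw [h _ (mem_divs.1 hp).1]

variable {R : Type*} [Ring R]

theorem IsLieExpFamily.map {t : ℕ → RatExt R →ₗ[ℚ] A} {𝓔 : R → PowerSeries A}
    (H : IsLieExpFamily t 𝓔) (φ : A →ₐ[ℚ] B) :
    IsLieExpFamily (fun n => φ.toLinearMap ∘ₗ t n)
      (fun W => PowerSeries.map (φ : A →+* B) (𝓔 W)) := fun W => by
  rw [← map_lieExp, ← H W, flip, flip, map_substMonomial]

theorem IsLieExpFamily.congr {t t' : ℕ → RatExt R →ₗ[ℚ] A} {𝓔 : R → PowerSeries A}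
    (H : IsLieExpFamily t 𝓔) (h : ∀ n, n ≠ 0 → t n = t' n) : IsLieExpFamily t' 𝓔 := fun W => by
  rw [← lieExp_congr h, H W]

theorem IsLieExpFamily.unique {t : ℕ → RatExt R →ₗ[ℚ] A} {𝓔 𝓔' : R → PowerSeries A}
    (H : IsLieExpFamily t 𝓔) (H' : IsLieExpFamily t 𝓔') : 𝓔 = 𝓔' := by
  ext1 W
  exact flip_injective ((H W).trans (H' W).symm)

theorem ratExt_hom_ext {f g : RatExt R →ₗ[ℚ] A}
    (h : ∀ W, f (toRatExt R W) = g (toRatExt R W)) : f = g := by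
  refine LinearMap.ext fun x => ?_
  refine TensorProduct.induction_on (motive := fun x : ℚ ⊗[ℤ] R => f x = g x) x ?_ ?_ ?_
  · exact (map_zero f).trans (map_zero g).symm
  · intro q W
    have e : (q ⊗ₜ[ℤ] W : ℚ ⊗[ℤ] R) = q • ((1 : ℚ) ⊗ₜ[ℤ] W) := by
      rw [TensorProduct.smul_tmul', smul_eq_mul, mul_one]
    rw [e]
    refine (map_smul f q (toRatExt R W)).trans (Eq.trans ?_ (map_smul g q (toRatExt R W)).symm)
    rw [h]
  · intro x y hx hy
    exact (map_add f x y).trans (Eq.trans (congrArg₂ (· + ·) hx hy) (map_add g x y).symm)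

theorem IsLieExpFamily.unique_left {t t' : ℕ → RatExt R →ₗ[ℚ] A} {𝓔 : R → PowerSeries A}
    (H : IsLieExpFamily t 𝓔) (H' : IsLieExpFamily t' 𝓔) {n : ℕ} (hn : n ≠ 0) : t n = t' n :=
  ratExt_hom_ext fun W => neg_injective
    ((H.coeff_moebiusLog_eq hn W).symm.trans (H'.coeff_moebiusLog_eq hn W))

variable {I : Type*} (b : Module.Basis I ℤ R)

theorem ratExt_basis_ext {f g : RatExt R →ₗ[ℚ] A}
    (h : ∀ u, f (toRatExt R (b u)) = g (toRatExt R (b u))) : f = g := by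
  refine ratExt_hom_ext fun W => ?_
  let f' : R →ₗ[ℤ] A := (f.toAddMonoidHom.comp (toRatExt R).toAddMonoidHom).toIntLinearMap
  let g' : R →ₗ[ℤ] A := (g.toAddMonoidHom.comp (toRatExt R).toAddMonoidHom).toIntLinearMap
  have : f' = g' := b.ext h
  exact LinearMap.congr_fun this W

theorem defect_eq_zero_of_basis {t : ℕ → RatExt R →ₗ[ℚ] A} {i j : ℕ}
    (h : ∀ u v, defect t t i j (toRatExt R (b u)) (toRatExt R (b v)) = 0) (x y : RatExt R) :
    defect t t i j x y = 0 := by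
  let D : RatExt R →ₗ[ℚ] RatExt R →ₗ[ℚ] A := LinearMap.mk₂ ℚ (defect t t i j)
    (fun x y z => by simp only [defect, map_add, add_mul, mul_add, map_sub]; split_ifs <;> abel)
    (fun c x y => by
      simp only [defect, map_smul, smul_mul_assoc, mul_smul_comm, smul_sub, map_sub]
      split_ifs <;> simp [smul_sub])
    (fun x y z => by simp only [defect, map_add, add_mul, mul_add, map_sub]; split_ifs <;> abel)
    (fun c x y => by
      simp only [defect, map_smul, smul_mul_assoc, mul_smul_comm, smul_sub, map_sub]
      split_ifs <;> simp [smul_sub])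
  have h1 : ∀ u, D (toRatExt R (b u)) = 0 := fun u => ratExt_basis_ext b fun v => h u v
  have h2 : D.flip y = 0 := ratExt_basis_ext b fun u => by
    rw [LinearMap.flip_apply, h1]; rfl
  exact LinearMap.congr_fun h2 x

/-- A family which satisfies the first relations for the elements of a basis satisfies the Lie
relations. -/
theorem IsLieExpFamily.isLieFamily {t : ℕ → RatExt R →ₗ[ℚ] A} {𝓔 : R → PowerSeries A}
    (H : IsLieExpFamily t 𝓔) (h : ∀ u v, tripleSeries (𝓔 (b u)) (𝓔 (b v * b u)) (𝓔 (b v)) =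
      tripleSeriesRev (𝓔 (b u)) (𝓔 (b u * b v)) (𝓔 (b v))) : IsLieFamily t := by
  -- Induction on `i + j`. Bilinearity extends each step from basis elements to all of `ℚ ⊗ R`,
  -- which the next step needs because `log` and the commutators leave the basis.
  have key : ∀ n i j, i ≠ 0 → j ≠ 0 → i + j = n → ∀ x y, defect t t i j x y = 0 := by
    intro n
    induction n using Nat.strong_induction_on with
    | _ n ih =>
      rintro i j hi hj rfl
      exact defect_eq_zero_of_basis b fun u v => defect_eq_zero_of_triple hi hj
        (fun i' j' hi' hj' hlt => ih _ hlt i' j' hi' hj' rfl) _ _ ((H.triple_iff _ _).1 (h u v))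
  exact fun i j hi hj => key _ i j hi hj rfl

end Naturality

/-! ### Universal enveloping algebras -/

section Enveloping

attribute [local instance] LieRing.ofAssociativeRing LieAlgebra.ofAssociativeAlgebra

variable {A : Type*} [Ring A] [Algebra ℚ A] {B : Type*} [Ring B] [Algebra ℚ B]

/-- The universal property lifts the canonical map to a homomorphism into `S`, and its composition
with the inclusion is the identity because the two agree on generators. -/
theorem env_mem_of_toEnv_mem (S : Subalgebra ℚ (EnvAssoc A)) (h : ∀ a, toEnv A a ∈ S)
    (x : EnvAssoc A) : x ∈ S := by
  let g : A →ₗ⁅ℚ⁆ S :=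
    { toFun := fun a => ⟨toEnv A a, h a⟩
      map_add' := fun x y => Subtype.ext (map_add _ _ _)
      map_smul' := fun c x => Subtype.ext (map_smul _ _ _)
      map_lie' := fun {x y} => Subtype.ext (by
        rw [LieRing.of_associative_ring_bracket, LieRing.of_associative_ring_bracket]
        exact toEnv_bracket x y) }
  have : S.val.comp (UniversalEnvelopingAlgebra.lift ℚ g) = AlgHom.id ℚ _ := by
    refine UniversalEnvelopingAlgebra.hom_ext (R := ℚ) (L := A) (A := EnvAssoc A) ?_
    refine LieHom.ext fun a => ?_
    change S.val (UniversalEnvelopingAlgebra.lift ℚ g (UniversalEnvelopingAlgebra.ι ℚ a)) =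
      toEnv A a
    rw [UniversalEnvelopingAlgebra.lift_ι_apply]
    rfl
  have h2 := AlgHom.congr_fun this x
  rw [AlgHom.id_apply] at h2
  rw [← h2]
  exact (UniversalEnvelopingAlgebra.lift ℚ g x).2

/-- The extension of a Lie homomorphism to the enveloping algebra. -/
def envLift (f : A →ₗ[ℚ] B) (h : ∀ x y, f (x * y - y * x) = f x * f y - f y * f x) :
    EnvAssoc A →ₐ[ℚ] B :=
  UniversalEnvelopingAlgebra.lift ℚ
    { f with
      map_lie' := fun {x y} => by
        rw [LieRing.of_associative_ring_bracket, LieRing.of_associative_ring_bracket]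
        exact h x y }

theorem envLift_toEnv (f : A →ₗ[ℚ] B) (h : ∀ x y, f (x * y - y * x) = f x * f y - f y * f x)
    (a : A) : envLift f h (toEnv A a) = f a :=
  UniversalEnvelopingAlgebra.lift_ι_apply ℚ _ a

/-- Centralizers are subalgebras, so commutation passes from generators to the whole algebra, one
argument at a time. -/
theorem envLift_commute {f g : A →ₗ[ℚ] B} (hf : ∀ x y, f (x * y - y * x) = f x * f y - f y * f x)
    (hg : ∀ x y, g (x * y - y * x) = g x * g y - g y * g x)
    (h : ∀ x y, Commute (f x) (g y)) (x y : EnvAssoc A) : Commute (envLift f hf x) (envLift g hg y) := by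
  have h1 : ∀ (x : EnvAssoc A) (c : B), (∀ a, Commute (f a) c) → Commute (envLift f hf x) c := by
    intro x c hc
    have := env_mem_of_toEnv_mem ((Subalgebra.centralizer ℚ {c}).comap (envLift f hf))
      (fun a => by
        rw [Subalgebra.mem_comap, Subalgebra.mem_centralizer_iff, envLift_toEnv]
        rintro _ rfl
        exact (hc a).eq.symm) x
    rw [Subalgebra.mem_comap, Subalgebra.mem_centralizer_iff] at this
    exact (this c rfl).symm
  have h2 : ∀ (y : EnvAssoc A) (c : B), (∀ a, Commute (g a) c) → Commute (envLift g hg y) c := by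
    intro x c hc
    have := env_mem_of_toEnv_mem ((Subalgebra.centralizer ℚ {c}).comap (envLift g hg))
      (fun a => by
        rw [Subalgebra.mem_comap, Subalgebra.mem_centralizer_iff, envLift_toEnv]
        rintro _ rfl
        exact (hc a).eq.symm) x
    rw [Subalgebra.mem_comap, Subalgebra.mem_centralizer_iff] at this
    exact (this c rfl).symm
  exact h1 x _ fun a => (h2 y _ fun a' => (h a a').symm).symm

end Enveloping

/-! ### Homomorphisms out of the restricted tensor product -/

section RestrictedProduct

variable {A : Type*} [Ring A] [Algebra ℚ A] {B : Type*} [Ring B] [Algebra ℚ B]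
  (f : ℕ+ → A →ₐ[ℚ] B)

/-- The product of the first `N` of the elements `f i (a i)`. -/
def partialProd (N : ℕ) (a : ℕ+ → A) : B :=
  ((List.range N).map fun k => f k.succPNat (a k.succPNat)).prod

theorem partialProd_succ (N : ℕ) (a : ℕ+ → A) :
    partialProd f (N + 1) a = partialProd f N a * f N.succPNat (a N.succPNat) := by
  rw [partialProd, partialProd, List.range_succ, List.map_append, List.prod_append]
  simp

/-- `N` bounds the support of `a`. -/
def SupportBound (N : ℕ) (a : ℕ+ → A) : Prop := ∀ i : ℕ+, N < i → a i = 1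

theorem partialProd_eq {a : ℕ+ → A} {N : ℕ} (h : SupportBound N a) {M : ℕ} (hM : N ≤ M) :
    partialProd f M a = partialProd f N a := by
  induction M, hM using Nat.le_induction with
  | base => rfl
  | succ M hM ih =>
    rw [partialProd_succ, ih, h _ (by rw [Nat.succPNat_coe]; omega), map_one, mul_one]

theorem partialProd_mul (hc : ∀ i j, i ≠ j → ∀ x y, Commute (f i x) (f j y)) (N : ℕ)
    (a a' : ℕ+ → A) : partialProd f N (a * a') = partialProd f N a * partialProd f N a' := by
  induction N with
  | zero => simp [partialProd]
  | succ N ih =>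
    have h : Commute (f N.succPNat (a N.succPNat)) (partialProd f N a') := by
      refine Commute.list_prod_right _ _ fun z hz => ?_
      obtain ⟨k, hk, rfl⟩ := List.mem_map.1 hz
      refine hc _ _ (fun h => ?_) _ _
      have := congrArg PNat.val h
      rw [List.mem_range] at hk
      simp only [Nat.succPNat, PNat.mk_coe] at this
      omega
    rw [partialProd_succ, partialProd_succ, partialProd_succ, ih, Pi.mul_apply, map_mul,
      mul_assoc, mul_assoc, ← mul_assoc (partialProd f N a') , ← h.eq, mul_assoc]

/-- As a function of one entry the product has the form `u * f i x * v`, which makes its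
multilinearity evident. -/
theorem partialProd_update [DecidableEq ℕ+] (N : ℕ) (a : ℕ+ → A) (i : ℕ+) (hi : (i : ℕ) ≤ N) :
    ∃ u v : B, ∀ x, partialProd f N (Function.update a i x) = u * f i x * v := by
  induction N with
  | zero => exact absurd i.pos (by omega)
  | succ N ih =>
    by_cases h : i = N.succPNat
    · refine ⟨partialProd f N a, 1, fun x => ?_⟩
      rw [partialProd_succ, mul_one]
      congr 1
      · refine congrArg List.prod (List.map_congr_left fun k hk => ?_)
        rw [Function.update_of_ne]
        intro h2
        have := congrArg PNat.val (h2.trans h)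
        rw [List.mem_range] at hk
        simp only [Nat.succPNat, PNat.mk_coe] at this
        omega
      · rw [← h, Function.update_self]
    · have h2 : (i : ℕ) ≠ N + 1 := fun h3 => h (PNat.eq h3)
      obtain ⟨u, v, huv⟩ := ih (by omega)
      refine ⟨u, v * f N.succPNat (a N.succPNat), fun x => ?_⟩
      rw [partialProd_succ, huv, Function.update_of_ne (Ne.symm h), mul_assoc]

open Classical in
/-- The product of the elements `f i (a i)` if almost all `a i` are `1`, and `0` otherwise. -/
def restrictedProd (a : ℕ+ → A) : B :=
  if h : ∃ N, SupportBound N a then partialProd f h.choose a else 0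

theorem restrictedProd_eq {a : ℕ+ → A} {N : ℕ} (h : SupportBound N a) :
    restrictedProd f a = partialProd f N a := by
  have h2 : ∃ N, SupportBound N a := ⟨N, h⟩
  rw [restrictedProd, dif_pos h2]
  rcases le_total N h2.choose with h3 | h3
  · exact partialProd_eq f h h3
  · exact (partialProd_eq f h2.choose_spec h3).symm

theorem SupportBound.update [DecidableEq ℕ+] {a : ℕ+ → A} {N : ℕ} (h : SupportBound N a) (i : ℕ+)
    (x : A) : SupportBound (max N i) (Function.update a i x) := by
  intro j hj
  rw [Function.update_of_ne (by rintro rfl; simp at hj), h j (by omega)]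

/-- Changing one factor does not affect whether almost all factors are `1`, so the default value `0`
is compatible with multilinearity. -/
theorem restrictedProd_update [DecidableEq ℕ+] (a : ℕ+ → A) (i : ℕ+) :
    ∃ u v : B, ∀ x, restrictedProd f (Function.update a i x) = u * f i x * v := by
  by_cases h : ∃ N, SupportBound N a
  · obtain ⟨N, h⟩ := h
    obtain ⟨u, v, huv⟩ := partialProd_update f (max N i) a i (le_max_right _ _)
    exact ⟨u, v, fun x => (restrictedProd_eq f (h.update i x)).trans (huv x)⟩
  · refine ⟨0, 0, fun x => ?_⟩
    rw [mul_zero, restrictedProd, dif_neg]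
    rintro ⟨N, hN⟩
    have := hN.update i (a i)
    rw [Function.update_idem, Function.update_eq_self] at this
    exact h ⟨_, this⟩

/-- The linear map on the tensor product given by the restricted product. -/
def restrictedLift : (⨂[ℚ] _i : ℕ+, A) →ₗ[ℚ] B :=
  PiTensorProduct.lift
    { toFun := restrictedProd f
      map_update_add' := fun a i x y => by
        obtain ⟨u, v, h⟩ := restrictedProd_update f a i
        rw [h, h, h, map_add, mul_add, add_mul]
      map_update_smul' := fun a i c x => by
        obtain ⟨u, v, h⟩ := restrictedProd_update f a i
        rw [h, h, map_smul, mul_smul_comm, smul_mul_assoc] }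

theorem restrictedLift_tprod {a : ℕ+ → A} {N : ℕ} (h : SupportBound N a) :
    restrictedLift f (PiTensorProduct.tprod ℚ a) = partialProd f N a := by
  rw [← restrictedProd_eq f h]
  exact PiTensorProduct.lift.tprod a

/-- The pure tensors almost all of whose factors are `1`. -/
def pureTensors (A : Type*) [Ring A] [Algebra ℚ A] : Submonoid (⨂[ℚ] _i : ℕ+, A) where
  carrier := {x | ∃ (a : ℕ+ → A) (N : ℕ), SupportBound N a ∧ PiTensorProduct.tprod ℚ a = x}
  one_mem' := ⟨1, 0, fun _ _ => rfl, rfl⟩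
  mul_mem' := by
    rintro _ _ ⟨a, N, h, rfl⟩ ⟨a', N', h', rfl⟩
    refine ⟨a * a', max N N', fun i hi => ?_, ((PiTensorProduct.tprodMonoidHom ℚ).map_mul a a')⟩
    rw [Pi.mul_apply, h i (lt_of_le_of_lt (le_max_left _ _) hi),
      h' i (lt_of_le_of_lt (le_max_right _ _) hi), one_mul]

theorem restrictedLift_one : restrictedLift f 1 = 1 :=
  restrictedLift_tprod f (a := 1) (N := 0) fun _ _ => rfl

/-- On the span of the pure tensors with almost all factors `1` everything reduces to finite
products, which can be rearranged since different factors commute. -/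
theorem restrictedLift_mul (hc : ∀ i j, i ≠ j → ∀ x y, Commute (f i x) (f j y))
    {x y : ⨂[ℚ] _i : ℕ+, A} (hx : x ∈ Submodule.span ℚ (pureTensors A : Set (⨂[ℚ] _i : ℕ+, A)))
    (hy : y ∈ Submodule.span ℚ (pureTensors A : Set (⨂[ℚ] _i : ℕ+, A))) :
    restrictedLift f (x * y) = restrictedLift f x * restrictedLift f y := by
  induction hx, hy using Submodule.span_induction₂ with
  | mem_mem x y hx hy =>
    obtain ⟨a, N, h, rfl⟩ := hx
    obtain ⟨a', N', h', rfl⟩ := hy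
    have h1 : SupportBound (max N N') a := fun i hi => h i (lt_of_le_of_lt (le_max_left _ _) hi)
    have h2 : SupportBound (max N N') a' := fun i hi => h' i (lt_of_le_of_lt (le_max_right _ _) hi)
    have h3 : SupportBound (max N N') (a * a') := fun i hi => by
      rw [Pi.mul_apply, h1 i hi, h2 i hi, one_mul]
    have e : PiTensorProduct.tprod ℚ a * PiTensorProduct.tprod ℚ a' =
      PiTensorProduct.tprod ℚ (a * a') := ((PiTensorProduct.tprodMonoidHom ℚ).map_mul a a').symm
    rw [e, restrictedLift_tprod f h3, restrictedLift_tprod f h1, restrictedLift_tprod f h2,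
      partialProd_mul f hc]
  | zero_left y hy => rw [zero_mul, map_zero, zero_mul]
  | zero_right x hx => rw [mul_zero, map_zero, mul_zero]
  | add_left x y z hx hy hz h1 h2 => rw [add_mul, map_add, map_add, add_mul, h1, h2]
  | add_right x y z hx hy hz h1 h2 => rw [mul_add, map_add, map_add, mul_add, h1, h2]
  | smul_left r x y hx hy h => rw [smul_mul_assoc, map_smul, map_smul, h, smul_mul_assoc]
  | smul_right r x y hx hy h => rw [mul_smul_comm, map_smul, map_smul, h, mul_smul_comm]

theorem singleAlgHom_mem_pureTensors (i : ℕ+) (x : A) :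
    PiTensorProduct.singleAlgHom (R := ℚ) (A := fun _ : ℕ+ => A) i x ∈ pureTensors A :=
  ⟨Pi.mulSingle i x, i, fun j hj => Pi.mulSingle_eq_of_ne (by rintro rfl; simp at hj) _, rfl⟩

theorem restrictedLift_single (i : ℕ+) (x : A) : restrictedLift f
    (PiTensorProduct.singleAlgHom (R := ℚ) (A := fun _ : ℕ+ => A) i x) = f i x := by
  have h : SupportBound (i : ℕ) (Pi.mulSingle i x : ℕ+ → A) := fun j hj =>
    Pi.mulSingle_eq_of_ne (by rintro rfl; simp at hj) _
  refine (restrictedLift_tprod f h).trans ?_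
  obtain ⟨k, rfl⟩ : ∃ k : ℕ, i = k.succPNat := ⟨i.natPred, (PNat.succPNat_natPred i).symm⟩
  rw [Nat.succPNat_coe, Nat.succ_eq_add_one, partialProd_succ, Pi.mulSingle_eq_same]
  convert one_mul _
  refine List.prod_eq_one fun z hz => ?_
  obtain ⟨j, hj, rfl⟩ := List.mem_map.1 hz
  rw [Pi.mulSingle_eq_of_ne, map_one]
  intro h2
  have := congrArg PNat.val h2
  rw [List.mem_range] at hj
  simp only [Nat.succPNat, PNat.mk_coe] at this
  omega

end RestrictedProduct

/-! ### The universal property of `G_∞^ℚ(R)` -/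

section Lift

variable {R : Type*} [Ring R] {B : Type*} [Ring B] [Algebra ℚ B]

theorem rationalSubalgebra_le : (rationalSubalgebra R : Set (⨂[ℚ] _i : ℕ+, Env R)) ⊆
    Submodule.span ℚ (pureTensors (Env R) : Set (⨂[ℚ] _i : ℕ+, Env R)) := by
  have h : rationalSubalgebra R ≤ Algebra.adjoin ℚ (pureTensors (Env R)) := by
    refine iSup_le fun i => ?_
    rintro _ ⟨x, rfl⟩
    exact Algebra.subset_adjoin (singleAlgHom_mem_pureTensors i x)
  intro x hx
  have h2 := h hx
  rw [← Subalgebra.mem_toSubmodule, Algebra.adjoin_eq_span, Submonoid.closure_eq] at h2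
  exact h2

theorem IsLieFamily.bracket {t : ℕ → RatExt R →ₗ[ℚ] B} (H : IsLieFamily t) (i : ℕ+)
    (x y : RatExt R) : t i (x * y - y * x) = t i x * t i y - t i y * t i x := by
  have := H i i i.ne_zero i.ne_zero x y
  rw [defect, if_pos rfl, sub_eq_zero] at this
  exact this.symm

theorem IsLieFamily.commute {t : ℕ → RatExt R →ₗ[ℚ] B} (H : IsLieFamily t) {i j : ℕ+} (h : i ≠ j)
    (x y : RatExt R) : Commute (t i x) (t j y) := by
  have := H i j i.ne_zero j.ne_zero x y
  rw [defect, if_neg (fun h2 => h (PNat.eq h2)), sub_zero, sub_eq_zero] at this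
  exact this

/-- The homomorphism from the restricted tensor product given by a Lie family. -/
def IsLieFamily.lift {t : ℕ → RatExt R →ₗ[ℚ] B} (H : IsLieFamily t) : GQ R →ₐ[ℚ] B :=
  AlgHom.ofLinearMap
    (restrictedLift (fun i : ℕ+ => envLift (t i) (H.bracket i)) ∘ₗ
      (rationalSubalgebra R).val.toLinearMap)
    (restrictedLift_one _)
    (fun x y => restrictedLift_mul _ (fun _ _ hij => envLift_commute _ _ (H.commute hij))
      (rationalSubalgebra_le x.2) (rationalSubalgebra_le y.2))

theorem IsLieFamily.lift_T {t : ℕ → RatExt R →ₗ[ℚ] B} (H : IsLieFamily t) (i : ℕ+)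
    (x : RatExt R) : H.lift (T R i x) = t i x := by
  change restrictedLift _ (T R i x : ⨂[ℚ] _i : ℕ+, Env R) = _
  rw [coe_T, restrictedLift_single, envLift_toEnv]

theorem IsLieFamily.lift_tau {t : ℕ → RatExt R →ₗ[ℚ] B} (H : IsLieFamily t) {n : ℕ} (hn : n ≠ 0) :
    H.lift.toLinearMap ∘ₗ tau R n = t n := by
  refine LinearMap.ext fun x => ?_
  rw [LinearMap.comp_apply, tau_mk (Nat.pos_of_ne_zero hn)]
  exact H.lift_T ⟨n, Nat.pos_of_ne_zero hn⟩ x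

theorem eq_top_of_T_mem (S : Subalgebra ℚ (GQ R)) (h : ∀ i x, T R i x ∈ S) : S = ⊤ := by
  have h1 : rationalSubalgebra R ≤ S.map (rationalSubalgebra R).val := by
    refine iSup_le fun i => ?_
    rintro _ ⟨x, rfl⟩
    have := env_mem_of_toEnv_mem ((S.map (rationalSubalgebra R).val).comap
      (PiTensorProduct.singleAlgHom (R := ℚ) (A := fun _ : ℕ+ => Env R) i))
      (fun a => ⟨T R i a, h i a, coe_T R i a⟩) x
    exact this
  refine Algebra.eq_top_iff.2 fun x => ?_
  obtain ⟨y, hy, hxy⟩ := h1 x.2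
  have : y = x := Subtype.ext hxy
  rwa [← this]

end Lift

/-! ### The presentation by generators and relations -/

section Presentation

variable {R : Type*} [Ring R] {I : Type*} (b : Module.Basis I ℤ R)

theorem constantCoeff_freeSeries (u : I) : PowerSeries.constantCoeff (freeSeries u) = 1 := by
  rw [← PowerSeries.coeff_zero_eq_constantCoeff_apply, freeSeries, PowerSeries.coeff_mk,
    dif_neg (lt_irrefl 0)]

theorem coeff_freeSeries (u : I) (r : ℕ+) :
    PowerSeries.coeff r (freeSeries u) = FreeAlgebra.ι ℚ (u, r) := by
  rw [freeSeries, PowerSeries.coeff_mk, dif_pos r.pos]; rfl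

/-- The homomorphism from the free algebra to `G_∞^ℚ(R)`. -/
def freeToGQ : Free I →ₐ[ℚ] GQ R := FreeAlgebra.lift ℚ fun p => e p.2 (b p.1)

theorem map_freeToGQ_freeSeries (u : I) :
    PowerSeries.map (freeToGQ b : Free I →+* GQ R) (freeSeries u) = E (b u) := by
  refine PowerSeries.ext fun n => ?_
  rw [PowerSeries.coeff_map, freeSeries, PowerSeries.coeff_mk]
  split_ifs with h
  · exact FreeAlgebra.lift_ι_apply _ _
  · have : n = 0 := by omega
    subst this
    rw [map_one, PowerSeries.coeff_zero_eq_constantCoeff_apply,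
      isLieExpFamily_E.constantCoeff_eq]

variable {b} {𝓔 : R → PowerSeries (Free I)}

/-- The image family satisfies (2), being again attached to linear maps, and agrees with `E` on the
basis; uniqueness does the rest. -/
theorem map_freeToGQ (h : IsSymbolFamily b 𝓔) :
    (fun W => PowerSeries.map (freeToGQ b : Free I →+* GQ R) (𝓔 W)) = E := by
  obtain ⟨t, ht⟩ := exists_isLieExpFamily b h.1 h.2.2
  have ht' := ht.map (freeToGQ b)
  refine sumRelation_unique b ht'.constantCoeff_eq isLieExpFamily_E.constantCoeff_eq ?_
    (ht'.sumRelation b) (isLieExpFamily_E.sumRelation b)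
  intro u
  rw [h.2.1, map_freeToGQ_freeSeries]

theorem freeToGQ_rel (h : IsSymbolFamily b 𝓔) ⦃x y : Free I⦄ (hxy : CommutationRel b 𝓔 x y) :
    freeToGQ b x = freeToGQ b y := by
  obtain ⟨u, v, m⟩ := hxy
  have hE : ∀ W, PowerSeries.map (freeToGQ b : Free I →+* GQ R) (𝓔 W) = E W :=
    congrFun (map_freeToGQ h)
  have h1 := congrArg (coeff m) (map_tripleSeries (freeToGQ b : Free I →+* GQ R)
    (F := 𝓔 (b u)) (H := 𝓔 (b v)) (h.1 (b v * b u)))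
  have h2 := congrArg (coeff m) (map_tripleSeriesRev (freeToGQ b : Free I →+* GQ R)
    (F := 𝓔 (b u)) (H := 𝓔 (b v)) (h.1 (b u * b v)))
  rw [coeff_map, hE, hE, hE] at h1 h2
  refine h1.trans (Eq.trans ?_ h2.symm)
  rw [isLieExpFamily_E.triple (isLieFamily_tau R)]

/-- A homomorphism backwards exists once the linear maps attached to the family in the quotient
satisfy the Lie relations. The two compositions are then checked on the elements `T_l(x)` and on the
symbols. -/
theorem exists_presentation (h : IsSymbolFamily b 𝓔) :
    ∃ φ : RingQuot (CommutationRel b 𝓔) ≃ₐ[ℚ] GQ R,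
      (∀ (u : I) (r : ℕ+),
        φ (RingQuot.mkAlgHom ℚ (CommutationRel b 𝓔) (FreeAlgebra.ι ℚ (u, r))) = e r (b u)) ∧
      ∀ (W : R) (r : ℕ),
        φ (RingQuot.mkAlgHom ℚ (CommutationRel b 𝓔) (PowerSeries.coeff r (𝓔 W))) = e r W := by
  set π := RingQuot.mkAlgHom ℚ (CommutationRel b 𝓔) with hπ
  obtain ⟨t₀, ht₀⟩ := exists_isLieExpFamily b h.1 h.2.2
  have hQ := ht₀.map π
  set t := fun n => π.toLinearMap ∘ₗ t₀ n with ht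
  -- The imposed relations are the first relations for basis elements, which suffice for the Lie
  -- relations.
  have hL : IsLieFamily t := hQ.isLieFamily b fun u v => by
    rw [← map_tripleSeries _ (h.1 _), ← map_tripleSeriesRev _ (h.1 _)]
    refine MvPowerSeries.ext fun m => ?_
    rw [coeff_map, coeff_map]
    exact RingQuot.mkAlgHom_rel ℚ (CommutationRel.mk u v m)
  let φ : RingQuot (CommutationRel b 𝓔) →ₐ[ℚ] GQ R :=
    RingQuot.liftAlgHom ℚ ⟨freeToGQ b, freeToGQ_rel h⟩
  have hφπ : ∀ x, φ (π x) = freeToGQ b x := fun x =>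
    RingQuot.liftAlgHom_mkAlgHom_apply ℚ (freeToGQ b) (freeToGQ_rel h) x
  have hφE : ∀ (W : R) (r : ℕ), φ (π (PowerSeries.coeff r (𝓔 W))) = e r W := fun W r => by
    rw [hφπ, e, ← congrFun (map_freeToGQ h) W, PowerSeries.coeff_map]
    rfl
  have hfam : (fun W => PowerSeries.map (φ : RingQuot (CommutationRel b 𝓔) →+* GQ R)
      (PowerSeries.map (π : Free I →+* RingQuot (CommutationRel b 𝓔)) (𝓔 W))) = E := by
    ext1 W
    refine PowerSeries.ext fun r => ?_
    rw [PowerSeries.coeff_map, PowerSeries.coeff_map]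
    exact hφE W r
  -- A family determines its linear maps, so `φ` carries those of the quotient to the `T_n`.
  have hφt : ∀ n, n ≠ 0 → ∀ x, φ (t n x) = tau R n x := fun n hn x => by
    have h1 := hQ.map φ
    rw [hfam] at h1
    exact LinearMap.congr_fun (h1.unique_left isLieExpFamily_E hn) x
  -- Conversely, linear maps determine their family, so the lift carries `E` to the family in the
  -- quotient.
  have hψE : (fun W => PowerSeries.map (hL.lift : GQ R →+* RingQuot (CommutationRel b 𝓔)) (E W)) =
      fun W => PowerSeries.map (π : Free I →+* RingQuot (CommutationRel b 𝓔)) (𝓔 W) :=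
    ((isLieExpFamily_E.map hL.lift).congr fun n hn => hL.lift_tau hn).unique hQ
  have h1 : φ.comp hL.lift = AlgHom.id ℚ _ := by
    have := eq_top_of_T_mem (AlgHom.equalizer (φ.comp hL.lift) (AlgHom.id ℚ _)) fun i x => by
      rw [AlgHom.mem_equalizer, AlgHom.comp_apply, hL.lift_T, hφt _ i.ne_zero, tau_mk i.pos]
      rfl
    refine AlgHom.ext fun x => ?_
    have h2 : x ∈ AlgHom.equalizer (φ.comp hL.lift) (AlgHom.id ℚ _) := this ▸ Algebra.mem_top
    exact h2
  have h2 : hL.lift.comp φ = AlgHom.id ℚ _ := by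
    refine RingQuot.ringQuot_ext' ℚ _ _ (FreeAlgebra.hom_ext (funext fun p => ?_))
    change hL.lift (φ (π (FreeAlgebra.ι ℚ p))) = π (FreeAlgebra.ι ℚ p)
    obtain ⟨u, r⟩ := p
    rw [← coeff_freeSeries, ← h.2.1, hφE, e]
    have := congrArg (PowerSeries.coeff r) (congrFun hψE (b u))
    simp only [PowerSeries.coeff_map] at this
    exact this
  refine ⟨AlgEquiv.ofAlgHom φ hL.lift h1 h2, fun u r => ?_, hφE⟩
  change φ (π _) = _
  rw [← coeff_freeSeries, ← h.2.1, hφE]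

theorem exists_isSymbolFamily (b : Module.Basis I ℤ R) : ∃ 𝓔 : R → PowerSeries (Free I),
    IsSymbolFamily b 𝓔 ∧ ∀ 𝓔', IsSymbolFamily b 𝓔' → 𝓔' = 𝓔 := by
  obtain ⟨𝓔, h⟩ := exists_sumRelation b (freeSeries : I → PowerSeries (Free I))
    constantCoeff_freeSeries
  exact ⟨𝓔, h, fun 𝓔' h' => sumRelation_unique b h'.1 h.1
    (fun u => (h'.2.1 u).trans (h.2.1 u).symm) h'.2.2 h.2.2⟩

end Presentation


/-! ### Exponentials of series over `R` -/

section IntegralExponential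

variable {R : Type*} [Ring R] {σ τ : Type*}

theorem map_subst {A B : Type*} [Ring A] [Ring B] (φ : A →+* B) (S : MonomialSubst σ τ)
    (f : MvPowerSeries σ A) :
    MvPowerSeries.map φ (S.subst f) = S.subst (MvPowerSeries.map φ f) := by
  ext n
  rw [coeff_map, MonomialSubst.coeff_subst, MonomialSubst.coeff_subst, map_sum]
  exact Finset.sum_congr rfl fun m _ => by rw [map_zsmul, coeff_map]

/-- The series `∏_l Θ_l(x(t^l))` for a series `x` over `R`. -/
def intExp (x : MvPowerSeries σ R) : MvPowerSeries σ (GQ R) :=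
  lieExp (tau R) (MvPowerSeries.map (toRatExt R) x)

theorem constantCoeff_intExp (x : MvPowerSeries σ R) : constantCoeff (intExp x) = 1 :=
  constantCoeff_lieExp _

theorem intExp_one : intExp (1 : MvPowerSeries σ R) = 1 := by
  rw [intExp, map_one, lieExp_one]

theorem intExp_mul {x y : MvPowerSeries σ R} (hx : constantCoeff x = 1)
    (hy : constantCoeff y = 1) : intExp (x * y) = intExp x * intExp y := by
  rw [intExp, map_mul, (isLieFamily_tau R).lieExp_mul]
  · rfl
  · rw [constantCoeff_map, hx, map_one]
  · rw [constantCoeff_map, hy, map_one]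

theorem intExp_seriesInv {x : MvPowerSeries σ R} (hx : constantCoeff x = 1) :
    intExp (seriesInv x) = seriesInv (intExp x) := by
  symm
  refine seriesInv_eq (constantCoeff_intExp x) ?_
  rw [← intExp_mul hx (constantCoeff_seriesInv x), mul_seriesInv hx, intExp_one]

theorem Cong.intExp {P : Set (σ →₀ ℕ)} (hP : IsLowerSet P) {x y : MvPowerSeries σ R}
    (h : Cong P x y) : Cong P (intExp x) (intExp y) :=
  Cong.lieExp hP fun m hm => by rw [coeff_map, coeff_map, h m hm]

theorem subst_intExp (S : MonomialSubst σ τ)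
    (hS : ∀ i, i ≠ 0 → ∀ m, S.weight (i • m) = S.weight m) {x : MvPowerSeries σ R}
    (hx : constantCoeff x = 1) : S.subst (intExp x) = intExp (S.subst x) := by
  rw [intExp, subst_lieExp S hS (by rw [constantCoeff_map, hx, map_one]), intExp, map_subst]

/-- For `W` in the basis this is the source of integrality: up to sign, the coefficients are
generators `e_r(W)`, or `0` and `1`. -/
theorem intExp_one_sub_monomial {d : σ →₀ ℕ} (hd : d ≠ 0) (W : R) :
    intExp (1 - monomial d W) = substMonomial (E W) (-1) d := by
  rw [isLieExpFamily_E.substMonomial_eq W hd, intExp, map_sub, map_one, map_monomial]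

end IntegralExponential

/-! ### Exponentials of integral series lie in the generated subalgebra -/

section CoefficientsInAdjoin

variable {R : Type*} [Ring R] {σ : Type*} {C : Subalgebra ℤ (GQ R)} {P : Set (σ →₀ ℕ)}

/-- The coefficients of `f` at the monomials in `P` belong to `C`. -/
def CoeffsIn (C : Subalgebra ℤ (GQ R)) (P : Set (σ →₀ ℕ)) (f : MvPowerSeries σ (GQ R)) : Prop :=
  ∀ m ∈ P, coeff m f ∈ C

theorem CoeffsIn.mul (hP : IsLowerSet P) {f g : MvPowerSeries σ (GQ R)} (hf : CoeffsIn C P f)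
    (hg : CoeffsIn C P g) : CoeffsIn C P (f * g) := fun m hm => by
  classical
  rw [coeff_mul]
  exact sum_mem fun p hp => mul_mem (hf _ (hP (HasAntidiagonal.antidiagonal.fst_le hp) hm))
    (hg _ (hP (HasAntidiagonal.antidiagonal.snd_le hp) hm))

theorem CoeffsIn.seriesInv (hP : IsLowerSet P) {f : MvPowerSeries σ (GQ R)}
    (hf : CoeffsIn C P f) : CoeffsIn C P (seriesInv f) := fun m => by
  classical
  induction m using WellFoundedLT.induction with
  | _ m ih =>
    intro hm
    rw [WreathGrothendieck.seriesInv, coeff_invOfUnit]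
    split_ifs
    · rw [inv_one, Units.val_one]; exact one_mem C
    · refine C.mul_mem (C.neg_mem (by rw [inv_one, Units.val_one]; exact C.one_mem))
        (C.sum_mem fun p hp => ?_)
      split_ifs with h
      · exact mul_mem (hf _ (hP (HasAntidiagonal.antidiagonal.fst_le hp) hm)) (ih _ h (hP h.le hm))
      · exact zero_mem C

/-- The series with constant term `1` whose exponential has coefficients in `C`. -/
def ExpIn (C : Subalgebra ℤ (GQ R)) (P : Set (σ →₀ ℕ)) (x : MvPowerSeries σ R) : Prop :=
  constantCoeff x = 1 ∧ CoeffsIn C P (intExp x)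

theorem expIn_one : ExpIn C P (1 : MvPowerSeries σ R) := by
  classical
  refine ⟨map_one _, fun m _ => ?_⟩
  rw [intExp_one, coeff_one]
  split_ifs
  · exact one_mem C
  · exact zero_mem C

theorem ExpIn.mul (hP : IsLowerSet P) {x y : MvPowerSeries σ R} (hx : ExpIn C P x)
    (hy : ExpIn C P y) : ExpIn C P (x * y) :=
  ⟨by rw [map_mul, hx.1, hy.1, mul_one], by rw [intExp_mul hx.1 hy.1]; exact hx.2.mul hP hy.2⟩

theorem ExpIn.seriesInv (hP : IsLowerSet P) {x : MvPowerSeries σ R} (hx : ExpIn C P x) :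
    ExpIn C P (seriesInv x) :=
  ⟨constantCoeff_seriesInv x, by rw [intExp_seriesInv hx.1]; exact hx.2.seriesInv hP⟩

theorem ExpIn.congr (hP : IsLowerSet P) {x y : MvPowerSeries σ R} (hx : ExpIn C P x)
    (hy : constantCoeff y = 1) (h : Cong P x y) : ExpIn C P y :=
  ⟨hy, fun m hm => (h.intExp hP m hm) ▸ hx.2 m hm⟩

theorem constantCoeff_one_add {d : ℕ} {f : MvPowerSeries σ R} (hf : OrdGE (d + 1) f) :
    constantCoeff (1 + f) = 1 := by
  rw [map_add, map_one, ordGE_one_iff.1 (hf.mono (by omega)), add_zero]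

/-- The additive group of the series `f` of order at least `d + 1` such that the exponential of
`1 + f` has coefficients in `C`, under the hypothesis that it contains all series of order at least
`d + 2`. -/
def expSubgroup (C : Subalgebra ℤ (GQ R)) (hP : IsLowerSet P) (d : ℕ)
    (H : ∀ f : MvPowerSeries σ R, OrdGE (d + 2) f → ExpIn C P (1 + f)) :
    AddSubgroup (MvPowerSeries σ R) where
  carrier := {f | OrdGE (d + 1) f ∧ ExpIn C P (1 + f)}
  zero_mem' := ⟨ordGE_zero _, by rw [add_zero]; exact expIn_one⟩
  add_mem' := by
    rintro f g ⟨hf, hf'⟩ ⟨hg, hg'⟩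
    refine ⟨hf.add hg, ?_⟩
    have hxy := hf'.mul hP hg'
    -- The product `(1 + f)(1 + g)` exceeds `1 + f + g` by `fg`, of order at least `2d + 2 ≥ d + 2`,
    -- so the correcting factor is covered by `H`.
    have h1 : ExpIn C P (1 + seriesInv ((1 + f) * (1 + g)) * -(f * g)) :=
      H _ (((hf.mul hg).mono (by omega)).neg.mul_left _)
    have h2 : 1 + (f + g) = (1 + f) * (1 + g) *
        (1 + seriesInv ((1 + f) * (1 + g)) * -(f * g)) := by
      rw [mul_add ((1 + f) * (1 + g)), ← mul_assoc, mul_seriesInv hxy.1]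
      noncomm_ring
    rw [h2]
    exact hxy.mul hP h1
  neg_mem' := by
    rintro f ⟨hf, hf'⟩
    refine ⟨hf.neg, ?_⟩
    have h1 : ExpIn C P (1 + -(f * f)) := H _ ((hf.mul hf).mono (by omega)).neg
    have h2 : 1 + -f = seriesInv (1 + f) * (1 + -(f * f)) := by
      have : 1 + -(f * f) = (1 + f) * (1 + -f) := by noncomm_ring
      rw [this, ← mul_assoc, seriesInv_mul hf'.1, one_mul]
    rw [h2]
    exact (hf'.seriesInv hP).mul hP h1

variable {I : Type*} (b : Module.Basis I ℤ R)

theorem monomial_mem_of_basis (V : AddSubgroup (MvPowerSeries σ R)) (d : σ →₀ ℕ)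
    (h : ∀ u, monomial d (b u) ∈ V) (W : R) : monomial d W ∈ V := by
  let g : R →+ MvPowerSeries σ R := (monomial d : R →ₗ[R] MvPowerSeries σ R).toAddMonoidHom
  have h1 : Submodule.span ℤ (Set.range b) ≤ AddSubgroup.toIntSubmodule (V.comap g) := by
    rw [Submodule.span_le]
    rintro _ ⟨u, rfl⟩
    exact h u
  rw [b.span_eq] at h1
  exact h1 (Submodule.mem_top (x := W))

/-- The `ℤ`-subalgebra generated by the `e_r(u)`. -/
abbrev genSubalgebra : Subalgebra ℤ (GQ R) :=
  Algebra.adjoin ℤ {x : GQ R | ∃ (u : I) (r : ℕ+), x = e r (b u)}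

theorem e_mem_genSubalgebra (u : I) (n : ℕ) : PowerSeries.coeff n (E (b u)) ∈ genSubalgebra b := by
  rcases Nat.eq_zero_or_pos n with rfl | h
  · rw [PowerSeries.coeff_zero_eq_constantCoeff_apply, isLieExpFamily_E.constantCoeff_eq]
    exact one_mem _
  · exact Algebra.subset_adjoin ⟨u, ⟨n, h⟩, rfl⟩

theorem coeff_substMonomial_mem (u : I) (d m : σ →₀ ℕ) :
    coeff m (substMonomial (E (b u)) (-1) d) ∈ genSubalgebra b := by
  rw [substMonomial, coeff_ofCoeff]
  refine sum_mem fun n _ => ?_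
  split_ifs
  · exact zsmul_mem (e_mem_genSubalgebra b u n) _
  · exact zero_mem _

/-- Descending induction on the order `d + 1`. Above the degree of `m₀` the series is invisible.
Otherwise admissible `f` form an additive group containing all series of higher order, so it
suffices to treat basis monomials of degree `d + 1`. -/
theorem expIn_of_ordGE (m₀ : σ →₀ ℕ) (k : ℕ) : ∀ d, d + k = m₀.degree →
    ∀ f : MvPowerSeries σ R, OrdGE (d + 1) f → ExpIn (genSubalgebra b) (Set.Iic m₀) (1 + f) := by
  classical
  have hP : IsLowerSet (Set.Iic m₀) := isLowerSet_Iic m₀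
  induction k with
  | zero =>
    intro d hd f hf
    refine expIn_one.congr hP (constantCoeff_one_add hf) fun m hm => ?_
    rw [map_add, hf m, add_zero]
    have : m.degree ≤ m₀.degree := Finsupp.degree_mono hm
    omega
  | succ k ih =>
    intro d hd f hf
    have H := ih (d + 1) (by omega)
    set V := expSubgroup (genSubalgebra b) hP d H with hV
    have hmon : ∀ m : σ →₀ ℕ, m.degree = d + 1 → ∀ W, monomial m W ∈ V := by
      intro m hm W
      refine monomial_mem_of_basis b V m (fun u => ?_) W
      -- Passing to the negative gives `1 - x^m u`, whose exponential is `E_u(-x^m)`.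
      rw [← neg_mem_iff, ← map_neg]
      refine ⟨?_, ?_⟩
      · exact ordGE_monomial hm.ge _
      · have hm0 : m ≠ 0 := by rintro rfl; simp at hm
        rw [map_neg, ← sub_eq_add_neg]
        refine ⟨constantCoeff_one_sub_monomial hm0 _, fun n _ => ?_⟩
        rw [intExp_one_sub_monomial hm0]
        exact coeff_substMonomial_mem b u m n
    set g : MvPowerSeries σ R := ofCoeff fun m => if d + 2 ≤ m.degree then coeff m f else 0 with hg
    have hgV : g ∈ V := by
      have : OrdGE (d + 2) g := fun m hm => by
        rw [hg, coeff_ofCoeff, if_neg (by omega)]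
      exact ⟨this.mono (by omega), H g this⟩
    set s := (Finset.Iic m₀).filter fun m => m.degree = d + 1 with hs
    have hsum : ∑ m ∈ s, monomial m (coeff m f) ∈ V :=
      sum_mem fun m hm => hmon m (Finset.mem_filter.1 hm).2 _
    have hall := add_mem hsum hgV
    refine hall.2.congr hP (constantCoeff_one_add hf) ((Cong.refl 1).add fun m hm => ?_)
    rw [map_add, map_sum]
    simp only [coeff_monomial]
    rw [Finset.sum_ite_eq, hg, coeff_ofCoeff]
    by_cases h1 : m.degree = d + 1
    · rw [if_pos (show m ∈ s from Finset.mem_filter.2 ⟨Finset.mem_Iic.2 hm, h1⟩),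
        if_neg (by omega), add_zero]
    · rw [if_neg (fun h : m ∈ s => h1 (Finset.mem_filter.1 h).2), zero_add]
      split_ifs with h2
      · rfl
      · rw [hf m (by omega)]

/-- The coefficients of the exponential of an integral series belong to the subalgebra generated by
the `e_r(u)`. -/
theorem coeff_intExp_mem_genSubalgebra {x : MvPowerSeries σ R} (hx : constantCoeff x = 1)
    (m : σ →₀ ℕ) : coeff m (intExp x) ∈ genSubalgebra b := by
  have h := expIn_of_ordGE b m m.degree 0 (zero_add _) (x - 1)
    (by rw [zero_add, ordGE_one_iff, map_sub, hx, map_one, sub_self])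
  rw [add_sub_cancel] at h
  exact h.2 m (Set.mem_Iic.2 le_rfl)

end CoefficientsInAdjoin

/-! ### Linear series and substitution of monomials for variables -/

section MonomialSubstitutions

variable {κ σ : Type*}

/-- The substitution which replaces the variables by given monomials. -/
def monomialSubst (d : κ → σ →₀ ℕ) (hd : ∀ k, d k ≠ 0) (hfin : ∀ n, {k | d k ≤ n}.Finite) :
    MonomialSubst κ σ where
  exponent := Finsupp.liftAddHom fun k => (multiplesHom (σ →₀ ℕ)) (d k)
  weight _ := 1
  weight_zero := rfl
  weight_add _ _ := rfl
  degree_le m := by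
    rw [Finsupp.liftAddHom_apply, Finsupp.sum, map_sum, Finsupp.degree_apply]
    refine Finset.sum_le_sum fun k _ => ?_
    rw [multiplesHom_apply, map_nsmul]
    exact Nat.le_mul_of_pos_right _ (Nat.pos_of_ne_zero fun h =>
      hd k ((Finsupp.degree_eq_zero_iff _).1 h))
  finite n := by
    classical
    refine (Set.finite_Iic (∑ k ∈ (hfin n).toFinset, Finsupp.single k n.degree)).subset ?_
    rintro m rfl k
    set n := (Finsupp.liftAddHom fun k => (multiplesHom (σ →₀ ℕ)) (d k)) m with hn
    by_cases hk : m k = 0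
    · rw [hk]; exact Nat.zero_le _
    · have h1 : m k • d k ≤ n := by
        rw [hn, Finsupp.liftAddHom_apply, Finsupp.sum]
        exact Finset.single_le_sum (f := fun k => (multiplesHom (σ →₀ ℕ)) (d k) (m k))
          (fun _ _ => zero_le) (Finsupp.mem_support_iff.2 hk)
      have h2 : d k ≤ n := le_trans (le_self_nsmul (zero_le) hk) h1
      have h3 : m k ≤ n.degree := by
        refine le_trans ?_ (Finsupp.degree_mono h1)
        rw [map_nsmul]
        exact Nat.le_mul_of_pos_right _ (Nat.pos_of_ne_zero fun h =>
          hd k ((Finsupp.degree_eq_zero_iff _).1 h))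
      rw [Finsupp.finsetSum_apply]
      refine h3.trans ?_
      refine le_trans (le_of_eq ?_) (Finset.single_le_sum (f := fun i => Finsupp.single i n.degree k)
        (fun _ _ => Nat.zero_le _) ((hfin n).mem_toFinset.2 h2))
      simp

variable {d : κ → σ →₀ ℕ} (hd : ∀ k, d k ≠ 0) (hfin : ∀ n, {k | d k ≤ n}.Finite)

theorem monomialSubst_exponent (m : κ →₀ ℕ) :
    (monomialSubst d hd hfin).exponent m = m.sum fun k a => a • d k := rfl

theorem monomialSubst_exponent_single (k : κ) (a : ℕ) :
    (monomialSubst d hd hfin).exponent (Finsupp.single k a) = a • d k := by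
  rw [monomialSubst_exponent, Finsupp.sum_single_index (zero_smul ℕ (d k))]

theorem monomialSubst_weight (m : κ →₀ ℕ) : (monomialSubst d hd hfin).weight m = 1 := rfl

variable {A : Type*} [Ring A]

theorem coeff_subst_of_injective (S : MonomialSubst κ σ) (hS : Function.Injective S.exponent)
    (hw : ∀ m, S.weight m = 1) (f : MvPowerSeries κ A) (m : κ →₀ ℕ) :
    coeff (S.exponent m) (S.subst f) = coeff m f := by
  rw [S.coeff_subst, Finset.sum_eq_single m, hw, one_smul]
  · intro m' hm' hne
    exact absurd (hS (S.mem_fiber.1 hm')) hne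
  · intro h
    exact absurd (S.mem_fiber.2 rfl) h

/-- The linear series `∑_k c_k y_k`. -/
def linSeries (c : σ → A) : MvPowerSeries σ A :=
  open Classical in
  ofCoeff fun m => ∑ p ∈ m.support, if m = Finsupp.single p 1 then c p else 0

theorem coeff_linSeries_single (c : σ → A) (p : σ) :
    coeff (Finsupp.single p 1) (linSeries c) = c p := by
  classical
  rw [linSeries, coeff_ofCoeff, Finsupp.support_single _ one_ne_zero, sum_singleton, if_pos rfl]

theorem coeff_linSeries_of_forall_ne (c : σ → A) {m : σ →₀ ℕ}
    (h : ∀ p, m ≠ Finsupp.single p 1) : coeff m (linSeries c) = 0 := by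
  classical
  rw [linSeries, coeff_ofCoeff]
  exact Finset.sum_eq_zero fun p _ => if_neg (h p)

theorem constantCoeff_one_add_linSeries (c : σ → A) : constantCoeff (1 + linSeries c) = 1 := by
  rw [map_add, map_one, ← coeff_zero_eq_constantCoeff_apply, coeff_linSeries_of_forall_ne, add_zero]
  intro p h
  have := congrArg (fun z => z p) h
  simp at this

theorem linSeries_ext {c : σ → A} {f : MvPowerSeries σ A} {P : Set (σ →₀ ℕ)}
    (h1 : ∀ p, Finsupp.single p 1 ∈ P → c p = coeff (Finsupp.single p 1) f)
    (h2 : ∀ m ∈ P, (∀ p, m ≠ Finsupp.single p 1) → coeff m f = 0) : Cong P (linSeries c) f := by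
  intro m hm
  by_cases h : ∃ p, m = Finsupp.single p 1
  · obtain ⟨p, rfl⟩ := h
    rw [coeff_linSeries_single, h1 p hm]
  · push Not at h
    rw [coeff_linSeries_of_forall_ne c h, h2 m hm h]

theorem linSeries_congr {c c' : σ → A} {P : Set (σ →₀ ℕ)}
    (h : ∀ p, Finsupp.single p 1 ∈ P → c p = c' p) : Cong P (linSeries c) (linSeries c') :=
  linSeries_ext (fun p hp => by rw [coeff_linSeries_single, h p hp])
    fun _ _ hm => coeff_linSeries_of_forall_ne _ hm

theorem coeff_subst_linSeries (c : κ → A) (n : σ →₀ ℕ) (s : Finset κ)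
    (hs : ∀ k, k ∈ s ↔ d k = n) :
    coeff n ((monomialSubst d hd hfin).subst (linSeries c)) = ∑ k ∈ s, c k := by
  classical
  have hinj : Function.Injective fun k : κ => (Finsupp.single k 1 : κ →₀ ℕ) :=
    fun k k' h => (Finsupp.single_left_inj one_ne_zero).1 h
  rw [MonomialSubst.coeff_subst, ← Finset.sum_subset (s₁ := s.image fun k => Finsupp.single k 1),
    Finset.sum_image fun _ _ _ _ h => hinj h]
  · refine Finset.sum_congr rfl fun k _ => ?_
    rw [monomialSubst_weight, one_smul, coeff_linSeries_single]
  · intro m hm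
    obtain ⟨k, hk, rfl⟩ := Finset.mem_image.1 hm
    rw [MonomialSubst.mem_fiber, monomialSubst_exponent_single, one_smul, (hs k).1 hk]
  · intro m hm hm'
    rw [coeff_linSeries_of_forall_ne, smul_zero]
    rintro k rfl
    rw [MonomialSubst.mem_fiber, monomialSubst_exponent_single, one_smul] at hm
    exact hm' (Finset.mem_image_of_mem _ ((hs k).2 hm))

/-- The substitution `y_z ↦ 0`. -/
def killSubst (z : σ) : MonomialSubst σ σ where
  exponent := AddMonoidHom.id _
  weight m := 0 ^ m z
  weight_zero := by simp
  weight_add m n := by simp [pow_add]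
  degree_le m := le_rfl
  finite n := Set.Finite.subset (Set.finite_singleton n) fun _ h => h

theorem coeff_killSubst (z : σ) (f : MvPowerSeries σ A) (n : σ →₀ ℕ) :
    coeff n ((killSubst z).subst f) = (0 : ℤ) ^ n z • coeff n f := by
  rw [MonomialSubst.coeff_subst, Finset.sum_eq_single n]
  · rfl
  · intro m hm hne
    exact absurd ((killSubst z).mem_fiber.1 hm) hne
  · intro h
    exact absurd ((killSubst z).mem_fiber.2 rfl) h

variable {R : Type*} [Ring R]

/-- The linear series is unchanged by `y_z ↦ 0`, and so is its exponential; the weight `0 ^ m z` is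
compatible with powers, as `subst_intExp` requires. -/
theorem coeff_intExp_eq_zero {c : σ → R} {z : σ} (hz : c z = 0) {n : σ →₀ ℕ} (hn : n z ≠ 0) :
    coeff n (intExp (1 + linSeries c)) = 0 := by
  have h1 : (killSubst z).subst (1 + linSeries c) = 1 + linSeries c := by
    rw [map_add, map_one]
    congr 1
    ext m
    rw [coeff_killSubst]
    by_cases h : ∃ p, m = Finsupp.single p 1
    · obtain ⟨p, rfl⟩ := h
      rw [coeff_linSeries_single]
      by_cases hp : p = z
      · rw [hp, hz, smul_zero]
      · rw [Finsupp.single_eq_of_ne (Ne.symm hp), pow_zero, one_smul]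
    · push Not at h
      rw [coeff_linSeries_of_forall_ne c h, smul_zero]
  have h2 := subst_intExp (killSubst z) (fun i hi m => by
    change (0 : ℤ) ^ (i • m) z = 0 ^ m z
    rw [Finsupp.smul_apply, smul_eq_mul, mul_comm, pow_mul]
    rcases Nat.eq_zero_or_pos (m z) with h | h
    · rw [h, pow_zero, one_pow]
    · rw [zero_pow h.ne', zero_pow hi]) (constantCoeff_one_add_linSeries c)
  rw [h1] at h2
  rw [← h2, coeff_killSubst, zero_pow hn, zero_smul]

end MonomialSubstitutions


/-! ### The coefficient span of the generating function is the generated subalgebra -/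

section CoefficientSpan

variable {R : Type*} [Ring R] {I : Type*} (b : Module.Basis I ℤ R)

theorem map_linSeries_basis : MvPowerSeries.map (toRatExt R)
    (linSeries fun p : I × ℕ => b p.1) = powerSumSeries b 1 := by
  ext m
  rw [coeff_map]
  by_cases h : ∃ p, m = Finsupp.single p 1
  · obtain ⟨p, rfl⟩ := h
    rw [coeff_linSeries_single]
    exact (coeff_powerSumSeries_single b 1 p).symm
  · push Not at h
    rw [coeff_linSeries_of_forall_ne _ h, coeff_powerSumSeries_of_forall_ne b 1 h, map_zero]

theorem genFun_eq_intExp : genFun b = intExp (1 + linSeries fun p : I × ℕ => b p.1) := by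
  rw [genFun_eq, intExp, map_add, map_one, map_linSeries_basis]

/-- The `ℤ`-span of the coefficients of the generating function. -/
def coeffSpan : Submodule ℤ (GQ R) := Submodule.span ℤ (Set.range fun m => coeff m (genFun b))

theorem coeff_genFun_mem (m : I × ℕ →₀ ℕ) : coeff m (genFun b) ∈ coeffSpan b :=
  Submodule.subset_span ⟨m, rfl⟩

theorem one_mem_coeffSpan : (1 : GQ R) ∈ coeffSpan b := by
  have := coeff_genFun_mem b 0
  rwa [genFun_eq_intExp, coeff_zero_eq_constantCoeff_apply, constantCoeff_intExp] at this

theorem coeff_zero_intExp_mem {σ : Type*} (x : MvPowerSeries σ R) :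
    coeff 0 (intExp x) ∈ coeffSpan b := by
  rw [coeff_zero_eq_constantCoeff_apply, constantCoeff_intExp]
  exact one_mem_coeffSpan b

theorem Cong.one_add {A σ : Type*} [Ring A] {P : Set (σ →₀ ℕ)} {f g : MvPowerSeries σ A}
    (h : Cong P f g) : Cong P (1 + f) (1 + g) := (Cong.refl 1).add h

theorem finite_setOf_single_le {κ σ : Type*} {g : κ → σ} (hg : ∀ s, {k | g k = s}.Finite)
    (n : σ →₀ ℕ) : {k | Finsupp.single (g k) 1 ≤ n}.Finite := by
  classical
  refine (n.support.finite_toSet.biUnion (t := fun s => {k | g k = s}) fun s _ => hg s).subset ?_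
  intro k hk
  refine Set.mem_biUnion (x := g k) ?_ rfl
  have := Finsupp.single_le_iff.1 hk
  exact Finsupp.mem_support_iff.2 (by omega)

theorem monomialSubst_exponent_eq_mapDomain {κ σ : Type*} {g : κ → σ}
    (hd : ∀ k, (Finsupp.single (g k) 1 : σ →₀ ℕ) ≠ 0)
    (hfin : ∀ n : σ →₀ ℕ, {k | Finsupp.single (g k) 1 ≤ n}.Finite) (m : κ →₀ ℕ) :
    (monomialSubst (fun k => Finsupp.single (g k) 1) hd hfin).exponent m =
      Finsupp.mapDomain g m := by
  rw [monomialSubst_exponent, Finsupp.mapDomain]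
  exact Finsupp.sum_congr fun k _ => by rw [Finsupp.smul_single, smul_eq_mul, mul_one]

/-- If `y_k` has coefficient `b (u k)`, it may be renamed `x_{u k, k}`. The second index keeps the
variables distinct, and the generating function restricts to the given series on these variables. -/
theorem coeff_intExp_mem_of_pos {c : ℕ → R} {n : ℕ →₀ ℕ} (h : ∀ k ∈ n.support, ∃ u, c k = b u) :
    coeff n (intExp (1 + linSeries c)) ∈ coeffSpan b := by
  classical
  by_cases hn : n = 0
  · rw [hn]; exact coeff_zero_intExp_mem b _
  obtain ⟨k₀, hk₀⟩ := Finsupp.support_nonempty_iff.2 hn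
  obtain ⟨u₀, -⟩ := h k₀ hk₀
  have : ∃ u : ℕ → I, ∀ k ∈ n.support, c k = b (u k) := by
    refine ⟨fun k => if hk : k ∈ n.support then (h k hk).choose else u₀, fun k hk => ?_⟩
    simp only [dif_pos hk]
    exact (h k hk).choose_spec
  obtain ⟨u, hu⟩ := this
  set g : ℕ → I × ℕ := fun k => (u k, k) with hg
  have hinj : Function.Injective g := fun k k' h => congrArg Prod.snd h
  have hd : ∀ k, (Finsupp.single (g k) 1 : I × ℕ →₀ ℕ) ≠ 0 := fun k => by simp
  have hfin := finite_setOf_single_le (g := g)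
    fun s => Set.Subsingleton.finite fun k hk k' hk' => hinj (hk.trans hk'.symm)
  set S := monomialSubst (fun k => Finsupp.single (g k) 1) hd hfin with hS
  have hSinj : Function.Injective S.exponent := fun m m' h => by
    rw [hS, monomialSubst_exponent_eq_mapDomain, monomialSubst_exponent_eq_mapDomain] at h
    exact Finsupp.mapDomain_injective hinj h
  have h1 : coeff n (intExp (1 + linSeries c)) =
      coeff n (intExp (1 + linSeries fun k => b (u k))) := by
    refine Cong.intExp (isLowerSet_Iic n) (linSeries_congr fun k hk => hu k ?_).one_add n (Set.mem_Iic.2 le_rfl)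
    have := Finsupp.single_le_iff.1 hk
    exact Finsupp.mem_support_iff.2 (by omega)
  set P : Set (I × ℕ →₀ ℕ) := {m | ∀ p ∈ m.support, p ∈ Set.range g} with hP
  have hPl : IsLowerSet P := fun m m' hle hm p hp => hm p (Finsupp.support_mono hle hp)
  have h2 : Cong P (linSeries fun p : I × ℕ => b p.1)
      (S.subst (linSeries fun k => b (u k))) := by
    refine linSeries_ext (fun p hp => ?_) fun m hm hne => ?_
    · obtain ⟨k, rfl⟩ := hp p (by simp)
      rw [hS, coeff_subst_linSeries hd hfin _ _ {k}, sum_singleton]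
      intro k'
      rw [Finset.mem_singleton, Finsupp.single_left_inj one_ne_zero, hinj.eq_iff]
    · rw [hS, coeff_subst_linSeries hd hfin _ _ ∅, sum_empty]
      intro k'
      simpa using (hne (g k')).symm
  have h3 : S.exponent n ∈ P := by
    intro p hp
    rw [hS, monomialSubst_exponent_eq_mapDomain] at hp
    obtain ⟨k, -, rfl⟩ := Finset.mem_image.1 (Finsupp.mapDomain_support hp)
    exact ⟨k, rfl⟩
  rw [h1, ← coeff_subst_of_injective S hSinj (monomialSubst_weight hd hfin),
    subst_intExp S (fun _ _ _ => rfl) (constantCoeff_one_add_linSeries _), map_add, map_one,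
    ← h2.one_add.intExp hPl _ h3, ← genFun_eq_intExp]
  exact coeff_genFun_mem b _

open Classical in
/-- The total exponent of the variables whose coefficients are not basis elements. -/
def negDegree (c : ℕ → R) (n : ℕ →₀ ℕ) : ℕ :=
  ∑ k ∈ n.support, if ∃ u, c k = b u then 0 else n k

theorem negDegree_eq_sum [DecidablePred fun k : R => ∃ u, k = b u] (c : ℕ → R) (n : ℕ →₀ ℕ)
    {s : Finset ℕ} (hs : n.support ⊆ s) :
    negDegree b c n = ∑ k ∈ s, if ∃ u, c k = b u then 0 else n k := by
  rw [negDegree]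
  refine (Finset.sum_subset hs fun k _ hk => ?_).trans (Finset.sum_congr rfl fun k _ => ?_)
  · rw [Finsupp.notMem_support_iff.1 hk, ite_self]
  · congr

/-- The merging of the variable `w` into the variable `z`. -/
def mergeVar (w z : ℕ) : ℕ → ℕ := Function.update id w z

theorem mergeVar_self (w z : ℕ) : mergeVar w z w = z := Function.update_self ..

theorem mergeVar_of_ne {w z k : ℕ} (h : k ≠ w) : mergeVar w z k = k := Function.update_of_ne h ..

theorem finite_mergeVar (w z s : ℕ) : {k | mergeVar w z k = s}.Finite := by
  refine (Set.toFinite {w, s}).subset fun k hk => ?_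
  by_cases h : k = w
  · exact Or.inl h
  · exact Or.inr ((mergeVar_of_ne h).symm.trans hk)

theorem mapDomain_mergeVar {w z : ℕ} (m : ℕ →₀ ℕ) :
    Finsupp.mapDomain (mergeVar w z) m = m.erase w + Finsupp.single z (m w) := by
  conv_lhs => rw [← Finsupp.erase_add_single w m]
  rw [Finsupp.mapDomain_add, Finsupp.mapDomain_single, mergeVar_self]
  congr 1
  refine (Finsupp.mapDomain_congr fun k hk => ?_).trans Finsupp.mapDomain_id
  refine mergeVar_of_ne ?_
  rintro rfl
  simp at hk

/-- A variable `z` with coefficient `-b u` is paired with a fresh variable `w` with coefficient `b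
u`. Setting `w = z` cancels both, so the coefficients over a monomial containing `z` add up to zero.
All terms except the given one have moved part of the exponent of `z` to `w`, which lowers
`negDegree`. -/
theorem coeff_intExp_linSeries_mem (N : ℕ) : ∀ (c : ℕ → R) (n : ℕ →₀ ℕ),
    (∀ k ∈ n.support, c k = 0 ∨ ∃ u, c k = b u ∨ c k = -b u) → negDegree b c n = N →
      coeff n (intExp (1 + linSeries c)) ∈ coeffSpan b := by
  classical
  induction N using Nat.strong_induction_on with
  | _ N ih =>
    rintro c n h rfl
    by_cases h0 : ∃ k ∈ n.support, c k = 0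
    · obtain ⟨k, hk, hk0⟩ := h0
      rw [coeff_intExp_eq_zero hk0 (Finsupp.mem_support_iff.1 hk)]
      exact zero_mem _
    by_cases hpos : ∀ k ∈ n.support, ∃ u, c k = b u
    · exact coeff_intExp_mem_of_pos b hpos
    push Not at h0 hpos
    obtain ⟨z, hz, hzpos⟩ := hpos
    obtain ⟨u, hu⟩ := (h z hz).resolve_left (h0 z hz)
    replace hu := hu.resolve_left (hzpos u)
    obtain ⟨w, hw⟩ := Infinite.exists_notMem_finset n.support
    have hwz : z ≠ w := by rintro rfl; exact hw hz
    have hnw : n w = 0 := Finsupp.notMem_support_iff.1 hw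
    set c' := Function.update c w (b u) with hc'
    have hc'w : c' w = b u := Function.update_self ..
    have hc'k : ∀ k, k ≠ w → c' k = c k := fun k hk => Function.update_of_ne hk ..
    have hd : ∀ k, (Finsupp.single (mergeVar w z k) 1 : ℕ →₀ ℕ) ≠ 0 := fun k => by simp
    have hfin := finite_setOf_single_le (g := mergeVar w z) (finite_mergeVar w z)
    set S := monomialSubst (fun k => Finsupp.single (mergeVar w z k) 1) hd hfin with hS
    have hexp : ∀ m, S.exponent m = m.erase w + Finsupp.single z (m w) := fun m => by
      rw [hS, monomialSubst_exponent_eq_mapDomain, mapDomain_mergeVar]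
    have h1 : coeff n (intExp (1 + linSeries c)) = coeff n (intExp (1 + linSeries c')) := by
      refine Cong.intExp (isLowerSet_Iic n) (linSeries_congr fun k hk => ?_).one_add n (Set.mem_Iic.2 le_rfl)
      have := Finsupp.single_le_iff.1 hk
      refine (hc'k k ?_).symm
      rintro rfl
      omega
    have h2 : S.subst (linSeries c') = linSeries fun k => if k = z ∨ k = w then 0 else c k := by
      refine cong_univ.1 (Cong.symm (linSeries_ext (fun k _ => ?_) fun m _ hm => ?_))
      · by_cases hkz : k = z
        · subst hkz
          rw [if_pos (Or.inl rfl), hS, coeff_subst_linSeries hd hfin _ _ {k, w},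
            Finset.sum_pair hwz, hc'w, hc'k _ hwz, hu, neg_add_cancel]
          intro j
          rw [Finset.mem_insert, Finset.mem_singleton, Finsupp.single_left_inj one_ne_zero]
          by_cases hj : j = w
          · rw [hj, mergeVar_self]; simp
          · rw [mergeVar_of_ne hj]; simp [hj]
        · by_cases hkw : k = w
          · rw [if_pos (Or.inr hkw), hS, coeff_subst_linSeries hd hfin _ _ ∅, sum_empty]
            intro j
            rw [Finsupp.single_left_inj one_ne_zero, hkw]
            by_cases hj : j = w
            · rw [hj, mergeVar_self]; simpa using hwz
            · rw [mergeVar_of_ne hj]; simpa using hj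
          · rw [if_neg (by tauto), hS, coeff_subst_linSeries hd hfin _ _ {k}, sum_singleton,
              hc'k k hkw]
            intro j
            rw [Finset.mem_singleton, Finsupp.single_left_inj one_ne_zero]
            by_cases hj : j = w
            · rw [hj, mergeVar_self]
              exact ⟨fun e => absurd e.symm hkw, fun e => absurd e.symm hkz⟩
            · rw [mergeVar_of_ne hj]
      · rw [hS, coeff_subst_linSeries hd hfin _ _ ∅, sum_empty]
        intro j
        simpa using (hm (mergeVar w z j)).symm
    -- After the merging the coefficient at `z` is zero, so the merged exponential has no monomial
    -- involving `z`; this yields the linear relation among coefficients.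
    have h3 := congrArg (coeff n) (subst_intExp S (fun _ _ _ => rfl)
      (constantCoeff_one_add_linSeries c'))
    have hz0 : (fun k => if k = z ∨ k = w then 0 else c k) z = 0 := if_pos (Or.inl rfl)
    rw [map_add, map_one, h2, coeff_intExp_eq_zero (c := fun k => if k = z ∨ k = w then 0 else c k) hz0 (Finsupp.mem_support_iff.1 hz),
      S.coeff_subst] at h3
    have h4 : n ∈ S.fiber n := by
      rw [S.mem_fiber, hexp, hnw, Finsupp.single_zero, add_zero, Finsupp.erase_of_notMem_support hw]
    rw [← Finset.add_sum_erase _ _ h4, monomialSubst_weight, one_smul] at h3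
    rw [h1, eq_neg_of_add_eq_zero_left h3]
    refine neg_mem (sum_mem fun m hm => ?_)
    obtain ⟨hmn, hm⟩ := Finset.mem_erase.1 hm
    rw [S.mem_fiber, hexp] at hm
    rw [monomialSubst_weight, one_smul]
    have hmz : m z + m w = n z := by
      rw [← hm, Finsupp.add_apply, Finsupp.single_eq_same, Finsupp.erase_ne hwz]
    have hmk : ∀ k, k ≠ z → k ≠ w → m k = n k := fun k hk hk' => by
      rw [← hm, Finsupp.add_apply, Finsupp.single_eq_of_ne hk, Finsupp.erase_ne hk', add_zero]
    -- Another monomial with the same image as `n` must contain `w`, since the merging changes no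
    -- other exponent than those of `z` and `w`.
    have hmw : m w ≠ 0 := by
      intro hmw
      refine hmn (Finsupp.ext fun k => ?_)
      by_cases hk : k = w
      · rw [hk, hmw, hnw]
      · by_cases hk' : k = z
        · rw [hk']; omega
        · exact hmk k hk' hk
    refine ih _ ?_ c' m (fun k hk => ?_) rfl
    · have hs1 : n.support ⊆ insert w n.support := Finset.subset_insert _ _
      have hs2 : m.support ⊆ insert w n.support := fun k hk => by
        by_cases hkw : k = w
        · exact hkw ▸ Finset.mem_insert_self _ _
        · refine Finset.mem_insert_of_mem ?_
          by_cases hkz : k = z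
          · rwa [hkz]
          · rw [Finsupp.mem_support_iff, ← hmk k hkz hkw]
            exact Finsupp.mem_support_iff.1 hk
      rw [negDegree_eq_sum b c n hs1, negDegree_eq_sum b c' m hs2]
      refine Finset.sum_lt_sum (fun k _ => ?_) ⟨z, hs1 hz, ?_⟩
      · by_cases hkw : k = w
        · subst hkw
          rw [if_pos ⟨u, hc'w⟩]
          exact Nat.zero_le _
        · rw [hc'k k hkw]
          split_ifs
          · exact le_rfl
          · by_cases hkz : k = z
            · rw [hkz]; omega
            · rw [hmk k hkz hkw]
      · have : ¬ ∃ u, c z = b u := fun ⟨v, hv⟩ => hzpos v hv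
        rw [hc'k z hwz, if_neg this, if_neg this]
        omega
    · by_cases hkw : k = w
      · exact Or.inr ⟨u, Or.inl (by rw [hkw, hc'w])⟩
      · rw [hc'k k hkw]
        refine h k ?_
        by_cases hkz : k = z
        · rwa [hkz]
        · rw [Finsupp.mem_support_iff, ← hmk k hkz hkw]
          exact Finsupp.mem_support_iff.1 hk

/-- Below `m₀` there are finitely many monomials, and each coefficient is a finite integral
combination of basis elements, written as a sum with repetitions of `±b u`. -/
theorem exists_linSeries_cong {σ : Type*} {f : MvPowerSeries σ R} (hf : constantCoeff f = 0)
    (m₀ : σ →₀ ℕ) : ∃ L : List ((σ →₀ ℕ) × R),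
      (∀ p ∈ L, p.1 ≠ 0 ∧ ∃ u, p.2 = b u ∨ p.2 = -b u) ∧
        Cong (Set.Iic m₀) f (L.map fun p => monomial p.1 p.2).sum := by
  classical
  let V : AddSubgroup (MvPowerSeries σ R) :=
    { carrier := {f | ∃ L : List ((σ →₀ ℕ) × R),
        (∀ p ∈ L, p.1 ≠ 0 ∧ ∃ u, p.2 = b u ∨ p.2 = -b u) ∧
          f = (L.map fun p => monomial p.1 p.2).sum}
      zero_mem' := ⟨[], by simp, by simp⟩
      add_mem' := by
        rintro _ _ ⟨L, hL, rfl⟩ ⟨L', hL', rfl⟩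
        refine ⟨L ++ L', fun p hp => ?_, by simp⟩
        rcases List.mem_append.1 hp with hp | hp
        · exact hL p hp
        · exact hL' p hp
      neg_mem' := by
        rintro _ ⟨L, hL, rfl⟩
        refine ⟨L.map fun p => (p.1, -p.2), fun p hp => ?_, ?_⟩
        · obtain ⟨q, hq, rfl⟩ := List.mem_map.1 hp
          obtain ⟨h1, u, h2 | h2⟩ := hL q hq
          · exact ⟨h1, u, Or.inr (by rw [h2])⟩
          · exact ⟨h1, u, Or.inl (by rw [h2, neg_neg])⟩
        · rw [List.map_map, List.sum_neg, List.map_map]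
          congr 2
          ext1 p
          exact (map_neg (monomial p.1) p.2).symm }
  have hmon : ∀ d : σ →₀ ℕ, d ≠ 0 → ∀ W, monomial d W ∈ V := fun d hd W =>
    monomial_mem_of_basis b V d (fun u => ⟨[(d, b u)],
      fun p hp => by rw [List.mem_singleton.1 hp]; exact ⟨hd, u, Or.inl rfl⟩, by simp⟩) W
  obtain ⟨L, hL, hsum⟩ : ∑ m ∈ (Finset.Iic m₀).erase 0, monomial m (coeff m f) ∈ V :=
    sum_mem fun m hm => hmon m (Finset.mem_erase.1 hm).1 _
  refine ⟨L, hL, fun m hm => ?_⟩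
  rw [← hsum, map_sum]
  simp only [coeff_monomial]
  rw [Finset.sum_ite_eq]
  by_cases h : m = 0
  · rw [if_neg (by simp [h]), h, coeff_zero_eq_constantCoeff_apply, hf]
  · rw [if_pos (Finset.mem_erase.2 ⟨h, Finset.mem_Iic.2 hm⟩)]

/-- The coefficients of the exponential of an integral series are integral combinations of the
coefficients of the generating function. -/
theorem coeff_intExp_mem_coeffSpan {σ : Type*} {x : MvPowerSeries σ R} (hx : constantCoeff x = 1)
    (m₀ : σ →₀ ℕ) : coeff m₀ (intExp x) ∈ coeffSpan b := by
  classical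
  by_cases hm₀ : m₀ = 0
  · rw [hm₀]; exact coeff_zero_intExp_mem b _
  obtain ⟨s₀, -⟩ := Finsupp.support_nonempty_iff.2 hm₀
  obtain ⟨L, hL, hcong⟩ := exists_linSeries_cong b (f := x - 1)
    (by rw [map_sub, hx, map_one, sub_self]) m₀
  set N := L.length with hN
  -- Beyond the list, the variables get coefficient `0`. The powers of `s₀` assigned to them serve
  -- only to keep the monomials nonzero, with finitely many below any bound.
  set d : ℕ → σ →₀ ℕ := fun k => if h : k < N then L[k].1 else Finsupp.single s₀ (k + 1) with hd'
  set c : ℕ → R := fun k => if h : k < N then L[k].2 else 0 with hc'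
  have hd : ∀ k, d k ≠ 0 := fun k => by
    rw [hd']
    simp only
    split_ifs with h
    · exact (hL _ (List.getElem_mem h)).1
    · simp
  have hfin : ∀ n, {k | d k ≤ n}.Finite := fun n => by
    refine (Set.finite_lt_nat (N + n s₀)).subset fun k hk => ?_
    by_cases h : k < N
    · exact Nat.lt_add_right _ h
    · have h1 : d k = Finsupp.single s₀ (k + 1) := dif_neg h
      have h2 := Finsupp.single_le_iff.1 (h1 ▸ hk : Finsupp.single s₀ (k + 1) ≤ n)
      change k < N + n s₀
      omega
  set S := monomialSubst d hd hfin with hS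
  have h1 : S.subst (linSeries c) = (L.map fun p => monomial p.1 p.2).sum := by
    ext n
    have hs := hfin n
    rw [hS, coeff_subst_linSeries hd hfin c n ((hfin n).toFinset.filter fun k => d k = n)
      (fun k => by
        rw [Finset.mem_filter, Set.Finite.mem_toFinset]
        exact ⟨fun h => h.2, fun h => ⟨h.le, h⟩⟩)]
    have h2 : (L.map fun p => monomial p.1 p.2).sum = ∑ k ∈ range N, monomial (d k) (c k) := by
      rw [← Fin.sum_univ_fun_getElem, Finset.sum_range]
      refine Finset.sum_congr rfl fun k _ => ?_
      have e1 : d k = L[k].1 := dif_pos k.2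
      have e2 : c k = L[k].2 := dif_pos k.2
      rw [e1, e2]
      rfl
    rw [h2, map_sum]
    simp only [coeff_monomial]
    rw [← Finset.sum_filter]
    symm
    refine (Finset.sum_subset_zero_on_sdiff (g := c) (fun k hk => ?_) (fun k hk => ?_)
      fun k _ => rfl)
    · obtain ⟨-, h3⟩ := Finset.mem_filter.1 hk
      exact Finset.mem_filter.2 ⟨(hfin n).mem_toFinset.2 h3.ge, h3.symm⟩
    · obtain ⟨h3, h4⟩ := Finset.mem_sdiff.1 hk
      obtain ⟨-, h5⟩ := Finset.mem_filter.1 h3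
      rw [hc']
      simp only
      rw [dif_neg]
      intro h6
      exact h4 (Finset.mem_filter.2 ⟨Finset.mem_range.2 h6, h5.symm⟩)
  rw [← h1] at hcong
  have h2 : Cong (Set.Iic m₀) x (1 + S.subst (linSeries c)) := by
    have := hcong.one_add
    rwa [add_sub_cancel] at this
  rw [h2.intExp (isLowerSet_Iic m₀) m₀ (Set.mem_Iic.2 le_rfl), ← map_one S.subst, ← map_add,
    ← subst_intExp S (fun _ _ _ => rfl) (constantCoeff_one_add_linSeries c), S.coeff_subst]
  refine sum_mem fun m _ => zsmul_mem (coeff_intExp_linSeries_mem b _ c m (fun k _ => ?_) rfl) _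
  by_cases h : k < N
  · right
    have : c k = L[k].2 := dif_pos h
    rw [this]
    exact (hL _ (List.getElem_mem h)).2
  · exact Or.inl (dif_neg h)

theorem e_mem_coeffSpan (u : I) (r : ℕ) : e r (b u) ∈ coeffSpan b := by
  have h1 : flip (E (b u)) = intExp (1 - monomial (Finsupp.single () 1) (b u)) := by
    rw [flip, intExp_one_sub_monomial single_one_ne_zero]
  have h2 := coeff_intExp_mem_coeffSpan b (x := 1 - monomial (Finsupp.single () 1) (b u))
    (constantCoeff_one_sub_monomial single_one_ne_zero _) (Finsupp.single () r)
  rw [← h1, coeff_flip] at h2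
  have h3 := zsmul_mem h2 ((-1 : ℤ) ^ (Finsupp.single () r : Unit →₀ ℕ) ())
  rw [smul_smul, ← mul_pow] at h3
  have h4 : (coeff (Finsupp.single () r) (E (b u) : MvPowerSeries Unit (GQ R))) ∈ coeffSpan b := by
    simpa using h3
  exact h4

/-- In two disjoint sets of variables, the product of two copies of the generating function is the
exponential of an integral series, by multiplicativity. Its coefficient at `x^m y^n` is the product
in question. -/
theorem mul_coeff_mem_coeffSpan (m n : I × ℕ →₀ ℕ) :
    coeff m (genFun b) * coeff n (genFun b) ∈ coeffSpan b := by
  classical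
  set p : MvPowerSeries (I × ℕ) R := 1 + linSeries fun p : I × ℕ => b p.1 with hp
  have hp1 : constantCoeff p = 1 := constantCoeff_one_add_linSeries _
  have hvar : ∀ g : I × ℕ → (I × ℕ) ⊕ (I × ℕ), Function.Injective g →
      ∃ S : MonomialSubst (I × ℕ) ((I × ℕ) ⊕ (I × ℕ)), (∀ m, S.weight m = 1) ∧
        ∀ m, S.exponent m = Finsupp.mapDomain g m := fun g hg =>
    ⟨monomialSubst (fun k => Finsupp.single (g k) 1) (fun k => by simp)
      (finite_setOf_single_le fun s => Set.Subsingleton.finite fun k hk k' hk' =>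
        hg (hk.trans hk'.symm)), fun _ => rfl, fun m => monomialSubst_exponent_eq_mapDomain _ _ m⟩
  obtain ⟨S, hSw, hS⟩ := hvar Sum.inl Sum.inl_injective
  obtain ⟨S', hSw', hS'⟩ := hvar Sum.inr Sum.inr_injective
  have hSi : Function.Injective S.exponent := fun a a' h => by
    rw [hS, hS] at h
    exact Finsupp.mapDomain_injective Sum.inl_injective h
  have hSi' : Function.Injective S'.exponent := fun a a' h => by
    rw [hS', hS'] at h
    exact Finsupp.mapDomain_injective Sum.inr_injective h
  have h1 := coeff_intExp_mem_coeffSpan b (x := S.subst p * S'.subst p)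
    (by rw [map_mul, S.constantCoeff_subst, S'.constantCoeff_subst, hp1, mul_one])
    (S.exponent m + S'.exponent n)
  rw [intExp_mul ((S.constantCoeff_subst _).trans hp1) ((S'.constantCoeff_subst _).trans hp1),
    ← subst_intExp S (fun _ _ _ => by rw [hSw, hSw]) hp1,
    ← subst_intExp S' (fun _ _ _ => by rw [hSw', hSw']) hp1, hp, ← genFun_eq_intExp, coeff_mul,
    Finset.sum_eq_single (S.exponent m, S'.exponent n)] at h1
  · rwa [coeff_subst_of_injective S hSi hSw, coeff_subst_of_injective S' hSi' hSw'] at h1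
  · rintro ⟨x, y⟩ hxy hne
    rw [HasAntidiagonal.mem_antidiagonal] at hxy
    rw [S.coeff_subst, S'.coeff_subst]
    by_contra hnz
    obtain ⟨a, ha, -⟩ := Finset.exists_ne_zero_of_sum_ne_zero (left_ne_zero_of_mul hnz)
    obtain ⟨a', ha', -⟩ := Finset.exists_ne_zero_of_sum_ne_zero (right_ne_zero_of_mul hnz)
    have h2 := S.mem_fiber.1 ha
    have h3 := S'.mem_fiber.1 ha'
    simp only at hxy h2 h3
    subst h2 h3
    rw [hS, hS', hS, hS'] at hxy
    have e1 : ∀ (x y : I × ℕ →₀ ℕ) (k : I × ℕ),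
        (Finsupp.mapDomain Sum.inl x + Finsupp.mapDomain Sum.inr y :
          (I × ℕ) ⊕ (I × ℕ) →₀ ℕ) (Sum.inl k) = x k := by
      intro x y k
      rw [Finsupp.add_apply, Finsupp.mapDomain_apply Sum.inl_injective,
        Finsupp.mapDomain_of_notMem_range, add_zero]
      simp
    have e2 : ∀ (x y : I × ℕ →₀ ℕ) (k : I × ℕ),
        (Finsupp.mapDomain Sum.inl x + Finsupp.mapDomain Sum.inr y :
          (I × ℕ) ⊕ (I × ℕ) →₀ ℕ) (Sum.inr k) = y k := by
      intro x y k
      rw [Finsupp.add_apply, Finsupp.mapDomain_apply Sum.inr_injective,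
        Finsupp.mapDomain_of_notMem_range, zero_add]
      simp
    refine hne ?_
    have e3 : a = m := Finsupp.ext fun k => by rw [← e1 a a' k, hxy, e1]
    have e4 : a' = n := Finsupp.ext fun k => by rw [← e2 a a' k, hxy, e2]
    rw [e3, e4]
  · intro h
    exact absurd (by rw [HasAntidiagonal.mem_antidiagonal]) h

/-- The span of the coefficients of the generating function is the subalgebra generated by the
`e_r(u)`. -/
theorem coeffSpan_eq : coeffSpan b = Subalgebra.toSubmodule (genSubalgebra b) := by
  apply le_antisymm
  · refine Submodule.span_le.2 ?_
    rintro _ ⟨m, rfl⟩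
    simp only [genFun_eq_intExp]
    exact coeff_intExp_mem_genSubalgebra b (constantCoeff_one_add_linSeries _) m
  · have hmul : ∀ x y, x ∈ coeffSpan b → y ∈ coeffSpan b → x * y ∈ coeffSpan b := by
      intro x y hx hy
      induction hx, hy using Submodule.span_induction₂ with
      | mem_mem x y hx hy =>
        obtain ⟨m, rfl⟩ := hx
        obtain ⟨n, rfl⟩ := hy
        exact mul_coeff_mem_coeffSpan b m n
      | zero_left y hy => rw [zero_mul]; exact zero_mem _
      | zero_right x hx => rw [mul_zero]; exact zero_mem _
      | add_left x y z hx hy hz h1 h2 => rw [add_mul]; exact add_mem h1 h2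
      | add_right x y z hx hy hz h1 h2 => rw [mul_add]; exact add_mem h1 h2
      | smul_left r x y hx hy h => rw [smul_mul_assoc]; exact Submodule.smul_mem _ _ h
      | smul_right r x y hx hy h => rw [mul_smul_comm]; exact Submodule.smul_mem _ _ h
    let C : Subalgebra ℤ (GQ R) := (coeffSpan b).toSubalgebra (one_mem_coeffSpan b) hmul
    have : genSubalgebra b ≤ C := by
      refine Algebra.adjoin_le ?_
      rintro _ ⟨u, r, rfl⟩
      exact e_mem_coeffSpan b u r
    exact fun x hx => this hx

end CoefficientSpan


/-! ### Symmetry of Schur functions: Bender–Knuth involutions on interlacing patterns -/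

section Patterns

variable {μ : YoungDiagram}

/-- The sequences of row lengths of the shapes `{S < j}` of a semistandard tableau `S` of shape
`μ`. -/
structure IsPattern (μ : YoungDiagram) (P : ℕ → ℕ → ℕ) : Prop where
  zero : ∀ r, P 0 r = 0
  le_succ : ∀ j r, P j r ≤ P (j + 1) r
  succ_le : ∀ j r, P (j + 1) (r + 1) ≤ P j r
  top : ∃ N, ∀ j, N ≤ j → ∀ r, P j r = μ.rowLen r

theorem IsPattern.mono {P : ℕ → ℕ → ℕ} (hP : IsPattern μ P) (r : ℕ) : Monotone fun j => P j r :=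
  monotone_nat_of_le_succ fun j => hP.le_succ j r

theorem IsPattern.le_rowLen {P : ℕ → ℕ → ℕ} (hP : IsPattern μ P) (j r : ℕ) :
    P j r ≤ μ.rowLen r := by
  obtain ⟨N, hN⟩ := hP.top
  rw [← hN (max j N) (le_max_right _ _) r]
  exact hP.mono r (le_max_left j N)

theorem exists_not_lt_entry (S : SemistandardYoungTableau μ) (j r : ℕ) :
    ∃ c, ¬((r, c) ∈ μ ∧ S r c < j) :=
  ⟨μ.rowLen r, fun h => lt_irrefl _ (YoungDiagram.mem_iff_lt_rowLen.1 h.1)⟩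

/-- The number of entries less than `j` in the row `r`. -/
def rowCount (S : SemistandardYoungTableau μ) (j r : ℕ) : ℕ := Nat.find (exists_not_lt_entry S j r)

theorem lt_rowCount {S : SemistandardYoungTableau μ} {j r c : ℕ} :
    c < rowCount S j r ↔ (r, c) ∈ μ ∧ S r c < j := by
  refine ⟨fun h => not_not.1 (Nat.find_min (exists_not_lt_entry S j r) h), fun h => ?_⟩
  by_contra h2
  have h3 := Nat.find_spec (exists_not_lt_entry S j r)
  push Not at h2
  exact h3 ⟨μ.up_left_mem le_rfl h2 h.1, (S.row_weak_of_le h2 h.1).trans_lt h.2⟩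

/-- The interlacing condition `succ_le` is column strictness: an entry at most `j` has the entry
above it less than `j`. -/
theorem isPattern_rowCount (S : SemistandardYoungTableau μ) : IsPattern μ (rowCount S) where
  zero r := by
    by_contra h
    exact absurd (lt_rowCount.1 (Nat.pos_of_ne_zero h)).2 (Nat.not_lt_zero _)
  le_succ j r := le_of_forall_lt fun c hc => by
    rw [lt_rowCount] at hc ⊢
    exact ⟨hc.1, Nat.lt_succ_of_lt hc.2⟩
  succ_le j r := le_of_forall_lt fun c hc => by
    rw [lt_rowCount] at hc ⊢
    have : S r c < S (r + 1) c := S.col_strict (Nat.lt_succ_self r) hc.1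
    exact ⟨μ.up_left_mem (Nat.le_succ r) le_rfl hc.1, by omega⟩
  top := by
    refine ⟨μ.cells.sup (fun c => S c.1 c.2) + 1, fun j hj r => ?_⟩
    refine eq_of_forall_lt_iff fun c => ?_
    rw [lt_rowCount, YoungDiagram.mem_iff_lt_rowLen, and_iff_left_iff_imp]
    intro h
    have := Finset.le_sup (f := fun c : ℕ × ℕ => S c.1 c.2)
      ((YoungDiagram.mem_cells (r, c)).2 (YoungDiagram.mem_iff_lt_rowLen.2 h))
    simp only at this
    omega

theorem rowCount_injective : Function.Injective
    (rowCount : SemistandardYoungTableau μ → ℕ → ℕ → ℕ) := by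
  intro S T h
  refine SemistandardYoungTableau.ext fun i c => ?_
  by_cases hc : (i, c) ∈ μ
  · refine eq_of_forall_gt_iff fun j => ?_
    have h1 := lt_rowCount (S := S) (j := j) (r := i) (c := c)
    have h2 := lt_rowCount (S := T) (j := j) (r := i) (c := c)
    rw [h] at h1
    tauto
  · rw [S.zeros hc, T.zeros hc]

theorem IsPattern.exists_lt {P : ℕ → ℕ → ℕ} (hP : IsPattern μ P) {i c : ℕ} (h : (i, c) ∈ μ) :
    ∃ k, c < P (k + 1) i := by
  obtain ⟨N, hN⟩ := hP.top
  exact ⟨N, by rw [hN _ (Nat.le_succ N)]; exact YoungDiagram.mem_iff_lt_rowLen.1 h⟩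

theorem IsPattern.find_lt {P : ℕ → ℕ → ℕ} (hP : IsPattern μ P) {i c : ℕ} (h : (i, c) ∈ μ)
    (k : ℕ) : Nat.find (hP.exists_lt h) < k ↔ c < P k i := by
  constructor
  · intro hk
    exact (Nat.find_spec (hP.exists_lt h)).trans_le (hP.mono i hk)
  · intro hk
    cases k with
    | zero => rw [hP.zero] at hk; exact absurd hk (Nat.not_lt_zero _)
    | succ k => exact Nat.lt_succ_of_le (Nat.find_min' _ hk)

/-- The tableau of a pattern. -/
def IsPattern.tableau {P : ℕ → ℕ → ℕ} (hP : IsPattern μ P) : SemistandardYoungTableau μ where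
  entry i c := if h : (i, c) ∈ μ then Nat.find (hP.exists_lt h) else 0
  row_weak' := by
    intro i c c' hc h
    have h' : (i, c) ∈ μ := μ.up_left_mem le_rfl hc.le h
    rw [dif_pos h, dif_pos h', ← Nat.lt_succ_iff, hP.find_lt h']
    exact hc.trans (Nat.find_spec (hP.exists_lt h))
  col_strict' := by
    intro i i' c hi h
    induction i', hi using Nat.le_induction with
    | base =>
      have h' : (i, c) ∈ μ := μ.up_left_mem (Nat.le_succ i) le_rfl h
      rw [dif_pos h, dif_pos h', hP.find_lt h']
      exact (Nat.find_spec (hP.exists_lt h)).trans_le (hP.succ_le _ _)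
    | succ i' hi ih =>
      have h' : (i', c) ∈ μ := μ.up_left_mem (Nat.le_succ i') le_rfl h
      refine (ih h').trans ?_
      rw [dif_pos h, dif_pos h', hP.find_lt h']
      exact (Nat.find_spec (hP.exists_lt h)).trans_le (hP.succ_le _ _)
  zeros' h := dif_neg h

theorem IsPattern.tableau_apply {P : ℕ → ℕ → ℕ} (hP : IsPattern μ P) {i c : ℕ} (h : (i, c) ∈ μ) :
    hP.tableau i c = Nat.find (hP.exists_lt h) := dif_pos h

theorem IsPattern.rowCount_tableau {P : ℕ → ℕ → ℕ} (hP : IsPattern μ P) :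
    rowCount hP.tableau = P := by
  ext j r
  refine eq_of_forall_lt_iff fun c => ?_
  rw [lt_rowCount]
  constructor
  · rintro ⟨h, h2⟩
    rwa [hP.tableau_apply h, hP.find_lt h] at h2
  · intro h
    have h2 : (r, c) ∈ μ := YoungDiagram.mem_iff_lt_rowLen.2 (h.trans_le (hP.le_rowLen j r))
    exact ⟨h2, by rwa [hP.tableau_apply h2, hP.find_lt h2]⟩

/-- The lower bound for `P (k + 1) r` given by the neighbouring levels. -/
def lowBound (P : ℕ → ℕ → ℕ) (k r : ℕ) : ℕ := max (P k r) (P (k + 2) (r + 1))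

/-- The upper bound for `P (k + 1) r` given by the neighbouring levels. -/
def highBound (P : ℕ → ℕ → ℕ) (k : ℕ) : ℕ → ℕ
  | 0 => P (k + 2) 0
  | r + 1 => min (P (k + 2) (r + 1)) (P k r)

/-- The reflection of the level `k + 1` of a pattern between its bounds. -/
def togglePattern (P : ℕ → ℕ → ℕ) (k j r : ℕ) : ℕ :=
  if j = k + 1 then lowBound P k r + highBound P k r - P (k + 1) r else P j r

variable {P : ℕ → ℕ → ℕ}

theorem IsPattern.lowBound_le (hP : IsPattern μ P) (k r : ℕ) : lowBound P k r ≤ P (k + 1) r :=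
  max_le (hP.le_succ k r) (hP.succ_le (k + 1) r)

theorem IsPattern.le_highBound (hP : IsPattern μ P) (k r : ℕ) : P (k + 1) r ≤ highBound P k r := by
  cases r with
  | zero => exact hP.le_succ (k + 1) 0
  | succ r => exact le_min (hP.le_succ (k + 1) _) (hP.succ_le k r)

theorem highBound_le (P : ℕ → ℕ → ℕ) (k r : ℕ) : highBound P k r ≤ P (k + 2) r := by
  cases r with
  | zero => exact le_rfl
  | succ r => exact min_le_left _ _

theorem togglePattern_self (P : ℕ → ℕ → ℕ) (k r : ℕ) :
    togglePattern P k (k + 1) r = lowBound P k r + highBound P k r - P (k + 1) r := if_pos rfl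

theorem togglePattern_of_ne {k j : ℕ} (h : j ≠ k + 1) (r : ℕ) : togglePattern P k j r = P j r :=
  if_neg h

theorem IsPattern.toggle (hP : IsPattern μ P) (k : ℕ) : IsPattern μ (togglePattern P k) where
  zero r := by rw [togglePattern_of_ne (by omega), hP.zero]
  le_succ j r := by
    have h1 := hP.lowBound_le k r
    have h2 := hP.le_highBound k r
    by_cases hj : j = k + 1
    · subst hj
      rw [togglePattern_self, togglePattern_of_ne (by omega)]
      have := highBound_le P k r
      change _ ≤ P (k + 2) r
      omega
    · rw [togglePattern_of_ne hj]
      by_cases hj' : j = k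
      · subst hj'
        rw [togglePattern_self]
        have : P j r ≤ lowBound P j r := le_max_left _ _
        omega
      · rw [togglePattern_of_ne (by omega)]
        exact hP.le_succ j r
  succ_le j r := by
    by_cases hj : j = k + 1
    · subst hj
      have h1 := hP.lowBound_le k r
      have h2 := hP.le_highBound k r
      rw [togglePattern_self, togglePattern_of_ne (by omega)]
      have : P (k + 2) (r + 1) ≤ lowBound P k r := le_max_right _ _
      change P (k + 2) (r + 1) ≤ _
      omega
    · rw [togglePattern_of_ne hj]
      by_cases hj' : j = k
      · subst hj'
        have h1 := hP.lowBound_le j (r + 1)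
        have h2 := hP.le_highBound j (r + 1)
        rw [togglePattern_self]
        have : highBound P j (r + 1) ≤ P j r := min_le_right _ _
        omega
      · rw [togglePattern_of_ne (by omega)]
        exact hP.succ_le j r
  top := by
    obtain ⟨N, hN⟩ := hP.top
    refine ⟨max N (k + 2), fun j hj r => ?_⟩
    rw [togglePattern_of_ne (by omega), hN j (by omega)]

theorem togglePattern_bounds (P : ℕ → ℕ → ℕ) (k r : ℕ) :
    lowBound (togglePattern P k) k r = lowBound P k r ∧
      highBound (togglePattern P k) k r = highBound P k r := by
  constructor
  · rw [lowBound, togglePattern_of_ne (by omega), togglePattern_of_ne (by omega)]; rfl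
  · cases r with
    | zero => rw [highBound, togglePattern_of_ne (by omega)]; rfl
    | succ r => rw [highBound, togglePattern_of_ne (by omega), togglePattern_of_ne (by omega)]; rfl

theorem IsPattern.toggle_toggle (hP : IsPattern μ P) (k : ℕ) :
    togglePattern (togglePattern P k) k = P := by
  ext j r
  by_cases hj : j = k + 1
  · subst hj
    obtain ⟨h3, h4⟩ := togglePattern_bounds P k r
    rw [togglePattern_self, h3, h4, togglePattern_self]
    have h1 := hP.lowBound_le k r
    have h2 := hP.le_highBound k r
    omega
  · rw [togglePattern_of_ne hj, togglePattern_of_ne hj]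

/-- The lower bound in row `r` and the upper bound in row `r + 1` are the maximum and the minimum of
the same two numbers, so their sum telescopes. -/
theorem sum_bounds (P : ℕ → ℕ → ℕ) (k n : ℕ) :
    ∑ r ∈ range n, (lowBound P k r + highBound P k r) + highBound P k n =
      ∑ r ∈ range n, (P k r + P (k + 2) r) + P (k + 2) n := by
  induction n with
  | zero => simp [highBound]
  | succ n ih =>
    rw [sum_range_succ, sum_range_succ]
    have : lowBound P k n + highBound P k (n + 1) = P k n + P (k + 2) (n + 1) := by
      rw [lowBound, highBound, min_comm, max_add_min]
    omega

/-- This says that the reflection exchanges the numbers of entries `k` and `k + 1`. -/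
theorem IsPattern.sum_toggle (hP : IsPattern μ P) (k : ℕ) :
    ∑ r ∈ range (μ.colLen 0), togglePattern P k (k + 1) r +
        ∑ r ∈ range (μ.colLen 0), P (k + 1) r =
      ∑ r ∈ range (μ.colLen 0), P k r + ∑ r ∈ range (μ.colLen 0), P (k + 2) r := by
  have h := sum_bounds P k (μ.colLen 0)
  -- The row below the last one is empty, so the boundary terms of `sum_bounds` vanish.
  have h0 : P (k + 2) (μ.colLen 0) = 0 := by
    have h1 := hP.le_rowLen (k + 2) (μ.colLen 0)
    have h2 : μ.rowLen (μ.colLen 0) = 0 := by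
      by_contra h2
      have := YoungDiagram.mem_iff_lt_rowLen.2 (Nat.pos_of_ne_zero h2)
      exact lt_irrefl _ (YoungDiagram.mem_iff_lt_colLen.1 this)
    omega
  have h1 := highBound_le P k (μ.colLen 0)
  rw [h0] at h h1
  rw [← sum_add_distrib, ← sum_add_distrib]
  have h3 : ∑ r ∈ range (μ.colLen 0), (togglePattern P k (k + 1) r + P (k + 1) r) =
      ∑ r ∈ range (μ.colLen 0), (lowBound P k r + highBound P k r) :=
    Finset.sum_congr rfl fun r _ => by
      rw [togglePattern_self]
      have h1 := hP.lowBound_le k r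
      have h2 := hP.le_highBound k r
      omega
  omega

/-- The number of entries less than `j`. -/
def cellCount (S : SemistandardYoungTableau μ) (j : ℕ) : ℕ :=
  (μ.cells.filter fun c => S c.1 c.2 < j).card

theorem cellCount_eq (S : SemistandardYoungTableau μ) (j : ℕ) :
    cellCount S j = ∑ r ∈ range (μ.colLen 0), rowCount S j r := by
  rw [cellCount, Finset.card_eq_sum_card_fiberwise (f := Prod.fst) (t := range (μ.colLen 0))]
  · refine Finset.sum_congr rfl fun r _ => ?_
    rw [← Finset.card_range (rowCount S j r)]
    refine Finset.card_bij' (fun c _ => c.2) (fun c _ => (r, c)) ?_ ?_ ?_ ?_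
    · rintro ⟨r', c⟩ h
      simp only [Finset.mem_filter, YoungDiagram.mem_cells] at h
      obtain ⟨⟨h1, h2⟩, rfl⟩ := h
      exact Finset.mem_range.2 (lt_rowCount.2 ⟨h1, h2⟩)
    · intro c h
      obtain ⟨h1, h2⟩ := lt_rowCount.1 (Finset.mem_range.1 h)
      simp only [Finset.mem_filter, YoungDiagram.mem_cells]
      exact ⟨⟨h1, h2⟩, trivial⟩
    · rintro ⟨r', c⟩ h
      simp only [Finset.mem_filter] at h
      obtain ⟨-, rfl⟩ := h
      rfl
    · intro c _; rfl
  · rintro ⟨r, c⟩ h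
    have h1 := (YoungDiagram.mem_cells _).1 (Finset.mem_filter.1 h).1
    exact Finset.mem_coe.2 (Finset.mem_range.2 (YoungDiagram.mem_iff_lt_colLen.1
      (μ.up_left_mem le_rfl (Nat.zero_le c) h1)))

/-- The toggling of the entries `k` and `k + 1` of a tableau. -/
def toggleTableau (k : ℕ) (S : SemistandardYoungTableau μ) : SemistandardYoungTableau μ :=
  ((isPattern_rowCount S).toggle k).tableau

theorem rowCount_toggleTableau (k : ℕ) (S : SemistandardYoungTableau μ) :
    rowCount (toggleTableau k S) = togglePattern (rowCount S) k := IsPattern.rowCount_tableau _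

theorem toggleTableau_involutive (k : ℕ) :
    Function.Involutive (toggleTableau k : SemistandardYoungTableau μ → _) := fun S =>
  rowCount_injective (by
    rw [rowCount_toggleTableau, rowCount_toggleTableau, (isPattern_rowCount S).toggle_toggle])

theorem cellCount_toggleTableau (k : ℕ) (S : SemistandardYoungTableau μ) :
    cellCount (toggleTableau k S) (k + 1) + cellCount S (k + 1) =
      cellCount S k + cellCount S (k + 2) := by
  simp only [cellCount_eq, rowCount_toggleTableau]
  exact (isPattern_rowCount S).sum_toggle k

theorem cellCount_toggleTableau_of_ne {k j : ℕ} (h : j ≠ k + 1) (S : SemistandardYoungTableau μ) :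
    cellCount (toggleTableau k S) j = cellCount S j := by
  simp only [cellCount_eq, rowCount_toggleTableau, togglePattern_of_ne h]

variable {I : Type*}

theorem tableauMonomial_apply_eq_card (u : I) (S : SemistandardYoungTableau μ) (j : ℕ) :
    tableauMonomial u S (u, j) = (μ.cells.filter fun c => S c.1 c.2 = j).card := by
  classical
  rw [tableauMonomial, Finsupp.finsetSum_apply, Finset.card_filter]
  refine Finset.sum_congr rfl fun c _ => ?_
  rw [Finsupp.single_apply]
  simp

theorem tableauMonomial_apply (u : I) (S : SemistandardYoungTableau μ) (j : ℕ) :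
    tableauMonomial u S (u, j) + cellCount S j = cellCount S (j + 1) := by
  rw [tableauMonomial_apply_eq_card, cellCount, cellCount, ← Finset.card_union_of_disjoint]
  · congr 1
    ext c
    simp only [Finset.mem_union, Finset.mem_filter]
    rw [Nat.lt_succ_iff, Nat.le_iff_lt_or_eq]
    tauto
  · rw [Finset.disjoint_filter]
    intro c _ h1 h2
    omega

theorem tableauMonomial_apply_of_ne {u u' : I} (h : u ≠ u') (S : SemistandardYoungTableau μ)
    (j : ℕ) : tableauMonomial u S (u', j) = 0 := by
  classical
  rw [tableauMonomial, Finsupp.finsetSum_apply]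
  refine Finset.sum_eq_zero fun c _ => ?_
  rw [Finsupp.single_apply, if_neg]
  exact fun h2 => h (congrArg Prod.fst h2)

open Classical in
/-- The exchange of the variables `x_{u,k}` and `x_{u,k+1}`. -/
def adjSwap (u : I) (k : ℕ) : Equiv.Perm (I × ℕ) := Equiv.swap (u, k) (u, k + 1)

open Classical in
theorem adjSwap_left (u : I) (k : ℕ) : adjSwap u k (u, k) = (u, k + 1) := Equiv.swap_apply_left _ _

open Classical in
theorem adjSwap_right (u : I) (k : ℕ) : adjSwap u k (u, k + 1) = (u, k) :=
  Equiv.swap_apply_right _ _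

open Classical in
theorem adjSwap_of_ne {u : I} {k : ℕ} {p : I × ℕ} (h : p ≠ (u, k)) (h' : p ≠ (u, k + 1)) :
    adjSwap u k p = p := Equiv.swap_apply_of_ne_of_ne h h'

open Classical in
theorem adjSwap_adjSwap (u : I) (k : ℕ) (p : I × ℕ) : adjSwap u k (adjSwap u k p) = p :=
  Equiv.swap_apply_self ..

theorem adjSwap_fst (u : I) (k : ℕ) (p : I × ℕ) : (adjSwap u k p).1 = p.1 := by
  by_cases h : p = (u, k)
  · rw [h, adjSwap_left]
  · by_cases h' : p = (u, k + 1)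
    · rw [h', adjSwap_right]
    · rw [adjSwap_of_ne h h']

theorem mapDomain_adjSwap_apply (u : I) (k : ℕ) (m : I × ℕ →₀ ℕ) (p : I × ℕ) :
    Finsupp.mapDomain (adjSwap u k) m p = m (adjSwap u k p) := by
  have := Finsupp.mapDomain_apply (adjSwap u k).injective m (adjSwap u k p)
  rwa [adjSwap_adjSwap] at this

theorem tableauMonomial_toggleTableau (u : I) (k : ℕ) (S : SemistandardYoungTableau μ) :
    tableauMonomial u (toggleTableau k S) =
      Finsupp.mapDomain (adjSwap u k) (tableauMonomial u S) := by
  refine Finsupp.ext fun p => ?_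
  rw [mapDomain_adjSwap_apply]
  obtain ⟨u', j⟩ := p
  by_cases hu : u = u'
  · subst hu
    have h := cellCount_toggleTableau k S
    have h1 := tableauMonomial_apply u (toggleTableau k S) j
    have h2 := tableauMonomial_apply u S k
    have h3 := tableauMonomial_apply u S (k + 1)
    by_cases hj : j = k
    · subst hj
      rw [adjSwap_left]
      rw [cellCount_toggleTableau_of_ne (by omega)] at h1
      have : j + 1 + 1 = j + 2 := rfl
      rw [this] at h3
      omega
    · by_cases hj' : j = k + 1
      · subst hj'
        rw [adjSwap_right]
        rw [cellCount_toggleTableau_of_ne (j := k + 1 + 1) (by omega)] at h1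
        have : k + 1 + 1 = k + 2 := rfl
        rw [this] at h1
        omega
      · rw [adjSwap_of_ne (by simpa using hj) (by simpa using hj')]
        rw [cellCount_toggleTableau_of_ne (by omega),
          cellCount_toggleTableau_of_ne (by omega)] at h1
        have := tableauMonomial_apply u S j
        omega
  · have h1 : (adjSwap u k (u', j)).1 = u' := adjSwap_fst u k _
    rw [tableauMonomial_apply_of_ne hu, ← Prod.mk.eta (p := adjSwap u k (u', j)), h1,
      tableauMonomial_apply_of_ne hu]

theorem tableauMonomial_adjSwap_of_ne {u u' : I} (h : u' ≠ u) (k : ℕ)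
    (S : SemistandardYoungTableau μ) :
    Finsupp.mapDomain (adjSwap u k) (tableauMonomial u' S) = tableauMonomial u' S := by
  refine Finsupp.ext fun p => ?_
  rw [mapDomain_adjSwap_apply]
  obtain ⟨v, j⟩ := p
  by_cases hv : u' = v
  · subst hv
    rw [adjSwap_of_ne (fun h2 => h (congrArg Prod.fst h2)) (fun h2 => h (congrArg Prod.fst h2))]
  · have h1 : (adjSwap u k (v, j)).1 = v := adjSwap_fst u k _
    rw [tableauMonomial_apply_of_ne hv, ← Prod.mk.eta (p := adjSwap u k (v, j)), h1,
      tableauMonomial_apply_of_ne hv]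

/-- For the set of variables involved, toggling is a bijection between the tableaux of the two
weights; for other sets the exchange does nothing. -/
theorem coeff_schur_adjSwap (u u' : I) (k : ℕ) (μ : YoungDiagram) (m : I × ℕ →₀ ℕ) :
    coeff (Finsupp.mapDomain (adjSwap u k) m) (schur u' μ) = coeff m (schur u' μ) := by
  have hinj := Finsupp.mapDomain_injective (M := ℕ) (adjSwap u k).injective
  rw [schur, coeff_ofCoeff, coeff_ofCoeff]
  congr 1
  by_cases h : u' = u
  · subst h
    refine (Nat.card_congr ((toggleTableau_involutive k).toPerm.subtypeEquiv fun S => ?_)).symm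
    change _ ↔ tableauMonomial u' (toggleTableau k S) = _
    rw [tableauMonomial_toggleTableau, hinj.eq_iff]
  · refine Nat.card_congr ((Equiv.refl _).subtypeEquiv fun S => ?_)
    rw [Equiv.refl_apply, ← tableauMonomial_adjSwap_of_ne h k S, hinj.eq_iff]
    rw [tableauMonomial_adjSwap_of_ne h k S]

end Patterns


/-! ### Unitriangular systems over `ℤ` -/

section Unitriangular

variable {Λ M G : Type*} [AddCommGroup G] {K : Λ → M → ℤ} {ρ : Λ → M} {w : M → ℕ}

/-- At the leading index `ρ l` only `l` itself and indices of smaller weight can contribute. -/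
theorem finsum_unitriangular (hρ : Function.Injective ρ) (hone : ∀ l, K l (ρ l) = 1)
    (hlt : ∀ l m, K l m ≠ 0 → m = ρ l ∨ w (ρ l) < w m) (hfin : ∀ m, {l | K l m ≠ 0}.Finite)
    (Z : Λ → G) (l : Λ) : ∑ᶠ l', K l' (ρ l) • Z l' =
      Z l + ∑ᶠ l', if w (ρ l') < w (ρ l) then K l' (ρ l) • Z l' else 0 := by
  classical
  have h1 : ∀ l', K l' (ρ l) • Z l' = (if l' = l then Z l else 0) +
      if w (ρ l') < w (ρ l) then K l' (ρ l) • Z l' else 0 := fun l' => by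
    by_cases h : l' = l
    · subst h
      rw [if_pos rfl, if_neg (lt_irrefl _), hone, one_smul, add_zero]
    · rw [if_neg h, zero_add]
      split_ifs with h2
      · rfl
      · have : K l' (ρ l) = 0 := by
          by_contra h3
          rcases hlt _ _ h3 with h4 | h4
          · exact h (hρ h4.symm)
          · exact h2 h4
        rw [this, zero_smul]
  rw [finsum_congr h1, finsum_add_distrib]
  · congr 1
    rw [finsum_eq_single _ l fun l' h => if_neg h, if_pos rfl]
  · refine (Set.finite_singleton l).subset fun l' h => ?_
    by_contra h2
    exact h (if_neg h2)
  · refine (hfin (ρ l)).subset fun l' h h2 => h ?_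
    simp only [h2, zero_smul, ite_self]

/-- The equations at the leading indices determine `Z` by recursion on the weight. Every other
equation coincides, by `hred`, with one of smaller weight. -/
theorem existsUnique_unitriangular (hρ : Function.Injective ρ) (hone : ∀ l, K l (ρ l) = 1)
    (hlt : ∀ l m, K l m ≠ 0 → m = ρ l ∨ w (ρ l) < w m) (hfin : ∀ m, {l | K l m ≠ 0}.Finite)
    (g : M → G) (hred : ∀ m, (∃ l, m = ρ l) ∨
      ∃ m', w m' < w m ∧ (∀ l, K l m' = K l m) ∧ g m' = g m) :
    ∃! Z : Λ → G, ∀ m, ∑ᶠ l, K l m • Z l = g m := by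
  classical
  have hwf : WellFounded fun l l' : Λ => w (ρ l) < w (ρ l') := (measure fun l => w (ρ l)).wf
  let Z : Λ → G := hwf.fix fun l Zl =>
    g (ρ l) - ∑ᶠ l', if h : w (ρ l') < w (ρ l) then K l' (ρ l) • Zl l' h else 0
  have hZ : ∀ l, Z l = g (ρ l) - ∑ᶠ l', if w (ρ l') < w (ρ l) then K l' (ρ l) • Z l' else 0 :=
    fun l => by
      refine (hwf.fix_eq _ l).trans ?_
      congr 1
  refine ⟨Z, fun m => ?_, fun Z' hZ' => funext fun l => ?_⟩
  · induction hn : w m using Nat.strong_induction_on generalizing m with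
    | _ n ih =>
      rcases hred m with ⟨l, rfl⟩ | ⟨m', h1, h2, h3⟩
      · rw [finsum_unitriangular hρ hone hlt hfin, hZ l, sub_add_cancel]
      · rw [← h3, ← ih _ (hn ▸ h1) m' rfl]
        exact finsum_congr fun l => by rw [h2]
  · induction l using hwf.induction with
    | _ l ih =>
      have h1 := hZ' (ρ l)
      rw [finsum_unitriangular hρ hone hlt hfin] at h1
      rw [hZ l, ← h1, eq_sub_iff_add_eq]
      congr 1
      refine finsum_congr fun l' => ?_
      split_ifs with h
      · rw [ih l' h]
      · rfl

/-- The diagonal entries are `1`, so `Z l` is `g (ρ l)` minus an integral combination of earlier `Z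
l'`; no denominators arise. -/
theorem span_range_unitriangular (hρ : Function.Injective ρ) (hone : ∀ l, K l (ρ l) = 1)
    (hlt : ∀ l m, K l m ≠ 0 → m = ρ l ∨ w (ρ l) < w m) (hfin : ∀ m, {l | K l m ≠ 0}.Finite)
    {g : M → G} {Z : Λ → G} (hZ : ∀ m, ∑ᶠ l, K l m • Z l = g m) :
    Submodule.span ℤ (Set.range Z) = Submodule.span ℤ (Set.range g) := by
  have hwf : WellFounded fun l l' : Λ => w (ρ l) < w (ρ l') := (measure fun l => w (ρ l)).wf
  refine le_antisymm (Submodule.span_le.2 ?_) (Submodule.span_le.2 ?_)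
  · rintro _ ⟨l, rfl⟩
    induction l using hwf.induction with
    | _ l ih =>
      have h1 := hZ (ρ l)
      rw [finsum_unitriangular hρ hone hlt hfin, ← eq_sub_iff_add_eq] at h1
      rw [h1]
      refine sub_mem (Submodule.subset_span ⟨_, rfl⟩) (finsum_induction
        (fun x => x ∈ Submodule.span ℤ (Set.range g)) (zero_mem _) (fun _ _ => add_mem) fun l' => ?_)
      split_ifs with h
      · exact zsmul_mem (ih l' h) _
      · exact zero_mem _
  · rintro _ ⟨m, rfl⟩
    rw [← hZ]
    exact finsum_induction (fun x => x ∈ Submodule.span ℤ (Set.range Z)) (zero_mem _)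
      (fun _ _ => add_mem) fun l => zsmul_mem (Submodule.subset_span (Set.mem_range_self l)) _

end Unitriangular

/-! ### Leading monomials of products of Schur functions -/

section LeadingMonomial

variable {I : Type*}

/-- The sum of the indices of the variables of a monomial. -/
def indexWeight : (I × ℕ →₀ ℕ) →+ ℕ := Finsupp.weight fun p => p.2

theorem indexWeight_single (p : I × ℕ) (n : ℕ) :
    indexWeight (Finsupp.single p n) = n * p.2 := by
  rw [indexWeight, Finsupp.weight_single, smul_eq_mul]

/-- The monomial `x^ρ` occurs with coefficient `1` in `f`, and all other monomials of `f` have the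
same degree in each set of variables and larger index weight. -/
def IsLeading (ρ : I × ℕ →₀ ℕ) (f : MvPowerSeries (I × ℕ) ℤ) : Prop :=
  coeff ρ f = 1 ∧ ∀ m, coeff m f ≠ 0 →
    Finsupp.mapDomain Prod.fst m = Finsupp.mapDomain Prod.fst ρ ∧
      (m = ρ ∨ indexWeight ρ < indexWeight m)

theorem IsLeading.indexWeight_le {ρ m : I × ℕ →₀ ℕ} {f : MvPowerSeries (I × ℕ) ℤ}
    (h : IsLeading ρ f) (hm : coeff m f ≠ 0) : indexWeight ρ ≤ indexWeight m := by
  rcases (h.2 m hm).2 with rfl | h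
  · exact le_rfl
  · exact h.le

theorem isLeading_one : IsLeading 0 (1 : MvPowerSeries (I × ℕ) ℤ) := by
  classical
  refine ⟨coeff_zero_one, fun m hm => ?_⟩
  rw [coeff_one] at hm
  have : m = 0 := by
    by_contra h
    exact hm (if_neg h)
  exact ⟨by rw [this], Or.inl this⟩

theorem IsLeading.mul {ρ ρ' : I × ℕ →₀ ℕ} {f f' : MvPowerSeries (I × ℕ) ℤ} (h : IsLeading ρ f)
    (h' : IsLeading ρ' f') : IsLeading (ρ + ρ') (f * f') := by
  classical
  have key : ∀ m n, coeff m f ≠ 0 → coeff n f' ≠ 0 → m ≠ ρ ∨ n ≠ ρ' →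
      indexWeight (ρ + ρ') < indexWeight (m + n) := fun m n hm hn hne => by
    rw [map_add, map_add]
    have h1 := h.indexWeight_le hm
    have h2 := h'.indexWeight_le hn
    rcases hne with hne | hne
    · have := (h.2 m hm).2.resolve_left hne
      omega
    · have := (h'.2 n hn).2.resolve_left hne
      omega
  refine ⟨?_, fun m hm => ?_⟩
  · rw [coeff_mul, Finset.sum_eq_single (ρ, ρ'), h.1, h'.1, one_mul]
    · rintro ⟨m, n⟩ hmn hne
      by_contra h0
      have h1 := key m n (left_ne_zero_of_mul h0) (right_ne_zero_of_mul h0) (by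
        by_contra! h2
        exact hne (Prod.ext h2.1 h2.2))
      rw [HasAntidiagonal.mem_antidiagonal] at hmn
      rw [hmn] at h1
      exact lt_irrefl _ h1
    · intro h
      rw [HasAntidiagonal.mem_antidiagonal] at h
      exact absurd rfl h
  · rw [coeff_mul] at hm
    obtain ⟨⟨a, c⟩, h1, h2⟩ := Finset.exists_ne_zero_of_sum_ne_zero hm
    rw [HasAntidiagonal.mem_antidiagonal] at h1
    have ha := left_ne_zero_of_mul h2
    have hc := right_ne_zero_of_mul h2
    simp only at h1 ha hc
    rw [← h1, Finsupp.mapDomain_add, Finsupp.mapDomain_add, (h.2 a ha).1, (h'.2 c hc).1]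
    refine ⟨rfl, ?_⟩
    by_cases h3 : a = ρ ∧ c = ρ'
    · exact Or.inl (by rw [h3.1, h3.2])
    · exact Or.inr (key a c ha hc (by tauto))

theorem isLeading_prod {κ : Type*} (s : Finset κ) {ρ : κ → I × ℕ →₀ ℕ}
    {f : κ → MvPowerSeries (I × ℕ) ℤ} (h : ∀ k, IsLeading (ρ k) (f k)) :
    IsLeading (∑ k ∈ s, ρ k) (∏ k ∈ s, f k) := by
  classical
  induction s using Finset.induction_on with
  | empty => exact isLeading_one
  | insert k s hk ih =>
    rw [Finset.sum_insert hk, Finset.prod_insert hk]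
    exact (h k).mul ih

variable {μ : YoungDiagram}

theorem le_entry (S : SemistandardYoungTableau μ) {i j : ℕ} (h : (i, j) ∈ μ) : i ≤ S i j := by
  induction i with
  | zero => exact Nat.zero_le _
  | succ i ih =>
    have h1 : S i j < S (i + 1) j := S.col_strict (Nat.lt_succ_self i) h
    have h2 := ih (μ.up_left_mem (Nat.le_succ i) le_rfl h)
    omega

theorem indexWeight_tableauMonomial (u : I) (S : SemistandardYoungTableau μ) :
    indexWeight (tableauMonomial u S) = ∑ c ∈ μ.cells, S c.1 c.2 := by
  rw [tableauMonomial, map_sum]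
  exact Finset.sum_congr rfl fun c _ => by rw [indexWeight_single, one_mul]

theorem mapDomain_tableauMonomial (u : I) (S : SemistandardYoungTableau μ) :
    Finsupp.mapDomain Prod.fst (tableauMonomial u S) = ∑ _c ∈ μ.cells, Finsupp.single u 1 := by
  rw [tableauMonomial, Finsupp.mapDomain_finsetSum]
  exact Finset.sum_congr rfl fun c _ => Finsupp.mapDomain_single

/-- Column strictness forces each entry to be at least its row index, with equality everywhere only
for the highest weight tableau. -/
theorem eq_highestWeight_or_lt (u : I) (S : SemistandardYoungTableau μ) :
    S = .highestWeight μ ∨ indexWeight (tableauMonomial u (.highestWeight μ)) <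
      indexWeight (tableauMonomial u S) := by
  have hw : ∀ c ∈ μ.cells, SemistandardYoungTableau.highestWeight μ c.1 c.2 = c.1 := fun c hc => by
    rw [SemistandardYoungTableau.highestWeight_apply, if_pos ((YoungDiagram.mem_cells c).1 hc)]
  have hle : ∀ c ∈ μ.cells, c.1 ≤ S c.1 c.2 := fun c hc =>
    le_entry S ((YoungDiagram.mem_cells c).1 hc)
  by_cases h : ∀ c ∈ μ.cells, S c.1 c.2 = c.1
  · refine Or.inl (SemistandardYoungTableau.ext fun i j => ?_)
    by_cases hc : (i, j) ∈ μ
    · exact (h (i, j) ((YoungDiagram.mem_cells _).2 hc)).trans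
        (hw (i, j) ((YoungDiagram.mem_cells _).2 hc)).symm
    · rw [S.zeros hc, SemistandardYoungTableau.zeros _ hc]
  · push Not at h
    obtain ⟨c, hc, hne⟩ := h
    right
    rw [indexWeight_tableauMonomial, indexWeight_tableauMonomial, Finset.sum_congr rfl hw]
    exact Finset.sum_lt_sum hle ⟨c, hc, lt_of_le_of_ne (hle c hc) hne.symm⟩

theorem isLeading_schur (u : I) (μ : YoungDiagram) :
    IsLeading (tableauMonomial u (.highestWeight μ)) (schur u μ) := by
  constructor
  · rw [schur, coeff_ofCoeff]
    have : Unique {S : SemistandardYoungTableau μ //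
        tableauMonomial u S = tableauMonomial u (.highestWeight μ)} :=
      { default := ⟨_, rfl⟩
        uniq := fun S => Subtype.ext ((eq_highestWeight_or_lt u S.1).resolve_right fun h => by
          rw [S.2] at h
          exact lt_irrefl _ h) }
    rw [Nat.card_unique, Nat.cast_one]
  · intro m hm
    rw [schur, coeff_ofCoeff, Nat.cast_ne_zero] at hm
    obtain ⟨⟨S, rfl⟩⟩ := (Nat.card_ne_zero.1 hm).1
    rw [mapDomain_tableauMonomial, mapDomain_tableauMonomial]
    refine ⟨rfl, ?_⟩
    rcases eq_highestWeight_or_lt u S with rfl | h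
    · exact Or.inl rfl
    · exact Or.inr h

/-- The exponent of the leading monomial of a product of Schur functions. -/
def leadingExponent (lam : Multipartition I) : I × ℕ →₀ ℕ :=
  ∑ u ∈ lam.2.toFinset, tableauMonomial u (.highestWeight (lam.1 u))

theorem isLeading_schurProd (lam : Multipartition I) :
    IsLeading (leadingExponent lam) (schurProd lam) :=
  isLeading_prod _ fun u => isLeading_schur u _

theorem tableauMonomial_highestWeight (u : I) (μ : YoungDiagram) (i : ℕ) :
    tableauMonomial u (.highestWeight μ) (u, i) = μ.rowLen i := by
  rw [tableauMonomial_apply_eq_card, YoungDiagram.rowLen_eq_card, YoungDiagram.row]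
  congr 1
  refine Finset.filter_congr fun c hc => ?_
  rw [SemistandardYoungTableau.highestWeight_apply, if_pos ((YoungDiagram.mem_cells c).1 hc)]

theorem leadingExponent_apply (lam : Multipartition I) (u : I) (i : ℕ) :
    leadingExponent lam (u, i) = (lam.1 u).rowLen i := by
  rw [leadingExponent, Finsupp.finsetSum_apply, Finset.sum_eq_single u,
    tableauMonomial_highestWeight]
  · exact fun v _ hv => tableauMonomial_apply_of_ne hv _ _
  · intro h
    rw [Set.Finite.mem_toFinset, Set.mem_ofPred_eq, not_not] at h
    rw [tableauMonomial_highestWeight, h]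
    by_contra h2
    exact YoungDiagram.notMem_bot _ (YoungDiagram.mem_iff_lt_rowLen.2 (Nat.pos_of_ne_zero h2))

theorem leadingExponent_injective :
    Function.Injective (leadingExponent : Multipartition I → I × ℕ →₀ ℕ) := fun lam nu h => by
  refine Subtype.ext (funext fun u => ?_)
  ext ⟨i, j⟩
  rw [YoungDiagram.mem_cells, YoungDiagram.mem_cells, YoungDiagram.mem_iff_lt_rowLen,
    YoungDiagram.mem_iff_lt_rowLen, ← leadingExponent_apply, ← leadingExponent_apply, h]

theorem apply_le_mapDomain_fst (m : I × ℕ →₀ ℕ) (p : I × ℕ) :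
    m p ≤ Finsupp.mapDomain Prod.fst m p.1 := by
  conv_rhs => rw [← Finsupp.single_add_erase p m]
  rw [Finsupp.mapDomain_add, Finsupp.mapDomain_single, Finsupp.add_apply, Finsupp.single_eq_same]
  exact Nat.le_add_right _ _

theorem le_indexWeight {m : I × ℕ →₀ ℕ} {p : I × ℕ} (h : m p ≠ 0) : p.2 ≤ indexWeight m := by
  conv_rhs => rw [← Finsupp.single_add_erase p m]
  rw [map_add, indexWeight_single]
  exact (Nat.le_mul_of_pos_left _ (Nat.pos_of_ne_zero h)).trans (Nat.le_add_right _ _)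

theorem finite_setOf_mapDomain_fst_eq (d : I →₀ ℕ) (N : ℕ) :
    {m : I × ℕ →₀ ℕ | Finsupp.mapDomain Prod.fst m = d ∧ indexWeight m ≤ N}.Finite := by
  classical
  refine (Set.finite_Iic (∑ p ∈ d.support ×ˢ range (N + 1), Finsupp.single p (d p.1))).subset ?_
  rintro m ⟨rfl, hN⟩
  refine Set.mem_Iic.2 fun p => ?_
  by_cases h : m p = 0
  · rw [h]; exact Nat.zero_le _
  have h1 := apply_le_mapDomain_fst m p
  have h2 := le_indexWeight h
  rw [Finsupp.finsetSum_apply, Finset.sum_eq_single p, Finsupp.single_eq_same]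
  · exact h1
  · exact fun q _ hq => Finsupp.single_eq_of_ne hq.symm
  · refine fun h3 => absurd (Finset.mem_product.2 ⟨Finsupp.mem_support_iff.2 ?_, ?_⟩) h3
    · omega
    · exact Finset.mem_range.2 (by omega)

/-- The degree in each set of variables is fixed and the index weight is bounded, which leaves
finitely many leading exponents; these determine the multipartition. -/
theorem finite_coeff_schurProd_ne_zero (m : I × ℕ →₀ ℕ) :
    {lam : Multipartition I | coeff m (schurProd lam) ≠ 0}.Finite := by
  refine ((finite_setOf_mapDomain_fst_eq (Finsupp.mapDomain Prod.fst m)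
    (indexWeight m)).preimage leadingExponent_injective.injOn).subset fun lam h => ?_
  exact ⟨((isLeading_schurProd lam).2 m h).1.symm, (isLeading_schurProd lam).indexWeight_le h⟩

end LeadingMonomial

/-! ### Existence and uniqueness of the `Z_λ`, and their span -/

section Symmetry

variable {I : Type*} (u : I) (k : ℕ)

theorem mapDomain_adjSwap_mapDomain (m : I × ℕ →₀ ℕ) :
    Finsupp.mapDomain (adjSwap u k) (Finsupp.mapDomain (adjSwap u k) m) = m :=
  Finsupp.ext fun p => by
    rw [mapDomain_adjSwap_apply, mapDomain_adjSwap_apply, adjSwap_adjSwap]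

/-- The substitution exchanging `x_{u,k}` and `x_{u,k+1}`. -/
def swapSubst : MonomialSubst (I × ℕ) (I × ℕ) :=
  monomialSubst (fun p => Finsupp.single (adjSwap u k p) 1) (fun p => by simp)
    (finite_setOf_single_le fun _ => Set.Subsingleton.finite fun _ hp _ hq =>
      (adjSwap u k).injective (hp.trans hq.symm))

theorem coeff_subst_swapSubst {A : Type*} [Ring A] (f : MvPowerSeries (I × ℕ) A)
    (m : I × ℕ →₀ ℕ) :
    coeff m ((swapSubst u k).subst f) = coeff (Finsupp.mapDomain (adjSwap u k) m) f := by
  have h1 : ∀ n, (swapSubst u k).exponent n = Finsupp.mapDomain (adjSwap u k) n :=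
    fun n => monomialSubst_exponent_eq_mapDomain _ _ n
  have hinj : Function.Injective (swapSubst u k).exponent := fun n n' h => by
    rw [h1, h1] at h
    exact Finsupp.mapDomain_injective (adjSwap u k).injective h
  have h2 := coeff_subst_of_injective (swapSubst u k) hinj (fun _ => rfl) f
    (Finsupp.mapDomain (adjSwap u k) m)
  rwa [h1, mapDomain_adjSwap_mapDomain] at h2

theorem coeff_schurProd_adjSwap (lam : Multipartition I) (m : I × ℕ →₀ ℕ) :
    coeff (Finsupp.mapDomain (adjSwap u k) m) (schurProd lam) = coeff m (schurProd lam) := by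
  rw [← coeff_subst_swapSubst, schurProd, map_prod]
  congr 1
  exact Finset.prod_congr rfl fun v _ => MvPowerSeries.ext fun n => by
    rw [coeff_subst_swapSubst, coeff_schur_adjSwap]

variable {R : Type*} [Ring R] (b : Module.Basis I ℤ R)

theorem coeff_genFun_adjSwap (m : I × ℕ →₀ ℕ) :
    coeff (Finsupp.mapDomain (adjSwap u k) m) (genFun b) = coeff m (genFun b) := by
  rw [← coeff_subst_swapSubst, genFun_eq_intExp,
    subst_intExp _ (fun _ _ _ => rfl) (constantCoeff_one_add_linSeries _), map_add, map_one]
  congr 3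
  refine MvPowerSeries.ext fun n => ?_
  rw [coeff_subst_swapSubst]
  by_cases h : ∃ p, n = Finsupp.single p 1
  · obtain ⟨p, rfl⟩ := h
    rw [Finsupp.mapDomain_single, coeff_linSeries_single, coeff_linSeries_single, adjSwap_fst]
  · push Not at h
    rw [coeff_linSeries_of_forall_ne _ h, coeff_linSeries_of_forall_ne]
    intro p hp
    refine h (adjSwap u k p) ?_
    rw [← mapDomain_adjSwap_mapDomain u k n, hp, Finsupp.mapDomain_single]

theorem indexWeight_adjSwap_lt {m : I × ℕ →₀ ℕ} (h : m (u, k) < m (u, k + 1)) :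
    indexWeight (Finsupp.mapDomain (adjSwap u k) m) < indexWeight m := by
  classical
  have h1 : Finsupp.mapDomain (adjSwap u k) m +
      Finsupp.single (u, k + 1) (m (u, k + 1) - m (u, k)) =
      m + Finsupp.single (u, k) (m (u, k + 1) - m (u, k)) := Finsupp.ext fun p => by
    rw [Finsupp.add_apply, Finsupp.add_apply, mapDomain_adjSwap_apply]
    by_cases h1 : p = (u, k)
    · subst h1
      rw [adjSwap_left, Finsupp.single_eq_same, Finsupp.single_eq_of_ne (by simp)]
      omega
    · by_cases h2 : p = (u, k + 1)
      · subst h2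
        rw [adjSwap_right, Finsupp.single_eq_same, Finsupp.single_eq_of_ne (by simp)]
        omega
      · rw [adjSwap_of_ne h1 h2, Finsupp.single_eq_of_ne h1, Finsupp.single_eq_of_ne h2]
  have h2 := congrArg indexWeight h1
  rw [map_add, map_add, indexWeight_single, indexWeight_single, mul_add, mul_one] at h2
  simp only at h2
  omega

open Classical in
/-- The cells `(i, j)` with `j < m (u, i)`. -/
def exponentCells (m : I × ℕ →₀ ℕ) : Finset (ℕ × ℕ) :=
  m.support.biUnion fun p => if p.1 = u then {p.2} ×ˢ range (m p) else ∅

theorem mem_exponentCells {u : I} {m : I × ℕ →₀ ℕ} {c : ℕ × ℕ} :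
    c ∈ exponentCells u m ↔ c.2 < m (u, c.1) := by
  classical
  obtain ⟨i, j⟩ := c
  rw [exponentCells, Finset.mem_biUnion]
  constructor
  · rintro ⟨⟨v, i'⟩, -, hj⟩
    split_ifs at hj with hv
    · subst hv
      simp only [Finset.mem_product, Finset.mem_singleton, Finset.mem_range] at hj
      obtain ⟨rfl, hj⟩ := hj
      exact hj
    · simp at hj
  · intro hj
    refine ⟨(u, i), Finsupp.mem_support_iff.2 (Nat.ne_zero_of_lt hj), ?_⟩
    simpa using hj

/-- The Young diagram with the row lengths `m (u, 0) ≥ m (u, 1) ≥ ⋯`. -/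
def exponentDiagram (m : I × ℕ →₀ ℕ) (h : Antitone fun i => m (u, i)) : YoungDiagram where
  cells := exponentCells u m
  isLowerSet c c' hle hc := by
    rw [Finset.mem_coe, mem_exponentCells] at hc ⊢
    exact (hle.2.trans_lt hc).trans_le (h hle.1)

theorem mem_exponentDiagram {u : I} {m : I × ℕ →₀ ℕ} {h : Antitone fun i => m (u, i)}
    {c : ℕ × ℕ} : c ∈ exponentDiagram u m h ↔ c.2 < m (u, c.1) := mem_exponentCells

theorem exists_leadingExponent_eq {m : I × ℕ →₀ ℕ} (h : ∀ u, Antitone fun i => m (u, i)) :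
    ∃ lam : Multipartition I, m = leadingExponent lam := by
  classical
  have hfin : {u | exponentDiagram u m (h u) ≠ ⊥}.Finite := by
    refine (m.support.image Prod.fst).finite_toSet.subset fun u hu => ?_
    by_contra h2
    refine hu ?_
    ext ⟨i, j⟩
    rw [YoungDiagram.mem_cells, mem_exponentDiagram]
    refine ⟨fun h3 => absurd ?_ h2, fun h3 => absurd h3 (YoungDiagram.notMem_bot _)⟩
    exact Finset.mem_coe.2 (Finset.mem_image.2
      ⟨(u, i), Finsupp.mem_support_iff.2 (Nat.ne_zero_of_lt h3), rfl⟩)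
  let lam : Multipartition I := ⟨fun u => exponentDiagram u m (h u), hfin⟩
  refine ⟨lam, Finsupp.ext fun p => ?_⟩
  refine eq_of_forall_lt_iff fun j => ?_
  rw [← Prod.mk.eta (p := p), leadingExponent_apply, ← YoungDiagram.mem_iff_lt_rowLen,
    mem_exponentDiagram]

/-- If the exponents decrease weakly in each set of variables they are row lengths. Otherwise some
adjacent pair increases, and exchanging it puts the larger exponent on the smaller index. -/
theorem exists_leadingExponent_or_adjSwap (m : I × ℕ →₀ ℕ) :
    (∃ lam : Multipartition I, m = leadingExponent lam) ∨
      ∃ u k, indexWeight (Finsupp.mapDomain (adjSwap u k) m) < indexWeight m := by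
  by_cases h : ∀ u i, m (u, i + 1) ≤ m (u, i)
  · exact Or.inl (exists_leadingExponent_eq fun u => antitone_nat_of_succ_le (h u))
  · push Not at h
    obtain ⟨u, k, h⟩ := h
    exact Or.inr ⟨u, k, indexWeight_adjSwap_lt u k h⟩

/-- The symmetry of the Schur functions and of the generating function reduces the equation at any
other monomial to one of smaller index weight. -/
theorem existsUnique_isZFamily : ∃! Z : Multipartition I → GQ R, IsZFamily b Z := by
  refine existsUnique_unitriangular (w := indexWeight) leadingExponent_injective
    (fun lam => (isLeading_schurProd lam).1) (fun lam m h => ((isLeading_schurProd lam).2 m h).2)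
    finite_coeff_schurProd_ne_zero _ fun m => ?_
  refine (exists_leadingExponent_or_adjSwap m).imp_right ?_
  rintro ⟨u, k, h⟩
  exact ⟨_, h, fun lam => coeff_schurProd_adjSwap u k lam m, coeff_genFun_adjSwap u k b m⟩

/-- The chosen `Z` satisfies the defining identity since a solution exists; unitriangularity then
identifies its span with `coeffSpan`. -/
theorem GZ_eq : GZ b = Subalgebra.toSubmodule (genSubalgebra b) := by
  rw [← coeffSpan_eq]
  exact span_range_unitriangular (w := indexWeight) leadingExponent_injective
    (fun lam => (isLeading_schurProd lam).1) (fun lam m h => ((isLeading_schurProd lam).2 m h).2)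
    finite_coeff_schurProd_ne_zero
    (Classical.epsilon_spec (existsUnique_isZFamily b).exists)

end Symmetry

end WreathGrothendieck
end

open WreathGrothendieck in
theorem theorem6p5 {R : Type*} [Ring R] {I : Type*} (b : Module.Basis I ℤ R) :
    -- the relations hold in `G_∞^ℚ(R)`
    (∀ U V : R, tripleSeries (E U) (E (V * U)) (E V) = tripleSeriesRev (E U) (E (U * V)) (E V)) ∧
    SumRelation b (E : R → PowerSeries (GQ R)) ∧
    -- they present `G_∞^ℚ(R)` on the generators `e_r(u)`: the second family expresses the series
    -- `𝓔_W`, `W ∈ R`, through the generators, and the first family is then imposed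
    (∃ 𝓔 : R → PowerSeries (Free I), IsSymbolFamily b 𝓔 ∧ (∀ 𝓔', IsSymbolFamily b 𝓔' → 𝓔' = 𝓔) ∧
      ∃ φ : RingQuot (CommutationRel b 𝓔) ≃ₐ[ℚ] GQ R,
        (∀ (u : I) (r : ℕ+),
          φ (RingQuot.mkAlgHom ℚ (CommutationRel b 𝓔) (FreeAlgebra.ι ℚ (u, r))) = e r (b u)) ∧
        ∀ (W : R) (r : ℕ),
          φ (RingQuot.mkAlgHom ℚ (CommutationRel b 𝓔) (PowerSeries.coeff r (𝓔 W))) = e r W) ∧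
    -- `G_∞^ℤ(R)` is well defined, and is the `ℤ`-subalgebra generated by the `e_r(u)`
    (∃! Z : Multipartition I → GQ R, IsZFamily b Z) ∧
    GZ b = Subalgebra.toSubmodule
      (Algebra.adjoin ℤ {x : GQ R | ∃ (u : I) (r : ℕ+), x = e r (b u)}) := by
  obtain ⟨𝓔, h, hu⟩ := exists_isSymbolFamily b
  refine ⟨fun U V => isLieExpFamily_E.triple (isLieFamily_tau R) U V,
    isLieExpFamily_E.sumRelation b, ⟨𝓔, h, hu, exists_presentation h⟩,
    existsUnique_isZFamily b, GZ_eq b⟩
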